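/- Let $M$ be a smooth manifold, let $B\in\Omega^2(M)$ and let $X\in\chi(M)$ be a vector field with flow $\phi$ ($\frac{d}{dt}\phi_t=X\circ\phi_t$, $\phi_0=\mathrm{id}$; $X$ need not be complete). For a bivector field $\pi$ write $\pi^\sharp\xi=\iota_\xi\pi$ and let $\wedge^2\tilde\pi:\Omega^2(M)\to\chi^2(M)$ be induced by $\xi_1\wedge\xi_2\mapsto\pi^\sharp\xi_1\wedge\pi^\sharp\xi_2$; for a 2-form $C$ write $C^\flat v=\iota_vC$, and, where $1+C^\flat\pi^\sharp$ is invertible, let $e^C\pi$ be the unique bivector whose graph $\{\pi'^\sharp\xi+\xi\}\subset TM\oplus T^*M$ (with $\pi'=e^C\pi$) is the image of the graph of $\pi$ under $Y+\eta\mapsto Y+\eta+\iota_YC$. Consider the vector field $\mathcal Y^{(B,X)}$ on $\Omega^3(M)\oplus\chi^2(M)$ given by $$\mathcal Y^{(B,X)}|_{(H,\pi)}=\bigl(-dB,\ -\mathcal L_X\pi+\wedge^2\tilde\pi(B-\iota_XH)\bigr),$$ where $\mathcal L_X\pi$ is the Lie derivative, so that $-\mathcal L_X\pi=\frac{d}{dt}\big|_{t=0}(\phi_t)_*\pi$.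 Let $(H,\pi)\in\Omega^3(M)\oplus\chi^2(M)$. There is a unique family $D_t$ of 2-forms, defined at the points where $\phi_t$ is defined, with $D_0=0$ and $\frac{d}{dt}D_t=t\,\phi_t^*\iota_XdB$. Put $$C_t^H=D_t+\int_0^t\phi_s^*(B-\iota_XH)\,ds .$$ Then the integral curve of $\mathcal Y^{(B,X)}$ starting at $(H,\pi)$ is $$t\mapsto\bigl(H-t\,dB,\ (\phi_t)_*e^{C_t^H}\pi\bigr),$$ as long as $\phi_t$ is defined and $1+(C_t^H)^\flat\pi^\sharp$ is invertible. Precisely: let $W\subseteq\mathbb R\times M$ be the set of $(t,y)$ such that $\phi_{-t}(y)$ is defined and $1+(C_t^H)^\flat\pi^\sharp$ is invertible at $\phi_{-t}(y)$. Then $W$ is open and contains $\{0\}\times M$; the curve takes the value $(H,\pi)$ at $t=0$, is smooth in $(t,y)\in W$, and its $t$-derivative at every $(t,y)\in W$ is the value at $y$ of $\mathcal Y^{(B,X)}$ at the curve; and if $J\ni 0$ is an open interval with $J\times M\subseteq W$, it is the only smooth integral curve $J\to\Omega^3(M)\oplus\chi^2(M)$ of $\mathcal Y^{(B,X)}$ starting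 at $(H,\pi)$. -/

import Mathlib

open scoped Manifold ContDiff Topology
open Set

noncomputable section

namespace TwistedPoisson

/-! ### Linear algebra of the pair `E`, `E*` -/

section Linear

variable {E : Type*} [NormedAddCommGroup E] [NormedSpace ℝ E]

variable (E) in
/-- Alternating `k`-linear forms on `E`, that is `∧ᵏ E*`. -/
abbrev Form (k : ℕ) : Type _ := E [⋀^Fin k]→L[ℝ] ℝ

variable (E) in
/-- Bivectors on the finite-dimensional space `E`, seen as alternating bilinear forms on `E*`;
the bivector `v ∧ w` is `(ξ, η) ↦ ξ v * η w - ξ w * η v`. -/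
abbrev Bivector : Type _ := Form (E →L[ℝ] ℝ) 2

/-- The contraction `ι_v β = β(v, ·, …, ·)`. -/
def contract {k : ℕ} (v : E) (β : Form E (k + 1)) : Form E k := β.curryLeft v

/-- Pull-back `β ↦ β(L ·, …, L ·)` of forms by a linear map. -/
def pullForm {k : ℕ} (L : E →L[ℝ] E) (β : Form E k) : Form E k := β.compContinuousLinearMap L

/-- The transpose `ξ ↦ ξ ∘ L` of a linear map. -/
def transpose (L : E →L[ℝ] E) : (E →L[ℝ] ℝ) →L[ℝ] (E →L[ℝ] ℝ) :=
  (ContinuousLinearMap.compL ℝ E E ℝ).flip L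

/-- Push-forward of bivectors by a linear map: `(L_* π)(ξ, η) = π(ξ ∘ L, η ∘ L)`. -/
def pushBivector (L : E →L[ℝ] E) (π : Bivector E) : Bivector E :=
  π.compContinuousLinearMap (transpose L)

/-- The map `v ↦ B(v, ·)` of an alternating bilinear form `B`. For a 2-form on `E` it is the
contraction in the first component `B^♭ : E → E*`. -/
def flat {F : Type*} [NormedAddCommGroup F] [NormedSpace ℝ F] (B : Form F 2) :
    F →L[ℝ] (F →L[ℝ] ℝ) :=
  ((ContinuousAlternatingMap.ofSubsingletonLIE (𝕜 := ℝ) (E := F) (F := ℝ)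
    (0 : Fin 1)).symm.toContinuousLinearEquiv : (F [⋀^Fin 1]→L[ℝ] ℝ) →L[ℝ] (F →L[ℝ] ℝ)).comp
    B.curryLeft

theorem flat_apply {F : Type*} [NormedAddCommGroup F] [NormedSpace ℝ F]
    (B : Form F 2) (v w : F) : flat B v w = B ![v, w] := by
  simp only [flat]
  change B (Matrix.vecCons v fun _ => w) = _
  congr 1
  ext i
  fin_cases i <;> rfl

theorem apply_swap {F : Type*} [NormedAddCommGroup F] [NormedSpace ℝ F]
    (B : Form F 2) (v w : F) : B ![v, w] = - B ![w, v] := by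
  have h := B.toAlternatingMap.map_swap ![w, v] (i := 0) (j := 1) (by decide)
  refine Eq.trans ?_ h
  change B _ = B _
  congr 1
  ext i
  fin_cases i <;> rfl

/-- The derivation `(α, β) ↦ π(α ∘ T, β) + π(α, β ∘ T)` induced by an endomorphism `T` of `E`
on bivectors (see `derivBivector_apply`), i.e. `v ∧ w ↦ T v ∧ w + v ∧ T w`. -/
def derivBivector (T : E →L[ℝ] E) (π : Bivector E) : Bivector E :=
  pushBivector (ContinuousLinearMap.id ℝ E + T) π - π - pushBivector T π

theorem pushBivector_apply (L : E →L[ℝ] E) (π : Bivector E) (α β : E →L[ℝ] ℝ) :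
    pushBivector L π ![α, β] = π ![α.comp L, β.comp L] := by
  change π (transpose L ∘ ![α, β]) = _
  congr 1
  ext i
  fin_cases i <;> rfl

theorem derivBivector_apply (T : E →L[ℝ] E) (π : Bivector E) (α β : E →L[ℝ] ℝ) :
    derivBivector T π ![α, β] = π ![α.comp T, β] + π ![α, β.comp T] := by
  simp only [derivBivector, ContinuousAlternatingMap.sub_apply, pushBivector_apply]
  simp only [← flat_apply, ContinuousLinearMap.comp_add, ContinuousLinearMap.comp_id, map_add,
    add_apply]
  ring

/-- The Schouten bracket `[X, π]` of a vector field and a bivector field on the vector space `E`,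
which is the Lie derivative of `π` along `X`; in components
`[X, π]^{ij} = X^k ∂_k π^{ij} - π^{kj} ∂_k X^i - π^{ik} ∂_k X^j`. -/
def schoutenInner (X : E → E) (π : E → Bivector E) (u : E) : Bivector E :=
  fderiv ℝ π u (X u) - derivBivector (fderiv ℝ X u) (π u)

/-- `[X, Y ∧ Z] = [X, Y] ∧ Z + Y ∧ [X, Z]`, with the usual Lie bracket of vector fields. -/
theorem schoutenInner_decomposable {X Y Z : E → E} {π : E → Bivector E} {u : E}
    (hY : DifferentiableAt ℝ Y u) (hZ : DifferentiableAt ℝ Z u) (hπ : DifferentiableAt ℝ π u)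
    (h : ∀ x α β, π x ![α, β] = α (Y x) * β (Z x) - α (Z x) * β (Y x)) (α β : E →L[ℝ] ℝ) :
    schoutenInner X π u ![α, β] =
      (α (VectorField.lieBracket ℝ X Y u) * β (Z u) - α (Z u) * β (VectorField.lieBracket ℝ X Y u))
      + (α (Y u) * β (VectorField.lieBracket ℝ X Z u)
        - α (VectorField.lieBracket ℝ X Z u) * β (Y u)) := by
  let L : Bivector E →L[ℝ] ℝ := ContinuousAlternatingMap.apply ℝ (E →L[ℝ] ℝ) ℝ ![α, β]
  have h1 : HasFDerivAt (fun x ↦ L (π x)) (L.comp (fderiv ℝ π u)) u :=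
    L.hasFDerivAt.comp u hπ.hasFDerivAt
  have hl : ∀ (γ : E →L[ℝ] ℝ) {V : E → E}, DifferentiableAt ℝ V u →
      HasFDerivAt (fun x ↦ γ (V x)) (γ.comp (fderiv ℝ V u)) u :=
    fun γ V hV ↦ γ.hasFDerivAt.comp u hV.hasFDerivAt
  have h2 := ((hl α hY).mul (hl β hZ)).sub ((hl α hZ).mul (hl β hY))
  have h3 := congrArg (fun f ↦ f (X u)) (h1.unique (h2.congr_of_eventuallyEq
    (Filter.Eventually.of_forall fun x ↦ h x α β)))
  have h4 : fderiv ℝ π u (X u) ![α, β] = _ := h3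
  rw [schoutenInner, ContinuousAlternatingMap.sub_apply, h4, derivBivector_apply, h, h]
  simp [VectorField.lieBracket]
  ring

variable [FiniteDimensional ℝ E]

/-- `π^♯ : E* → E`, the contraction `ξ ↦ ι_ξ π` of a bivector in its first component, written in
a basis `e_i` of `E` as `ξ ↦ ∑ π(ξ, e^i) e_i`. See `apply_sharp` for the basis-free form. -/
def sharp (π : Bivector E) : (E →L[ℝ] ℝ) →L[ℝ] E :=
  ∑ i, ((flat π).flip (LinearMap.toContinuousLinearMap
    ((Module.finBasis ℝ E).coord i))).smulRight (Module.finBasis ℝ E i)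

theorem apply_sharp (π : Bivector E) (ξ η : E →L[ℝ] ℝ) : η (sharp π ξ) = π ![ξ, η] := by
  have h : η = ∑ i, η (Module.finBasis ℝ E i) •
      (LinearMap.toContinuousLinearMap ((Module.finBasis ℝ E).coord i) : E →L[ℝ] ℝ) := by
    ext v
    conv_lhs => rw [← (Module.finBasis ℝ E).sum_repr v]
    simp only [map_sum, map_smul, sum_apply, smul_apply]
    exact Finset.sum_congr rfl fun i _ ↦ mul_comm _ _
  rw [← flat_apply]
  conv_rhs => rw [h]
  simp [sharp, mul_comm]

/-- `∧²π̃ = ½ (π^♯ ∧ π^♯) : ∧²E* → ∧²E`, which sends `ξ₁ ∧ ξ₂` to `π^♯ξ₁ ∧ π^♯ξ₂`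
(see `wedgeTwo_decomposable`). As a bilinear form on `E*` the bivector
`∧²π̃(B)` is `(α, β) ↦ B(π^♯α, π^♯β)`. -/
def wedgeTwo (π : Bivector E) (B : Form E 2) : Bivector E := B.compContinuousLinearMap (sharp π)

/-- On a decomposable 2-form `B = ξ₁ ∧ ξ₂` one has `∧²π̃(B) = π^♯ξ₁ ∧ π^♯ξ₂`. -/
theorem wedgeTwo_decomposable (π : Bivector E) (B : Form E 2) (ξ₁ ξ₂ : E →L[ℝ] ℝ)
    (hB : ∀ v w, B ![v, w] = ξ₁ v * ξ₂ w - ξ₁ w * ξ₂ v) (α β : E →L[ℝ] ℝ) :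
    wedgeTwo π B ![α, β]
      = α (sharp π ξ₁) * β (sharp π ξ₂) - α (sharp π ξ₂) * β (sharp π ξ₁) := by
  have h1 : wedgeTwo π B ![α, β] = B ![sharp π α, sharp π β] := by
    change B (sharp π ∘ ![α, β]) = _
    congr 1
    ext i
    fin_cases i <;> rfl
  rw [h1, hB]
  simp only [apply_sharp]
  rw [apply_swap π α ξ₁, apply_swap π β ξ₂, apply_swap π α ξ₂, apply_swap π β ξ₁]
  ring

/-- The graph `{π^♯ξ + ξ}` of a bivector in `E ⊕ E*`. -/
def bivectorGraph (π : Bivector E) : Set (E × (E →L[ℝ] ℝ)) := {p | p.1 = sharp π p.2}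

/-- The map `e^B : Y + η ↦ Y + (η + ι_Y B)` of `E ⊕ E*`. -/
def expForm (B : Form E 2) (p : E × (E →L[ℝ] ℝ)) : E × (E →L[ℝ] ℝ) := (p.1, p.2 + flat B p.1)

/-- The endomorphism `1 + B^♭ π^♯` of `E*`. -/
def onePlus (B : Form E 2) (π : Bivector E) : (E →L[ℝ] ℝ) →L[ℝ] (E →L[ℝ] ℝ) :=
  ContinuousLinearMap.id ℝ (E →L[ℝ] ℝ) + (flat B).comp (sharp π)

open scoped Classical in
/-- `e^B π`: the bivector whose graph is `e^B (graph π)`. It is unique by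
`bivectorGraph_injective`, and it exists if `1 + B^♭ π^♯` is invertible by
`bivectorGraph_expBivector`. (Junk value `0` if there is none.) -/
def expBivector (B : Form E 2) (π : Bivector E) : Bivector E :=
  if h : ∃ τ : Bivector E, bivectorGraph τ = expForm B '' bivectorGraph π then h.choose else 0

theorem bivector_ext {π τ : Bivector E} (h : ∀ ξ, sharp π ξ = sharp τ ξ) : π = τ := by
  ext v
  have hv : v = ![v 0, v 1] := by
    ext i
    fin_cases i <;> rfl
  rw [hv, ← apply_sharp, ← apply_sharp, h]

theorem bivectorGraph_injective : Function.Injective (bivectorGraph (E := E)) := by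
  intro π τ h
  refine bivector_ext fun ξ ↦ ?_
  have : (sharp π ξ, ξ) ∈ bivectorGraph τ := h ▸ (rfl : sharp π ξ = sharp π ξ)
  exact this

theorem bivectorGraph_expBivector {B : Form E 2} {π : Bivector E}
    (h : (onePlus B π).IsInvertible) :
    bivectorGraph (expBivector B π) = expForm B '' bivectorGraph π := by
  suffices hex : ∃ τ : Bivector E, bivectorGraph τ = expForm B '' bivectorGraph π by
    rw [expBivector, dif_pos hex]
    exact hex.choose_spec
  obtain ⟨A, hA⟩ := h
  have hA' : ∀ ξ, A ξ = ξ + flat B (sharp π ξ) := fun ξ ↦ by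
    have := congrArg (fun f ↦ f ξ) hA
    simpa [onePlus] using this
  let τ : Bivector E := (π - wedgeTwo π B).compContinuousLinearMap
    (A.symm : (E →L[ℝ] ℝ) →L[ℝ] (E →L[ℝ] ℝ))
  have hτ : ∀ ξ, sharp τ (A ξ) = sharp π ξ := by
    intro ξ
    refine (SeparatingDual.eq_iff_forall_dual_eq (R := ℝ)).mpr fun η ↦ ?_
    obtain ⟨ζ, rfl⟩ := A.surjective η
    rw [apply_sharp]
    have h1 : τ ![A ξ, A ζ] = π ![ξ, ζ] - B ![sharp π ξ, sharp π ζ] := by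
      change (π - wedgeTwo π B) (A.symm ∘ ![A ξ, A ζ]) = _
      have : A.symm ∘ ![A ξ, A ζ] = ![ξ, ζ] := by
        ext i
        fin_cases i <;> simp
      rw [this]
      change π ![ξ, ζ] - B (sharp π ∘ ![ξ, ζ]) = _
      congr 2
      ext i
      fin_cases i <;> rfl
    rw [h1, hA' ζ, apply_swap B]
    rw [add_apply, apply_sharp, flat_apply]
    ring
  refine ⟨τ, Set.ext fun p ↦ ⟨fun hp ↦ ?_, ?_⟩⟩
  · refine ⟨(sharp π (A.symm p.2), A.symm p.2), rfl, Prod.ext ?_ ?_⟩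
    · change sharp π (A.symm p.2) = p.1
      rw [← hτ, A.apply_symm_apply]
      exact (show p.1 = sharp τ p.2 from hp).symm
    · change A.symm p.2 + flat B (sharp π (A.symm p.2)) = p.2
      rw [← hA', A.apply_symm_apply]
  · rintro ⟨q, hq, rfl⟩
    have hq' : q.1 = sharp π q.2 := hq
    change q.1 = sharp τ (q.2 + flat B q.1)
    rw [hq', ← hA', hτ]

end Linear

/-! ### Fields on a manifold

`M` is a manifold without boundary modelled on the finite-dimensional space `E`. In Mathlib each
`TangentSpace 𝓘(ℝ, E) x` is `E` itself, so `k`-forms and bivectors at `x` are elements of `Form E k`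
and `Bivector E`. -/

section Manifold

variable {E : Type*} [NormedAddCommGroup E] [NormedSpace ℝ E]
  {M : Type*} [TopologicalSpace M] [ChartedSpace E M]

variable (E M) in
/-- (Not necessarily smooth) `k`-forms on `M`. -/
abbrev FormField (k : ℕ) : Type _ := M → Form E k

variable (E M) in
/-- (Not necessarily smooth) bivector fields on `M`. -/
abbrev BivectorField : Type _ := M → Bivector E

variable (E M) in
/-- (Not necessarily smooth) vector fields on `M`. -/
abbrev VectorFieldOn : Type _ := (x : M) → TangentSpace 𝓘(ℝ, E) x

variable (E) in
/-- The differential at `x` of a map `M → M`. -/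
def tangentMapAt (f : M → M) (x : M) : E →L[ℝ] E := mfderiv 𝓘(ℝ, E) 𝓘(ℝ, E) f x

variable (E) in
/-- The differential at `x` of the chart of `M` around `x₀`. -/
def dChart (x₀ x : M) : E →L[ℝ] E := mfderiv 𝓘(ℝ, E) 𝓘(ℝ, E) (extChartAt 𝓘(ℝ, E) x₀) x

/-- The differential at `u` of the inverse of the chart of `M` around `x₀`. -/
def dChartSymm (x₀ : M) (u : E) : E →L[ℝ] E :=
  mfderiv 𝓘(ℝ, E) 𝓘(ℝ, E) (extChartAt 𝓘(ℝ, E) x₀).symm u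

/-- The coordinate expression of a form in the chart around `x₀`. -/
def formInChart {k : ℕ} (x₀ : M) (β : FormField E M k) (u : E) : Form E k :=
  pullForm (dChartSymm x₀ u) (β ((extChartAt 𝓘(ℝ, E) x₀).symm u))

/-- The coordinate expression of a bivector field in the chart around `x₀`. -/
def bivectorInChart (x₀ : M) (π : BivectorField E M) (u : E) : Bivector E :=
  pushBivector (dChart E x₀ ((extChartAt 𝓘(ℝ, E) x₀).symm u)) (π ((extChartAt 𝓘(ℝ, E) x₀).symm u))

/-- The coordinate expression of a vector field in the chart around `x₀`. -/
def vectorInChart (x₀ : M) (X : VectorFieldOn E M) (u : E) : E :=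
  dChart E x₀ ((extChartAt 𝓘(ℝ, E) x₀).symm u) (X ((extChartAt 𝓘(ℝ, E) x₀).symm u))

/-- Smooth vector fields, `X ∈ χ(M)`. -/
def IsSmoothVectorField [IsManifold 𝓘(ℝ, E) ∞ M] (X : VectorFieldOn E M) : Prop :=
  ContMDiff 𝓘(ℝ, E) 𝓘(ℝ, E).tangent ∞ (fun x ↦ (⟨x, X x⟩ : TangentBundle 𝓘(ℝ, E) M))

/-- Smooth forms, `β ∈ Ωᵏ(M)`: all coordinate expressions are smooth. -/
def IsSmoothForm {k : ℕ} (β : FormField E M k) : Prop :=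
  ∀ x₀ : M, ContDiffOn ℝ ∞ (formInChart x₀ β) (extChartAt 𝓘(ℝ, E) x₀).target

/-- Smooth bivector fields, `π ∈ χ²(M)`: all coordinate expressions are smooth. -/
def IsSmoothBivectorField (π : BivectorField E M) : Prop :=
  ∀ x₀ : M, ContDiffOn ℝ ∞ (bivectorInChart x₀ π) (extChartAt 𝓘(ℝ, E) x₀).target

/-- The part of `ℝ × E` that corresponds to `W ⊆ ℝ × M` in the chart around `x₀`. -/
def inChart (x₀ : M) (W : Set (ℝ × M)) : Set (ℝ × E) :=
  {p | p.2 ∈ (extChartAt 𝓘(ℝ, E) x₀).target ∧ (p.1, (extChartAt 𝓘(ℝ, E) x₀).symm p.2) ∈ W}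

/-- A family `β_t` of forms which is smooth in `(t, x)` jointly, for `(t, x)` in the open set
`W ⊆ ℝ × M`. -/
def IsSmoothFormFamilyOn {k : ℕ} (β : ℝ → FormField E M k) (W : Set (ℝ × M)) : Prop :=
  ∀ x₀ : M, ContDiffOn ℝ ∞ (fun p : ℝ × E ↦ formInChart x₀ (β p.1) p.2) (inChart x₀ W)

/-- A family `π_t` of bivector fields which is smooth in `(t, x)` jointly, for `(t, x)` in the
open set `W ⊆ ℝ × M`. -/
def IsSmoothBivectorFamilyOn (π : ℝ → BivectorField E M) (W : Set (ℝ × M)) : Prop :=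
  ∀ x₀ : M, ContDiffOn ℝ ∞ (fun p : ℝ × E ↦ bivectorInChart x₀ (π p.1) p.2) (inChart x₀ W)

/-- The de Rham differential, computed at `x` in the chart around `x`. -/
def deRham {k : ℕ} (β : FormField E M k) : FormField E M (k + 1) := fun x ↦
  pullForm (dChart E x x) (extDeriv (formInChart x β) (extChartAt 𝓘(ℝ, E) x x))

/-- The Schouten bracket `[X, π] = 𝓛_X π` of a vector field and a bivector field,
computed at `x` in the chart around `x`. -/
def schouten (X : VectorFieldOn E M) (π : BivectorField E M) : BivectorField E M := fun x ↦
  pushBivector (dChartSymm x (extChartAt 𝓘(ℝ, E) x x))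
    (schoutenInner (vectorInChart x X) (bivectorInChart x π) (extChartAt 𝓘(ℝ, E) x x))

/-- The contraction `ι_X β`. -/
def contractField {k : ℕ} (X : VectorFieldOn E M) (β : FormField E M (k + 1)) : FormField E M k :=
  fun x ↦ contract (X x : E) (β x)

/-! ### The flow of a vector field -/

/-- The pairs `(t, x)` for which `φ_t(x)` is defined, where `φ` is the (maximal) flow of `X`: there
is an integral curve of `X` on an open interval that contains `0` and `t`, starting at `x`. -/
def flowDomain (X : VectorFieldOn E M) : Set (ℝ × M) :=
  {p | ∃ γ : ℝ → M, ∃ a b : ℝ, (0 : ℝ) ∈ Ioo a b ∧ p.1 ∈ Ioo a b ∧ γ 0 = p.2 ∧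
    IsMIntegralCurveOn (I := 𝓘(ℝ, E)) γ X (Ioo a b)}

open scoped Classical in
/-- The flow `φ_t(x)` of `X`: the value at time `t` of the integral curve of `X` that starts at `x`
(see `flow_eq`). The value outside of `flowDomain X` is junk. -/
def flow (X : VectorFieldOn E M) (t : ℝ) (x : M) : M :=
  if h : (t, x) ∈ flowDomain X then h.choose t else x

theorem flow_eq [IsManifold 𝓘(ℝ, E) ∞ M] [T2Space M] [FiniteDimensional ℝ E]
    {X : VectorFieldOn E M} (hX : IsSmoothVectorField X)
    {γ : ℝ → M} {a b t : ℝ} (h0 : (0 : ℝ) ∈ Ioo a b) (ht : t ∈ Ioo a b)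
    (hγ : IsMIntegralCurveOn (I := 𝓘(ℝ, E)) γ X (Ioo a b)) : flow X t (γ 0) = γ t := by
  have h : (t, γ 0) ∈ flowDomain X := ⟨γ, a, b, h0, ht, rfl, hγ⟩
  have : CompleteSpace E := FiniteDimensional.complete ℝ E
  have : IsManifold 𝓘(ℝ, E) 1 M := IsManifold.of_le (n := ∞) (by norm_cast)
  rw [flow, dif_pos h]
  obtain ⟨a', b', h0', ht', hx, hγ'⟩ := h.choose_spec
  have hsub1 : Ioo (max a a') (min b b') ⊆ Ioo a b :=
    Ioo_subset_Ioo (le_max_left _ _) (min_le_left _ _)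
  have hsub2 : Ioo (max a a') (min b b') ⊆ Ioo a' b' :=
    Ioo_subset_Ioo (le_max_right _ _) (min_le_right _ _)
  exact isMIntegralCurveOn_Ioo_eqOn_of_contMDiff_boundaryless (I := 𝓘(ℝ, E)) (t₀ := 0)
    ⟨max_lt h0.1 h0'.1, lt_min h0.2 h0'.2⟩
    (ContMDiff.of_le hX (by norm_cast)) (hγ'.mono hsub2) (hγ.mono hsub1) hx
    ⟨max_lt ht.1 ht'.1, lt_min ht.2 ht'.2⟩

/-- The pull-back `φ_t^* β` by the flow of `X`, at the points where `φ_t` is defined. -/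
def flowPullback {k : ℕ} (X : VectorFieldOn E M) (t : ℝ) (β : FormField E M k) :
    FormField E M k := fun x ↦
  pullForm (tangentMapAt E (flow X t) x) (β (flow X t x))

/-- The push-forward `(φ_t)_* π` by the flow of `X`: its value at `y` is the image of
the bivector `π(x)` under the differential of `φ_t` at `x = φ_{-t}(y)`. -/
def flowPushforward (X : VectorFieldOn E M) (t : ℝ) (π : BivectorField E M) :
    BivectorField E M := fun y ↦
  pushBivector (tangentMapAt E (flow X t) (flow X (-t) y)) (π (flow X (-t) y))

/-! ### The vector field on `Ω³(M) ⊕ χ²(M)` and its candidate integral curve -/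

section Gauge

variable [FiniteDimensional ℝ E]

/-- The vector field `𝒴^{(B, X)}` on `Ω³(M) ⊕ χ²(M)`:
`(H, π) ↦ (-dB, -𝓛_X π + ∧²π̃ (B - ι_X H))`. The term `-𝓛_X π` is the derivative at `t = 0` of
`(φ_t)_* π`, for the flow `φ` of `X`. With this sign the vector field is tangent to the set of
pairs `(H, π)` with `dH = 0` and `π` an `H`-twisted Poisson structure. -/
def gaugeField (B : FormField E M 2) (X : VectorFieldOn E M)
    (m : FormField E M 3 × BivectorField E M) : FormField E M 3 × BivectorField E M :=
  (-deRham B,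
    fun y ↦ -schouten X m.2 y + wedgeTwo (m.2 y) (B y - contractField X m.1 y))

/-- The curve `t ↦ (H_t, π_t)`, with `(H_t, π_t)` defined at the points `y` with `(t, y) ∈ W`, is
an integral curve of `𝒴^{(B, X)}` there: it is smooth in `(t, y)`, and its velocity is given by
`𝒴^{(B, X)}` at each `(t, y)` in the open set `W`. For `W = J × M` this is an integral curve
`J → Ω³(M) ⊕ χ²(M)`. -/
structure IsGaugeIntegralCurveOn (B : FormField E M 2) (X : VectorFieldOn E M)
    (c : ℝ → FormField E M 3 × BivectorField E M) (W : Set (ℝ × M)) : Prop where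
  isOpen : IsOpen W
  smooth_form : IsSmoothFormFamilyOn (fun t ↦ (c t).1) W
  smooth_bivector : IsSmoothBivectorFamilyOn (fun t ↦ (c t).2) W
  deriv_form : ∀ t y, (t, y) ∈ W →
    HasDerivAt (fun s ↦ (c s).1 y) ((gaugeField B X (c t)).1 y) t
  deriv_bivector : ∀ t y, (t, y) ∈ W →
    HasDerivAt (fun s ↦ (c s).2 y) ((gaugeField B X (c t)).2 y) t

/-- `D_t` solves `dD_t/dt = t φ_t^* ι_X dB`, `D_0 = 0`, at all points where `φ_t` is defined. -/
def IsPrimitiveD (B : FormField E M 2) (X : VectorFieldOn E M) (D : ℝ → FormField E M 2) : Prop :=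
  (∀ x, D 0 x = 0) ∧ ∀ t x, (t, x) ∈ flowDomain X →
    HasDerivAt (fun s ↦ D s x) (t • flowPullback X t (contractField X (deRham B)) x) t

/-- `C_t^H = D_t + ∫₀ᵗ φ_s^*(B - ι_X H) ds`. -/
def formC (B : FormField E M 2) (X : VectorFieldOn E M) (H : FormField E M 3)
    (D : ℝ → FormField E M 2) (t : ℝ) : FormField E M 2 := fun x ↦
  D t x + ∫ s in (0 : ℝ)..t, flowPullback X s (fun y ↦ B y - contractField X H y) x

/-- The curve `t ↦ (H - t dB, (φ_t)_* e^{C_t^H} π)`. -/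
def gaugeCurve (B : FormField E M 2) (X : VectorFieldOn E M) (H : FormField E M 3)
    (π : BivectorField E M) (D : ℝ → FormField E M 2) (t : ℝ) :
    FormField E M 3 × BivectorField E M :=
  (fun y ↦ H y - t • deRham B y,
    flowPushforward X t (fun x ↦ expBivector (formC B X H D t x) (π x)))

/-- The pairs `(t, y)` at which `(φ_t)_* e^{C_t^H} π` is defined: `φ_t` reaches `y` from
`x = φ_{-t}(y)`, and `1 + (C_t^H)^♭ π^♯` is invertible at `x`. -/
def gaugeCurveDomain (B : FormField E M 2) (X : VectorFieldOn E M) (H : FormField E M 3)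
    (π : BivectorField E M) (D : ℝ → FormField E M 2) : Set (ℝ × M) :=
  {p | (-p.1, p.2) ∈ flowDomain X ∧
    (onePlus (formC B X H D p.1 (flow X (-p.1) p.2)) (π (flow X (-p.1) p.2))).IsInvertible}

end Gauge

end Manifold

end TwistedPoisson

end

open TwistedPoisson

/-!
The second component of the curve is determined by pulling it back along the orbits of `X`. Fix `x`
and put `τ_s = (φ_{-s})_* σ_s` at `x`, for a smooth family `σ_s` of bivector fields. Then `dτ/ds` is
the pull-back of `∂σ/∂s + 𝓛_X σ` (`hasDerivAt_flowPushforward_neg`), so that `σ` satisfies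
`∂σ/∂s = -𝓛_X σ + ∧²σ̃ (B - ι_X H_s)`, with `H_s = H - s dB`, exactly if
`dτ/ds = ∧²τ̃ (φ_s^* (B - ι_X H_s))` along each orbit. The form `φ_s^* (B - ι_X H_s)` is the
derivative of `C_s` (`hasDerivAt_formC`), and `dτ/ds = ∧²τ̃ (dC/ds)` is solved by `τ_s = e^{C_s} π`:
one has `(e^C π)^♯ (1 + C^♭ π^♯) = π^♯`, and differentiating this gives
`d/ds (e^{C_s} π)^♯ = -(e^{C_s} π)^♯ (dC/ds)^♭ (e^{C_s} π)^♯`, where the right-hand side is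
`(∧²τ̃ (dC/ds))^♯` (`hasDerivAt_expBivector`, `sharp_wedgeTwo`). For any other solution `τ` with
`τ_0 = π`, the difference `τ^♯ (1 + C^♭ π^♯) - π^♯` vanishes at the time `0` and solves a
homogeneous linear equation, so it vanishes identically
(`eq_expBivector_of_hasDerivAt`).

The formula for `dτ/ds` rests on the variational equation `∂_s dφ_s = dX(φ_s) ∘ dφ_s`
(`hasDerivAt_fderiv_of_flow`), which is the symmetry of the second derivatives of the flow. It needs
the flow to be smooth in the time and the initial value jointly, on an open domain. On a vector
space and for small times this is the implicit function theorem (`exists_localFlow`): the solutions on the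
time interval `[0, t]`, rescaled to `[0, 1]`, are the zeros of `g ↦ g - x - t ∫ X ∘ g` on the Banach
space `C([0, 1], E)`, and the superposition operator `g ↦ X ∘ g` is as smooth as `X`
(`contDiff_superposition`). The group law `φ_{s + t} = φ_s ∘ φ_t` and the compactness of the orbit
segment from `x` to `φ_t(x)` extend this to the whole domain of the flow (`flowRegularAt`). The same
superposition operator shows that `∫₀ᵗ F(s, p) ds` is smooth in `(t, p)`
(`contDiffAt_parametric_primitive`), and hence that `D_t` and `C_t` are smooth.
-/

noncomputable section

namespace TwistedPoisson

/-! ### Superposition operators on spaces of continuous functions -/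

section Superposition

universe u

variable {K : Type*} [TopologicalSpace K] [CompactSpace K]
  {E F : Type u} [NormedAddCommGroup E] [NormedSpace ℝ E] [NormedAddCommGroup F] [NormedSpace ℝ F]

variable (K E F) in
/-- Pointwise evaluation `(A, h) ↦ (k ↦ A k (h k))` of a continuous family of operators on a
continuous family of vectors. -/
def pointwiseEval : C(K, E →L[ℝ] F) →L[ℝ] C(K, E) →L[ℝ] C(K, F) :=
  LinearMap.mkContinuous₂
    (LinearMap.mk₂ ℝ
      (fun (A : C(K, E →L[ℝ] F)) (h : C(K, E)) ↦ (⟨fun k ↦ A k (h k), by fun_prop⟩ : C(K, F)))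
      (fun _ _ _ ↦ by ext; simp) (fun _ _ _ ↦ by ext; simp) (fun _ _ _ ↦ by ext; simp)
      (fun _ _ _ ↦ by ext; simp)) 1 fun A h ↦ by
    rw [one_mul]
    refine (ContinuousMap.norm_le _ (by positivity)).2 fun k ↦ ?_
    refine ((A k).le_opNorm (h k)).trans ?_
    gcongr
    · exact A.norm_coe_le_norm k
    · exact h.norm_coe_le_norm k

/-- The superposition operator `g ↦ f ∘ g` on `C(K, E)` has derivative `h ↦ (f' ∘ g) h`. -/
theorem hasFDerivAt_superposition (f : C(E, F)) (f' : C(E, E →L[ℝ] F))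
    (hf : ∀ x, HasFDerivAt f (f' x) x) (g : C(K, E)) :
    HasFDerivAt (fun g : C(K, E) ↦ f.comp g) (pointwiseEval K E F (f'.comp g)) g := by
  rw [hasFDerivAt_iff_isLittleO_nhds_zero, Asymptotics.isLittleO_iff]
  intro ε hε
  have hc : ContinuousAt (fun g : C(K, E) ↦ f'.comp g) g :=
    (ContinuousMap.continuous_postcomp f').continuousAt
  obtain ⟨δ, hδ, hball⟩ := Metric.eventually_nhds_iff.1
    (hc.eventually (Metric.ball_mem_nhds (f'.comp g) hε))
  filter_upwards [Metric.ball_mem_nhds (0 : C(K, E)) hδ] with h hh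
  rw [mem_ball_zero_iff] at hh
  refine (ContinuousMap.norm_le _ (by positivity)).2 fun k ↦ ?_
  have key : ‖f (g k + h k) - f (g k) - f' (g k) (g k + h k - g k)‖ ≤ ε * ‖g k + h k - g k‖ := by
    refine Convex.norm_image_sub_le_of_norm_hasFDerivWithin_le' (s := segment ℝ (g k) (g k + h k))
      (fun x _ ↦ (hf x).hasFDerivWithinAt) ?_ (convex_segment _ _) (left_mem_segment _ _ _)
      (right_mem_segment _ _ _)
    intro x hx
    rw [segment_eq_image'] at hx
    obtain ⟨r, hr, rfl⟩ := hx
    have h1 : dist (g + r • h) g < δ := by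
      rw [dist_eq_norm, add_sub_cancel_left, norm_smul, Real.norm_eq_abs, abs_of_nonneg hr.1]
      exact (mul_le_of_le_one_left (norm_nonneg _) hr.2).trans_lt hh
    have h2 := (ContinuousMap.dist_apply_le_dist k).trans (hball h1).le
    simpa [dist_eq_norm] using h2
  rw [add_sub_cancel_left] at key
  exact key.trans (mul_le_mul_of_nonneg_left (h.norm_coe_le_norm k) hε.le)

/-- The superposition operator of a `C^n` map is `C^n`. In the induction on `n` the derivative is
the superposition operator of `f'`, followed by a bounded bilinear map; it takes values in another
space, whence the quantification over `F`. -/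
theorem contDiff_superposition (n : ℕ) : ∀ {F : Type u} [NormedAddCommGroup F] [NormedSpace ℝ F]
    (f : C(E, F)), ContDiff ℝ n f → ContDiff ℝ n (fun g : C(K, E) ↦ f.comp g) := by
  induction n with
  | zero =>
    intro F _ _ f _
    exact contDiff_zero.2 (ContinuousMap.continuous_postcomp f)
  | succ n ih =>
    intro F _ _ f hf
    obtain ⟨f', hf', hd⟩ := contDiff_succ_iff_hasFDerivAt.1 hf
    refine contDiff_succ_iff_hasFDerivAt.2 ⟨fun g ↦ pointwiseEval K E F
      ((⟨f', hf'.continuous⟩ : C(E, E →L[ℝ] F)).comp g), ?_,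
      hasFDerivAt_superposition f ⟨f', hf'.continuous⟩ hd⟩
    exact (pointwiseEval K E F).contDiff.comp (ih ⟨f', hf'.continuous⟩ hf')

end Superposition

section Volterra

variable {E : Type*} [NormedAddCommGroup E] [NormedSpace ℝ E]

theorem continuous_extend {Y : Type*} [TopologicalSpace Y] (g : C(Icc (0 : ℝ) 1, Y)) :
    Continuous (IccExtend (zero_le_one' ℝ) g) := g.continuous.Icc_extend'

variable (E) in
/-- The Volterra operator `(Vg)(s) = ∫₀ˢ g` on `C([0, 1], E)`. -/
def volterra : C(Icc (0 : ℝ) 1, E) →L[ℝ] C(Icc (0 : ℝ) 1, E) :=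
  LinearMap.mkContinuous
    { toFun := fun g ↦ ⟨fun s ↦ ∫ r in (0 : ℝ)..s, IccExtend (zero_le_one' ℝ) g r,
        (intervalIntegral.continuous_primitive
          (fun _ _ ↦ (continuous_extend g).intervalIntegrable _ _) 0).comp
          continuous_subtype_val⟩
      map_add' := fun g h ↦ by
        ext s
        exact intervalIntegral.integral_add ((continuous_extend g).intervalIntegrable _ _)
          ((continuous_extend h).intervalIntegrable _ _)
      map_smul' := fun c g ↦ by
        ext s
        exact intervalIntegral.integral_smul c _ } 1 fun g ↦ by
    rw [one_mul]
    refine (ContinuousMap.norm_le _ (norm_nonneg _)).2 fun s ↦ ?_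
    refine (intervalIntegral.norm_integral_le_of_norm_le_const
      fun r _ ↦ g.norm_coe_le_norm (projIcc 0 1 zero_le_one r)).trans ?_
    rw [sub_zero, abs_of_nonneg s.2.1]
    exact mul_le_of_le_one_right (norm_nonneg _) s.2.2

theorem volterra_apply (g : C(Icc (0 : ℝ) 1, E)) (s : Icc (0 : ℝ) 1) :
    volterra E g s = ∫ r in (0 : ℝ)..s, IccExtend (zero_le_one' ℝ) g r := rfl

end Volterra

/-! ### Local flows on vector spaces -/

section LocalFlow

universe u

variable {E : Type u} [NormedAddCommGroup E] [NormedSpace ℝ E]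

/-- The map whose zeros `((l, x), g)` are the solutions `g` on `[0, 1]` of `g' = l • X(g)`,
`g 0 = x`. -/
def picardDefect (X : C(E, E)) (p : (ℝ × E) × C(Icc (0 : ℝ) 1, E)) : C(Icc (0 : ℝ) 1, E) :=
  p.2 - ContinuousLinearMap.const ℝ _ p.1.2 - p.1.1 • volterra E (X.comp p.2)

theorem contDiff_picardDefect {n : ℕ} {X : C(E, E)} (hX : ContDiff ℝ n X) :
    ContDiff ℝ n (picardDefect X) := by
  have h := contDiff_superposition (K := Icc (0 : ℝ) 1) n X hX
  unfold picardDefect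
  refine (contDiff_snd.sub ?_).sub (ContDiff.smul (contDiff_fst.comp contDiff_fst) ?_)
  · exact (ContinuousLinearMap.contDiff _).comp (contDiff_snd.comp contDiff_fst)
  · exact (ContinuousLinearMap.contDiff _).comp (h.comp contDiff_snd)

/-- At time scale `0` the linearization of the Picard equation in the curve is the identity. -/
theorem fderiv_picardDefect {n : ℕ} (hn : n ≠ 0) {X : C(E, E)} (hX : ContDiff ℝ n X) (x : E)
    (g : C(Icc (0 : ℝ) 1, E)) :
    fderiv ℝ (picardDefect X) ((0, x), g) ∘L ContinuousLinearMap.inr ℝ (ℝ × E) _ =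
      ContinuousLinearMap.id ℝ _ := by
  have h1 : HasFDerivAt (picardDefect X) (fderiv ℝ (picardDefect X) ((0, x), g)) ((0, x), g) :=
    ((contDiff_picardDefect hX).differentiable (by exact_mod_cast hn)).differentiableAt.hasFDerivAt
  have h2 := h1.comp g (hasFDerivAt_prodMk_right (𝕜 := ℝ) ((0 : ℝ), x) g)
  refine h2.unique ?_
  have h3 : picardDefect X ∘ (fun g ↦ (((0 : ℝ), x), g)) =
      fun g ↦ g - ContinuousLinearMap.const ℝ _ x := by
    ext g
    simp [picardDefect]
  rw [h3]
  exact (hasFDerivAt_id g).sub_const _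

variable [FiniteDimensional ℝ E]

/-- The zeros of `picardDefect` solve the rescaled differential equation. -/
theorem hasDerivWithinAt_of_picardDefect_eq_zero {X : C(E, E)} {l : ℝ} {x : E}
    {g : C(Icc (0 : ℝ) 1, E)} (h : picardDefect X ((l, x), g) = 0) :
    g ⟨0, by simp⟩ = x ∧ ∀ t ∈ Ico (0 : ℝ) 1, HasDerivWithinAt (IccExtend (zero_le_one' ℝ) g)
      (l • X (IccExtend (zero_le_one' ℝ) g t)) (Ici t) t := by
  have hg : ∀ s : Icc (0 : ℝ) 1, g s = x + l • ∫ r in (0 : ℝ)..s,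
      X (IccExtend (zero_le_one' ℝ) g r) := by
    intro s
    have := congrArg (fun f ↦ f s) h
    simp only [picardDefect, ContinuousMap.sub_apply, ContinuousMap.smul_apply, volterra_apply,
      ContinuousMap.zero_apply] at this
    rw [sub_sub, sub_eq_zero] at this
    exact this
  refine ⟨by rw [hg]; simp, fun t ht ↦ ?_⟩
  have hc : Continuous fun r ↦ X (IccExtend (zero_le_one' ℝ) g r) :=
    X.continuous.comp (continuous_extend g)
  have hd : HasDerivAt (fun s : ℝ ↦ x + l • ∫ r in (0 : ℝ)..s, X (IccExtend (zero_le_one' ℝ) g r))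
      (l • X (IccExtend (zero_le_one' ℝ) g t)) t :=
    ((intervalIntegral.integral_hasDerivAt_right (hc.intervalIntegrable _ _)
      (hc.stronglyMeasurableAtFilter _ _) hc.continuousAt).const_smul l).const_add x
  have hev : ∀ s ∈ Icc (0 : ℝ) 1, IccExtend (zero_le_one' ℝ) g s =
      x + l • ∫ r in (0 : ℝ)..s, X (IccExtend (zero_le_one' ℝ) g r) := by
    intro s hs
    rw [IccExtend_of_mem _ _ hs]
    exact hg ⟨s, hs⟩
  refine hd.hasDerivWithinAt.congr_of_eventuallyEq ?_ (hev t ⟨ht.1, ht.2.le⟩)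
  filter_upwards [Ico_mem_nhdsGE ht.2] with s hs
  exact hev s ⟨ht.1.trans hs.1, hs.2.le⟩

/-- The local flow of a compactly supported vector field on `E` depends smoothly on time and the
initial value jointly. The regularity is finite here, since a point where a function is `C^∞` need
not have a neighbourhood where it is `C^∞`. -/
theorem exists_localFlow {n : ℕ} (hn : n ≠ 0) {X : E → E} (hX : ContDiff ℝ n X)
    (hc : HasCompactSupport X) (x₀ : E) :
    ∃ Φ : ℝ × E → E, ContDiffAt ℝ n Φ (0, x₀) ∧ ∃ ε > 0, ∀ᶠ x in 𝓝 x₀, Φ (0, x) = x ∧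
      ∀ t ∈ Ioo (-ε) ε, HasDerivAt (fun s ↦ Φ (s, x)) (X (Φ (t, x))) t := by
  have hn' : ((n : ℕ) : ℕ∞ω) ≠ 0 := by exact_mod_cast hn
  have : CompleteSpace E := FiniteDimensional.complete ℝ E
  let Xc : C(E, E) := ⟨X, hX.continuous⟩
  let g₀ : C(Icc (0 : ℝ) 1, E) := ContinuousLinearMap.const ℝ _ x₀
  let p₀ : (ℝ × E) × C(Icc (0 : ℝ) 1, E) := ((0, x₀), g₀)
  have hP : ContDiffAt ℝ n (picardDefect Xc) p₀ := (contDiff_picardDefect (X := Xc) hX).contDiffAt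
  have hinv : (fderiv ℝ (picardDefect Xc) p₀ ∘L ContinuousLinearMap.inr ℝ (ℝ × E) _).IsInvertible :=
    (fderiv_picardDefect hn (X := Xc) hX x₀ g₀) ▸ ⟨ContinuousLinearEquiv.refl ℝ _, rfl⟩
  have hzero : picardDefect Xc p₀ = 0 := by simp [picardDefect, p₀, g₀]
  -- `ψ (l, x)` solves `g' = l • X(g)`, `g 0 = x`, so at `1` it is the flow of `X` for the time `l`
  let ψ := hP.implicitFunction hn' hinv
  have hψ : ContDiffAt ℝ n ψ (0, x₀) := hP.contDiffAt_implicitFunction hn' hinv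
  have hsol : ∀ᶠ p in 𝓝 ((0 : ℝ), x₀), picardDefect Xc (p, ψ p) = 0 := by
    have := hP.eventually_apply_implicitFunction hn' hinv
    rwa [hzero] at this
  let Φ : ℝ × E → E := fun p ↦ ψ p ⟨1, by simp⟩
  have hΦ : ContDiffAt ℝ n Φ (0, x₀) :=
    (ContinuousMap.evalCLM ℝ (M := E)
      (⟨1, by simp⟩ : Icc (0 : ℝ) 1)).contDiff.contDiffAt.comp (0, x₀) hψ
  -- the Picard–Lindelöf solutions `α` identify `Φ (·, x)` as a solution in the original time
  obtain ⟨r, hr, ε, hε, hα⟩ :=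
    ((hX.of_le (m := 1) (by exact_mod_cast Nat.one_le_iff_ne_zero.2 hn)).contDiffAt
      (x := x₀)).exists_forall_mem_closedBall_exists_eq_forall_mem_Ioo_hasDerivAt 0
  simp only [zero_sub, zero_add] at hα
  obtain ⟨C, hC⟩ := ContDiff.lipschitzWith_of_hasCompactSupport hc hX hn'
  obtain ⟨a, ha, b, hb, hab⟩ := Filter.eventually_prod_iff.1
    (by rwa [nhds_prod_eq] at hsol)
  obtain ⟨ε', hε', ha'⟩ := Metric.eventually_nhds_iff.1 ha
  refine ⟨Φ, hΦ, min ε ε', lt_min hε hε', ?_⟩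
  filter_upwards [hb, Metric.closedBall_mem_nhds x₀ hr] with x hxb hxr
  obtain ⟨α, hα0, hαd⟩ := hα x hxr
  have hΦα : ∀ t ∈ Ioo (-(min ε ε')) (min ε ε'), Φ (t, x) = α t := by
    intro t ht
    have htε : |t| < ε := (abs_lt.2 ht).trans_le (min_le_left _ _)
    have htε' : |t| < ε' := (abs_lt.2 ht).trans_le (min_le_right _ _)
    have h0 : picardDefect Xc ((t, x), ψ (t, x)) = 0 :=
      hab (ha' (by rwa [Real.dist_eq, sub_zero])) hxb
    obtain ⟨hψ0, hψd⟩ := hasDerivWithinAt_of_picardDefect_eq_zero h0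
    have hts : ∀ s ∈ Icc (0 : ℝ) 1, t * s ∈ Ioo (-ε) ε := fun s hs ↦ by
      rw [mem_Ioo, ← abs_lt, abs_mul, abs_of_nonneg hs.1]
      exact (mul_le_of_le_one_right (abs_nonneg _) hs.2).trans_lt htε
    have hαd' : ∀ s ∈ Icc (0 : ℝ) 1, HasDerivAt (fun s ↦ α (t * s)) (t • X (α (t * s))) s := by
      intro s hs
      have h1 : HasDerivAt (fun s ↦ t * s) t s := by
        simpa using (hasDerivAt_id s).const_mul t
      exact (hαd _ (hts s hs)).scomp s h1
    have huniq := ODE_solution_unique (v := fun _ y ↦ t • X y) (K := ‖t‖₊ * C) (a := 0) (b := 1)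
      (f := IccExtend (zero_le_one' ℝ) (ψ (t, x))) (g := fun s ↦ α (t * s))
      (fun _ ↦ (lipschitzWith_smul t).comp hC)
      (continuous_extend _).continuousOn hψd
      (fun s hs ↦ (hαd' s hs).continuousAt.continuousWithinAt)
      (fun s hs ↦ (hαd' s ⟨hs.1, hs.2.le⟩).hasDerivWithinAt)
      (by
        rw [IccExtend_of_mem _ _ (⟨le_rfl, zero_le_one⟩ : (0 : ℝ) ∈ Icc (0 : ℝ) 1), hψ0, mul_zero,
          hα0])
    have h1 := huniq (⟨zero_le_one, le_rfl⟩ : (1 : ℝ) ∈ Icc (0 : ℝ) 1)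
    rw [IccExtend_of_mem _ _ (⟨zero_le_one, le_rfl⟩ : (1 : ℝ) ∈ Icc (0 : ℝ) 1)] at h1
    simpa using h1
  have hpos : 0 < min ε ε' := lt_min hε hε'
  refine ⟨by rw [hΦα 0 ⟨by linarith, hpos⟩, hα0], fun t ht ↦ ?_⟩
  have h1 : (fun s ↦ Φ (s, x)) =ᶠ[𝓝 t] α := by
    filter_upwards [Ioo_mem_nhds ht.1 ht.2] with s hs using hΦα s hs
  rw [hΦα t ht]
  refine (hαd t ?_).congr_of_eventuallyEq h1
  exact ⟨(neg_le_neg (min_le_left _ _)).trans_lt ht.1, ht.2.trans_le (min_le_left _ _)⟩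

end LocalFlow

/-! ### Primitives depending on a parameter -/

section ParametricIntegral

universe u

variable {E G : Type u} [NormedAddCommGroup E] [NormedSpace ℝ E] [FiniteDimensional ℝ E]
  [NormedAddCommGroup G] [NormedSpace ℝ G]

variable (E) in
/-- The path `r ↦ (r t, p)`, as a linear function of `(t, p)`. -/
def scaledPath : (ℝ × E) →L[ℝ] C(Icc (0 : ℝ) 1, ℝ × E) :=
  LinearMap.mkContinuous
    { toFun := fun p ↦ ⟨fun r ↦ (r * p.1, p.2), by fun_prop⟩
      map_add' := fun p q ↦ by ext r <;> simp [mul_add]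
      map_smul' := fun c p ↦ by ext r <;> simp [mul_left_comm] } 1 fun p ↦ by
    rw [one_mul]
    refine (ContinuousMap.norm_le _ (norm_nonneg _)).2 fun r ↦ ?_
    refine max_le ?_ (norm_snd_le p)
    change ‖(r : ℝ) * p.1‖ ≤ _
    rw [norm_mul, Real.norm_eq_abs, abs_of_nonneg r.2.1]
    exact (mul_le_of_le_one_left (norm_nonneg _) r.2.2).trans (norm_fst_le p)

/-- `∫₀ᵗ F(s, p) ds` is smooth in `(t, p)` if `F` is smooth near the segment `[0, t] × {p}`. The
integral is written as `t ∫₀¹ F(r t, p) dr`, so that it becomes a superposition operator composed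
with linear maps. -/
theorem contDiffAt_parametric_primitive {F : ℝ × E → G} {Ω : Set (ℝ × E)} (hΩ : IsOpen Ω)
    (hF : ContDiffOn ℝ ∞ F Ω) {t₀ : ℝ} {p₀ : E} (h : ∀ r ∈ Icc (0 : ℝ) 1, (r * t₀, p₀) ∈ Ω) :
    ContDiffAt ℝ ∞ (fun q : ℝ × E ↦ ∫ s in (0 : ℝ)..q.1, F (s, q.2)) (t₀, p₀) := by
  let S : Set (ℝ × E) := range (scaledPath E (t₀, p₀))
  have hS : IsCompact S := isCompact_range (scaledPath E (t₀, p₀)).continuous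
  have hSΩ : S ⊆ Ω := by
    rintro _ ⟨r, rfl⟩
    exact h r r.2
  -- a cut-off function `χ` around the segment makes the integrand smooth on the whole space
  obtain ⟨L, hL, hSL, hLΩ⟩ := exists_compact_between hS hΩ hSΩ
  obtain ⟨χ, hχ1, hχ0, -⟩ := exists_contMDiffMap_one_nhds_of_subset_interior (n := ⊤)
    𝓘(ℝ, ℝ × E) hS.isClosed hSL
  have hχ : ContDiff ℝ ∞ χ := χ.contMDiff.contDiff
  have hF' : ContDiff ℝ ∞ fun q ↦ χ q • F q := by
    refine contDiff_iff_contDiffAt.2 fun q ↦ ?_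
    by_cases hq : q ∈ L
    · exact hχ.contDiffAt.smul (hF.contDiffAt (hΩ.mem_nhds (hLΩ hq)))
    · refine (contDiffAt_const (c := (0 : G))).congr_of_eventuallyEq ?_
      filter_upwards [hL.isClosed.isOpen_compl.mem_nhds hq] with q' hq'
      rw [hχ0 q' hq', zero_smul]
  let Fc : C(ℝ × E, G) := ⟨fun q ↦ χ q • F q, hF'.continuous⟩
  have hsm : ContDiff ℝ ∞ fun q : ℝ × E ↦
      q.1 • volterra G (Fc.comp (scaledPath E q)) ⟨1, by simp⟩ := by
    refine contDiff_fst.smul ?_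
    have h1 : ContDiff ℝ ∞ fun g : C(Icc (0 : ℝ) 1, ℝ × E) ↦ Fc.comp g :=
      contDiff_infty.2 fun n ↦ contDiff_superposition n Fc (hF'.of_le (by exact_mod_cast le_top))
    exact (ContinuousMap.evalCLM ℝ (M := G) (⟨1, by simp⟩ : Icc (0 : ℝ) 1)).contDiff.comp
      ((volterra G).contDiff.comp (h1.comp (scaledPath E).contDiff))
  refine hsm.contDiffAt.congr_of_eventuallyEq ?_
  have hopen : ∀ᶠ q in 𝓝 (t₀, p₀), MapsTo (scaledPath E q) univ (interior {z | χ z = 1}) := by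
    refine (scaledPath E).continuous.continuousAt.eventually
      ((ContinuousMap.isOpen_setOfPred_mapsTo isCompact_univ isOpen_interior).mem_nhds ?_)
    intro r _
    exact mem_interior_iff_mem_nhds.2 (Filter.eventually_of_mem (Filter.mem_of_superset
      (mem_nhdsSet_iff_forall.1 hχ1 _ (mem_range_self r)) fun _ h ↦ h) fun _ h ↦ h)
  filter_upwards [hopen] with q hq
  have h1 := intervalIntegral.smul_integral_comp_mul_left (a := 0) (b := 1)
    (fun s ↦ F (s, q.2)) q.1
  rw [mul_zero, mul_one] at h1
  rw [← h1, volterra_apply]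
  congr 1
  refine intervalIntegral.integral_congr fun r hr ↦ ?_
  rw [uIcc_of_le zero_le_one] at hr
  rw [IccExtend_of_mem _ _ hr]
  have h2 : χ (r * q.1, q.2) = 1 := interior_subset (s := {z | χ z = 1})
    (hq (mem_univ (⟨r, hr⟩ : Icc (0 : ℝ) 1)))
  change F (q.1 * r, q.2) = χ (r * q.1, q.2) • F (r * q.1, q.2)
  rw [h2, one_smul, mul_comm]

end ParametricIntegral

/-! ### Families of operators and forms on a vector space -/

section Operators

variable {V W : Type*} [NormedAddCommGroup V] [NormedSpace ℝ V] [NormedAddCommGroup W]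
  [NormedSpace ℝ W]

theorem hasDerivAt_linear (L : V →L[ℝ] W) {f : ℝ → V} {f' : V} {t : ℝ} (h : HasDerivAt f f' t) :
    HasDerivAt (fun s ↦ L (f s)) (L f') t := L.hasFDerivAt.comp_hasDerivAt t h

theorem eventually_isInvertible [CompleteSpace V] {Y : Type*} [TopologicalSpace Y]
    {A : Y → V →L[ℝ] V} {p : Y} (hA : ContinuousAt A p) (h : (A p).IsInvertible) :
    ∀ᶠ q in 𝓝 p, (A q).IsInvertible := by
  obtain ⟨e, he⟩ := h
  have h1 := e.nhds
  rw [he] at h1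
  exact hA.eventually h1

/-- Derivative of the solution `T` of an equation `T A = S` with constant `S` and invertible `A`. -/
theorem hasDerivAt_of_comp_eq_const [CompleteSpace V] {T : ℝ → V →L[ℝ] W} {A : ℝ → V →L[ℝ] V}
    {A' : V →L[ℝ] V} {S : V →L[ℝ] W} {t : ℝ} (hA : HasDerivAt A A' t) (h : (A t).IsInvertible)
    (hT : ∀ᶠ s in 𝓝 t, T s ∘L A s = S) :
    HasDerivAt T (-(T t ∘L A' ∘L (A t).inverse)) t := by
  have hinv := eventually_isInvertible hA.continuousAt h
  have hd : DifferentiableAt ℝ T t := by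
    have h0 : DifferentiableAt ℝ (fun s ↦ (A s).inverse) t :=
      DifferentiableAt.comp t
        ((h.contDiffAt_map_inverse (n := 1)).differentiableAt one_ne_zero) hA.differentiableAt
    refine ((differentiableAt_const S).clm_comp h0).congr_of_eventuallyEq ?_
    filter_upwards [hinv, hT] with s hs hTs
    rw [← hTs, ContinuousLinearMap.comp_assoc, hs.self_comp_inverse, ContinuousLinearMap.comp_id]
  have h1 := (hd.hasDerivAt.clm_comp hA).unique
    ((hasDerivAt_const t S).congr_of_eventuallyEq hT)
  have h2 : deriv T t = -(T t ∘L A' ∘L (A t).inverse) := by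
    ext1 v
    have h3 := DFunLike.congr_fun h1 ((A t).inverse v)
    simp only [add_apply, ContinuousLinearMap.comp_apply, zero_apply, h.self_apply_inverse] at h3
    exact eq_neg_of_add_eq_zero_left h3
  rw [← h2]
  exact hd.hasDerivAt

end Operators

section Forms

variable {F G P : Type*} [NormedAddCommGroup F] [NormedSpace ℝ F] [NormedAddCommGroup G]
  [NormedSpace ℝ G] [NormedAddCommGroup P] [NormedSpace ℝ P]

/-- A form is a linear function of its values on tuples of basis vectors. -/
theorem exists_form_retraction [FiniteDimensional ℝ F] (k : ℕ) :
    ∃ g : ((Fin k → Fin (Module.finrank ℝ F)) → ℝ) →L[ℝ] Form F k,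
      ∀ β : Form F k, g (fun t ↦ β fun i ↦ Module.finBasis ℝ F (t i)) = β := by
  let b := Module.finBasis ℝ F
  let ev : Form F k →ₗ[ℝ] ((Fin k → Fin (Module.finrank ℝ F)) → ℝ) :=
    { toFun := fun β t ↦ β fun i ↦ b (t i)
      map_add' := fun _ _ ↦ rfl
      map_smul' := fun _ _ ↦ rfl }
  have hker : LinearMap.ker ev = ⊥ := by
    refine LinearMap.ker_eq_bot.2 fun β γ h ↦ ?_
    refine ContinuousAlternatingMap.toAlternatingMap_injective ?_
    exact b.ext_alternating fun t _ ↦ congrFun h t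
  obtain ⟨g, hg⟩ := ev.exists_leftInverse_of_injective hker
  exact ⟨LinearMap.toContinuousLinearMap g, fun β ↦ LinearMap.congr_fun hg β⟩

instance finiteDimensional_form [FiniteDimensional ℝ F] (k : ℕ) :
    FiniteDimensional ℝ (Form F k) := by
  obtain ⟨g, hg⟩ := exists_form_retraction (F := F) k
  exact Module.Finite.of_surjective (g : _ →ₗ[ℝ] Form F k)
    fun β ↦ ⟨fun t : Fin k → Fin (Module.finrank ℝ F) ↦ β fun i ↦ Module.finBasis ℝ F (t i), hg β⟩

/-- A family of forms is smooth if all its values are; the next lemma is the analogue for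
derivatives. -/
theorem contDiffAt_form [FiniteDimensional ℝ F] {k : ℕ} {n : ℕ∞ω} {f : P → Form F k} {p : P}
    (h : ∀ v, ContDiffAt ℝ n (fun q ↦ f q v) p) : ContDiffAt ℝ n f p := by
  obtain ⟨g, hg⟩ := exists_form_retraction (F := F) k
  have h1 := g.contDiff.contDiffAt.comp p (contDiffAt_pi.2 fun t ↦
    h fun i ↦ Module.finBasis ℝ F (t i))
  exact h1.congr_of_eventuallyEq (Filter.Eventually.of_forall fun q ↦ (hg (f q)).symm)

theorem hasDerivAt_form [FiniteDimensional ℝ F] {k : ℕ} {f : ℝ → Form F k} {f' : Form F k} {t : ℝ}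
    (h : ∀ v, HasDerivAt (fun s ↦ f s v) (f' v) t) : HasDerivAt f f' t := by
  obtain ⟨g, hg⟩ := exists_form_retraction (F := F) k
  have h1 := g.hasFDerivAt.comp_hasDerivAt t (hasDerivAt_pi.2 fun τ ↦
    h fun i ↦ Module.finBasis ℝ F (τ i))
  rw [hg] at h1
  exact h1.congr_of_eventuallyEq (Filter.Eventually.of_forall fun q ↦ (hg (f q)).symm)

theorem _root_.HasDerivAt.form_apply {k : ℕ} {f : ℝ → Form F k} {f' : Form F k} {t : ℝ}
    (h : HasDerivAt f f' t) (v : Fin k → F) : HasDerivAt (fun s ↦ f s v) (f' v) t :=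
  (ContinuousAlternatingMap.apply ℝ F ℝ v).hasFDerivAt.comp_hasDerivAt t h

/-- The pull-back of a form by a linear map is smooth in the form and the map jointly. -/
theorem contDiffAt_compCLM [FiniteDimensional ℝ F] {k : ℕ} {n : ℕ∞ω} {L : P → F →L[ℝ] G}
    {β : P → Form G k} {p : P} (hL : ContDiffAt ℝ n L p) (hβ : ContDiffAt ℝ n β p) :
    ContDiffAt ℝ n (fun q ↦ ((β q).compContinuousLinearMap (L q) : Form F k)) p := by
  refine contDiffAt_form fun v ↦ ?_
  have h1 : ContDiffAt ℝ n (fun q ↦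
      ContinuousMultilinearMap.compContinuousLinearMapContinuousMultilinear ℝ
        (fun _ : Fin k ↦ F) (fun _ ↦ G) ℝ (fun _ ↦ L q)) p :=
    (ContinuousMultilinearMap.contDiff _).contDiffAt.comp p (contDiffAt_pi.2 fun _ ↦ hL)
  have h2 : ContDiffAt ℝ n (fun q ↦ (β q).toContinuousMultilinearMap) p :=
    (ContinuousAlternatingMap.toContinuousMultilinearMapLI (𝕜 := ℝ) (E := G) (F := ℝ)
      (ι := Fin k)).contDiff.contDiffAt.comp p hβ
  exact (ContinuousMultilinearMap.apply ℝ (fun _ : Fin k ↦ F) ℝ v).contDiff.contDiffAt.comp p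
    (h1.clm_apply h2)

theorem two_vec {Y : Type*} (v : Fin 2 → Y) : v = ![v 0, v 1] := by
  ext i
  fin_cases i <;> rfl

theorem form_ext_two {B C : Form F 2} (h : ∀ v w, B ![v, w] = C ![v, w]) : B = C := by
  ext v
  rw [two_vec v]
  exact h _ _

theorem comp_two (B : Form G 2) (L : F →L[ℝ] G) (v w : F) :
    (B.compContinuousLinearMap L : Form F 2) ![v, w] = B ![L v, L w] := by
  change B (L ∘ ![v, w]) = _
  rw [two_vec (L ∘ ![v, w])]
  rfl

variable (F) in
/-- `B ↦ B^♭` as a linear map. -/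
def flatL [FiniteDimensional ℝ F] : Form F 2 →L[ℝ] F →L[ℝ] F →L[ℝ] ℝ :=
  LinearMap.toContinuousLinearMap
    { toFun := flat
      map_add' := fun B C ↦ by ext v w; simp [flat_apply]
      map_smul' := fun c B ↦ by ext v w; simp [flat_apply] }

theorem contDiffAt_flat [FiniteDimensional ℝ F] {n : ℕ∞ω} {B : P → Form F 2} {p : P}
    (h : ContDiffAt ℝ n B p) : ContDiffAt ℝ n (fun q ↦ flat (B q)) p := by
  have h0 : ContDiff ℝ n (flatL F) := by fun_prop
  exact h0.contDiffAt.comp p h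

theorem hasDerivAt_flat [FiniteDimensional ℝ F] {B : ℝ → Form F 2} {B' : Form F 2} {t : ℝ}
    (h : HasDerivAt B B' t) : HasDerivAt (fun s ↦ flat (B s)) (flat B') t := by
  exact hasDerivAt_linear (V := Form F 2) (W := F →L[ℝ] F →L[ℝ] ℝ) (flatL F) h

end Forms

/-! ### Linear algebra of `e^C π` and its derivative -/

section Bivectors

variable {E P : Type*} [NormedAddCommGroup E] [NormedSpace ℝ E]
  [NormedAddCommGroup P] [NormedSpace ℝ P]

theorem pullForm_two (L : E →L[ℝ] E) (B : Form E 2) (v w : E) :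
    pullForm L B ![v, w] = B ![L v, L w] := comp_two B L v w

theorem pullForm_comp {k : ℕ} (L L' : E →L[ℝ] E) (β : Form E k) :
    pullForm L (pullForm L' β) = pullForm (L' ∘L L) β := rfl

theorem pullForm_id {k : ℕ} (β : Form E k) : pullForm (ContinuousLinearMap.id ℝ E) β = β := rfl

theorem pullForm_add {k : ℕ} (L : E →L[ℝ] E) (β γ : Form E k) :
    pullForm L (β + γ) = pullForm L β + pullForm L γ := rfl

theorem pullForm_smul {k : ℕ} (L : E →L[ℝ] E) (c : ℝ) (β : Form E k) :
    pullForm L (c • β) = c • pullForm L β := rfl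

theorem pushBivector_comp (L L' : E →L[ℝ] E) (π : Bivector E) :
    pushBivector L (pushBivector L' π) = pushBivector (L ∘L L') π := rfl

theorem pushBivector_id (π : Bivector E) : pushBivector (ContinuousLinearMap.id ℝ E) π = π := rfl

theorem pushBivector_add (L : E →L[ℝ] E) (π τ : Bivector E) :
    pushBivector L (π + τ) = pushBivector L π + pushBivector L τ := rfl

theorem transpose_apply (L : E →L[ℝ] E) (ξ : E →L[ℝ] ℝ) : transpose L ξ = ξ ∘L L := rfl

theorem dual_ext {v w : E} (h : ∀ η : E →L[ℝ] ℝ, η v = η w) : v = w :=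
  (SeparatingDual.eq_iff_forall_dual_eq (R := ℝ)).mpr h

theorem flat_pullForm (L : E →L[ℝ] E) (C : Form E 2) :
    flat (pullForm L C) = transpose L ∘L flat C ∘L L := by
  ext v w
  rw [flat_apply, pullForm_two]
  exact (flat_apply C (L v) (L w)).symm

theorem transpose_comp_transpose {L L' : E →L[ℝ] E} (h : L' ∘L L = ContinuousLinearMap.id ℝ E) :
    transpose L ∘L transpose L' = ContinuousLinearMap.id ℝ (E →L[ℝ] ℝ) := by
  ext1 ξ
  change (ξ ∘L L') ∘L L = ξ
  rw [ContinuousLinearMap.comp_assoc, h, ContinuousLinearMap.comp_id]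

theorem contract_pullForm {k : ℕ} (L : E →L[ℝ] E) (v : E) (β : Form E (k + 1)) :
    contract v (pullForm L β) = pullForm L (contract (L v) β) := by
  ext w
  change β (L ∘ Matrix.vecCons v w) = β (Matrix.vecCons (L v) (L ∘ w))
  congr 1
  ext i
  refine Fin.cases rfl (fun _ ↦ rfl) i

variable [FiniteDimensional ℝ E]

theorem contDiffAt_pullForm {k : ℕ} {n : ℕ∞ω} {L : P → E →L[ℝ] E}
    {β : P → Form E k} {p : P} (hL : ContDiffAt ℝ n L p) (hβ : ContDiffAt ℝ n β p) :
    ContDiffAt ℝ n (fun q ↦ pullForm (L q) (β q)) p := contDiffAt_compCLM hL hβ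

theorem contDiffAt_pushBivector {n : ℕ∞ω} {L : P → E →L[ℝ] E}
    {π : P → Bivector E} {p : P} (hL : ContDiffAt ℝ n L p) (hπ : ContDiffAt ℝ n π p) :
    ContDiffAt ℝ n (fun q ↦ pushBivector (L q) (π q)) p := by
  have h0 : ContDiff ℝ n (transpose (E := E)) := by
    change ContDiff ℝ n (ContinuousLinearMap.compL ℝ E E ℝ).flip
    fun_prop
  exact contDiffAt_compCLM (h0.contDiffAt.comp p hL) hπ

theorem contDiffAt_contract {k : ℕ} {n : ℕ∞ω} {v : P → E}
    {β : P → Form E (k + 1)} {p : P} (hv : ContDiffAt ℝ n v p) (hβ : ContDiffAt ℝ n β p) :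
    ContDiffAt ℝ n (fun q ↦ contract (v q) (β q)) p := by
  let c : Form E (k + 1) →L[ℝ] E →L[ℝ] Form E k := LinearMap.toContinuousLinearMap
    { toFun := fun β : Form E (k + 1) ↦ (β.curryLeft : E →L[ℝ] Form E k)
      map_add' := fun _ _ ↦ rfl
      map_smul' := fun _ _ ↦ rfl }
  have h0 : ContDiff ℝ n c := by fun_prop
  exact (h0.contDiffAt.comp p hβ).clm_apply hv

/-- If `A' = T A`, then the velocity of `A_* τ` is `A_* τ'` plus the derivation induced by `T`
applied to `A_* τ`. -/
theorem hasDerivAt_pushBivector {A : ℝ → E →L[ℝ] E} {τ : ℝ → Bivector E} {T : E →L[ℝ] E}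
    {τ' : Bivector E} {t : ℝ} (hA : HasDerivAt A (T ∘L A t) t) (hτ : HasDerivAt τ τ' t) :
    HasDerivAt (fun s ↦ pushBivector (A s) (τ s))
      (pushBivector (A t) τ' + derivBivector T (pushBivector (A t) (τ t))) t := by
  refine hasDerivAt_form fun v ↦ ?_
  rw [two_vec v, ContinuousAlternatingMap.add_apply, derivBivector_apply]
  simp only [pushBivector_apply]
  simp only [← flat_apply]
  have h1 := hasDerivAt_flat hτ
  have h2 : ∀ α : E →L[ℝ] ℝ, HasDerivAt (fun s ↦ α ∘L A s) (α ∘L (T ∘L A t)) t := fun α ↦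
    (ContinuousLinearMap.compL ℝ E E ℝ α).hasFDerivAt.comp_hasDerivAt t hA
  refine ((h1.clm_apply (h2 (v 0))).clm_apply (h2 (v 1))).congr_deriv ?_
  simp only [add_apply, ContinuousLinearMap.comp_assoc]
  ring

theorem hasDerivAt_pushBivector_const (L : E →L[ℝ] E) {τ : ℝ → Bivector E}
    {τ' : Bivector E} {t : ℝ} (hτ : HasDerivAt τ τ' t) :
    HasDerivAt (fun s ↦ pushBivector L (τ s)) (pushBivector L τ') t :=
  hasDerivAt_form fun v ↦ hτ.form_apply (transpose L ∘ v)

variable (E) in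
/-- `π ↦ π^♯` as a linear map. -/
def sharpL : Bivector E →L[ℝ] (E →L[ℝ] ℝ) →L[ℝ] E :=
  LinearMap.toContinuousLinearMap
    { toFun := fun π : Bivector E ↦ sharp π
      map_add' := fun π τ ↦ by
        ext1 ξ
        refine (SeparatingDual.eq_iff_forall_dual_eq (R := ℝ)).mpr fun η ↦ ?_
        simp [apply_sharp]
      map_smul' := fun c π ↦ by
        ext1 ξ
        refine (SeparatingDual.eq_iff_forall_dual_eq (R := ℝ)).mpr fun η ↦ ?_
        simp [apply_sharp] }

theorem contDiffAt_sharp {n : ℕ∞ω} {π : P → Bivector E} {p : P} (h : ContDiffAt ℝ n π p) :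
    ContDiffAt ℝ n (fun q ↦ sharp (π q)) p := by
  have h0 : ContDiff ℝ n (sharpL E) := by fun_prop
  exact h0.contDiffAt.comp p h

theorem hasDerivAt_sharp {π : ℝ → Bivector E} {π' : Bivector E} {t : ℝ} (h : HasDerivAt π π' t) :
    HasDerivAt (fun s ↦ sharp (π s)) (sharp π') t := by
  exact hasDerivAt_linear (V := Bivector E) (W := (E →L[ℝ] ℝ) →L[ℝ] E) (sharpL E) h

theorem contDiffAt_of_sharp {n : ℕ∞ω} {π : P → Bivector E} {p : P}
    (h : ContDiffAt ℝ n (fun q ↦ sharp (π q)) p) : ContDiffAt ℝ n π p := by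
  refine contDiffAt_form fun v ↦ ?_
  rw [two_vec v]
  simp only [← apply_sharp]
  exact (v 1).contDiff.contDiffAt.comp p (h.clm_apply contDiffAt_const)

theorem hasDerivAt_of_sharp {π : ℝ → Bivector E} {π' : Bivector E} {t : ℝ}
    (h : HasDerivAt (fun s ↦ sharp (π s)) (sharp π') t) : HasDerivAt π π' t := by
  refine hasDerivAt_form fun v ↦ ?_
  rw [two_vec v]
  simp only [← apply_sharp]
  refine (v 1).hasFDerivAt.comp_hasDerivAt t ?_
  simpa using h.clm_apply (hasDerivAt_const t (v 0))

theorem sharp_pushBivector (L : E →L[ℝ] E) (π : Bivector E) :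
    sharp (pushBivector L π) = L ∘L sharp π ∘L transpose L := by
  ext ξ
  refine dual_ext fun η ↦ ?_
  rw [apply_sharp, pushBivector_apply]
  exact (apply_sharp π (ξ ∘L L) (η ∘L L)).symm

theorem sharp_wedgeTwo (τ : Bivector E) (C : Form E 2) :
    sharp (wedgeTwo τ C) = -(sharp τ ∘L flat C ∘L sharp τ) := by
  ext ξ
  refine dual_ext fun η ↦ ?_
  rw [apply_sharp, wedgeTwo, comp_two]
  have h : η (sharp τ (flat C (sharp τ ξ))) = -flat C (sharp τ ξ) (sharp τ η) := by
    rw [apply_sharp, apply_swap, ← apply_sharp]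
  simp only [neg_apply, map_neg, ContinuousLinearMap.comp_apply]
  rw [h, flat_apply, neg_neg]

theorem wedgeTwo_pushBivector (L : E →L[ℝ] E) (τ : Bivector E) (C : Form E 2) :
    wedgeTwo (pushBivector L τ) C = pushBivector L (wedgeTwo τ (pullForm L C)) := by
  refine form_ext_two fun α β ↦ ?_
  rw [wedgeTwo, comp_two, pushBivector_apply, wedgeTwo, comp_two, pullForm_two,
    sharp_pushBivector]
  rfl

theorem contDiffAt_onePlus {n : ℕ∞ω} {C : P → Form E 2} {π : P → Bivector E} {p : P}
    (hC : ContDiffAt ℝ n C p) (hπ : ContDiffAt ℝ n π p) :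
    ContDiffAt ℝ n (fun q ↦ onePlus (C q) (π q)) p :=
  contDiffAt_const.add ((contDiffAt_flat hC).clm_comp (contDiffAt_sharp hπ))

theorem sharp_expBivector_comp {C : Form E 2} {π : Bivector E} (h : (onePlus C π).IsInvertible) :
    sharp (expBivector C π) ∘L onePlus C π = sharp π := by
  ext ξ
  have h1 : expForm C (sharp π ξ, ξ) ∈ bivectorGraph (expBivector C π) := by
    rw [bivectorGraph_expBivector h]
    exact mem_image_of_mem _ rfl
  exact (show sharp π ξ = sharp (expBivector C π) (ξ + flat C (sharp π ξ)) from h1).symm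

/-- `e^C π` is characterised by `(e^C π)^♯ (1 + C^♭ π^♯) = π^♯`. -/
theorem eq_expBivector {C : Form E 2} {π τ : Bivector E} (h : (onePlus C π).IsInvertible)
    (hτ : sharp τ ∘L onePlus C π = sharp π) : τ = expBivector C π := by
  refine bivector_ext fun ξ ↦ ?_
  obtain ⟨ζ, rfl⟩ := h.surjective ξ
  have h1 := sharp_expBivector_comp h
  exact (DFunLike.congr_fun hτ ζ).trans (DFunLike.congr_fun h1 ζ).symm

theorem sharp_expBivector {C : Form E 2} {π : Bivector E} (h : (onePlus C π).IsInvertible) :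
    sharp (expBivector C π) = sharp π ∘L (onePlus C π).inverse := by
  rw [← sharp_expBivector_comp h, ContinuousLinearMap.comp_assoc, h.self_comp_inverse,
    ContinuousLinearMap.comp_id]

theorem onePlus_zero (π : Bivector E) :
    onePlus (0 : Form E 2) π = ContinuousLinearMap.id ℝ (E →L[ℝ] ℝ) := by
  have h : flat (0 : Form E 2) = 0 := map_zero (flatL E)
  ext1 ξ
  simp [onePlus, h]

theorem isInvertible_onePlus_zero (π : Bivector E) : (onePlus (0 : Form E 2) π).IsInvertible := by
  rw [onePlus_zero]
  exact ⟨ContinuousLinearEquiv.refl ℝ _, rfl⟩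

theorem expBivector_zero (π : Bivector E) : expBivector (0 : Form E 2) π = π :=
  (eq_expBivector (isInvertible_onePlus_zero π) (by
    rw [onePlus_zero, ContinuousLinearMap.comp_id])).symm

/-- `e^C π` is smooth in `C` and `π`, where it is defined. -/
theorem contDiffAt_expBivector {n : ℕ∞ω} {C : P → Form E 2} {π : P → Bivector E} {p : P}
    (hC : ContDiffAt ℝ n C p) (hπ : ContDiffAt ℝ n π p) (h : (onePlus (C p) (π p)).IsInvertible) :
    ContDiffAt ℝ n (fun q ↦ expBivector (C q) (π q)) p := by
  refine contDiffAt_of_sharp ?_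
  have hA := contDiffAt_onePlus hC hπ
  have h0 : ContDiffAt ℝ n (fun q ↦ (onePlus (C q) (π q)).inverse) p :=
    ContDiffAt.comp (g := ContinuousLinearMap.inverse) p h.contDiffAt_map_inverse hA
  have h1 := (contDiffAt_sharp hπ).clm_comp h0
  refine h1.congr_of_eventuallyEq ?_
  filter_upwards [eventually_isInvertible hA.continuousAt h] with q hq using sharp_expBivector hq

theorem hasDerivAt_onePlus {C : ℝ → Form E 2} {C' : Form E 2} {π : Bivector E} {t : ℝ}
    (hC : HasDerivAt C C' t) :
    HasDerivAt (fun s ↦ onePlus (C s) π) (flat C' ∘L sharp π) t := by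
  have h1 := hasDerivAt_flat hC
  have h2 := h1.clm_comp (hasDerivAt_const t (sharp π))
  rw [ContinuousLinearMap.comp_zero, add_zero] at h2
  exact HasDerivAt.const_add (𝕜 := ℝ) (F := (E →L[ℝ] ℝ) →L[ℝ] (E →L[ℝ] ℝ)) _ h2

/-- `d/dt e^{C_t} π = ∧²(e^{C_t} π)~ (dC_t/dt)`. -/
theorem hasDerivAt_expBivector {C : ℝ → Form E 2} {C' : Form E 2} {π : Bivector E} {t : ℝ}
    (hC : HasDerivAt C C' t) (h : (onePlus (C t) π).IsInvertible) :
    HasDerivAt (fun s ↦ expBivector (C s) π) (wedgeTwo (expBivector (C t) π) C') t := by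
  refine hasDerivAt_of_sharp ?_
  have hA := hasDerivAt_onePlus (π := π) hC
  have hinv : ∀ᶠ s in 𝓝 t, (onePlus (C s) π).IsInvertible :=
    eventually_isInvertible (A := fun s ↦ onePlus (C s) π) hA.continuousAt h
  have h1 := hasDerivAt_of_comp_eq_const (V := E →L[ℝ] ℝ) (W := E)
    (T := fun s ↦ sharp (expBivector (C s) π)) hA h
    (hinv.mono fun q hq ↦ sharp_expBivector_comp hq)
  have h2 : -(sharp (expBivector (C t) π) ∘L (flat C' ∘L sharp π) ∘L (onePlus (C t) π).inverse) =
      sharp (wedgeTwo (expBivector (C t) π) C') := by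
    rw [sharp_wedgeTwo, ← sharp_expBivector_comp h]
    ext1 ξ
    simp only [ContinuousLinearMap.comp_apply, neg_apply, h.self_apply_inverse]
  rwa [h2] at h1

theorem onePlus_conj {L L' : E →L[ℝ] E} (h : L' ∘L L = ContinuousLinearMap.id ℝ E)
    (h' : L ∘L L' = ContinuousLinearMap.id ℝ E) (C : Form E 2) (π : Bivector E) :
    onePlus (pullForm L' C) (pushBivector L π) = transpose L' ∘L onePlus C π ∘L transpose L := by
  ext1 ξ
  rw [onePlus, flat_pullForm, sharp_pushBivector, onePlus]
  have h1 : ∀ v, L' (L v) = v := fun v ↦ DFunLike.congr_fun h v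
  have h2 : transpose L' (transpose L ξ) = ξ := by
    rw [transpose_apply, transpose_apply, ContinuousLinearMap.comp_assoc, h',
      ContinuousLinearMap.comp_id]
  simp [h1, h2]

theorem isInvertible_onePlus_conj {L L' : E →L[ℝ] E} (h : L' ∘L L = ContinuousLinearMap.id ℝ E)
    (h' : L ∘L L' = ContinuousLinearMap.id ℝ E) {C : Form E 2} {π : Bivector E}
    (hC : (onePlus C π).IsInvertible) :
    (onePlus (pullForm L' C) (pushBivector L π)).IsInvertible := by
  rw [onePlus_conj h h']
  have h1 := transpose_comp_transpose h
  have h2 := transpose_comp_transpose h'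
  exact (ContinuousLinearMap.IsInvertible.of_inverse h2 h1).comp
    (hC.comp (ContinuousLinearMap.IsInvertible.of_inverse h1 h2))

/-- `e^C π` is natural under linear isomorphisms `L`, with inverse `L'`. -/
theorem expBivector_conj {L L' : E →L[ℝ] E} (h : L' ∘L L = ContinuousLinearMap.id ℝ E)
    (h' : L ∘L L' = ContinuousLinearMap.id ℝ E) {C : Form E 2} {π : Bivector E}
    (hC : (onePlus C π).IsInvertible) :
    pushBivector L (expBivector C π) = expBivector (pullForm L' C) (pushBivector L π) := by
  refine eq_expBivector (isInvertible_onePlus_conj h h' hC) ?_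
  rw [onePlus_conj h h', sharp_pushBivector, sharp_pushBivector, ← sharp_expBivector_comp hC]
  have h1 := transpose_comp_transpose h
  ext1 ξ
  have h2 := DFunLike.congr_fun h1 (onePlus C π (transpose L ξ))
  exact congrArg (fun ζ ↦ L (sharp (expBivector C π) ζ)) h2

end Bivectors

/-! ### Coordinate expressions on the manifold -/

section Charts

variable {E : Type*} [NormedAddCommGroup E] [NormedSpace ℝ E]
  {M : Type*} [TopologicalSpace M] [ChartedSpace E M] [IsManifold 𝓘(ℝ, E) ∞ M]

omit [IsManifold 𝓘(ℝ, E) ∞ M] in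
theorem isOpen_chart_target (x₀ : M) : IsOpen (extChartAt 𝓘(ℝ, E) x₀).target :=
  isOpen_extChartAt_target x₀

theorem isManifold_one : IsManifold 𝓘(ℝ, E) 1 M := IsManifold.of_le (n := ∞) (by norm_cast)

theorem mdifferentiableAt_chart {x₀ x : M} (hx : x ∈ (extChartAt 𝓘(ℝ, E) x₀).source) :
    MDifferentiableAt 𝓘(ℝ, E) 𝓘(ℝ, E) (extChartAt 𝓘(ℝ, E) x₀) x := by
  have := isManifold_one (E := E) (M := M)
  exact mdifferentiableAt_extChartAt (by rwa [extChartAt_source] at hx)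

theorem mdifferentiableAt_chart_symm {x₀ : M} {u : E} (hu : u ∈ (extChartAt 𝓘(ℝ, E) x₀).target) :
    MDifferentiableAt 𝓘(ℝ, E) 𝓘(ℝ, E) (extChartAt 𝓘(ℝ, E) x₀).symm u := by
  have := isManifold_one (E := E) (M := M)
  have h := mdifferentiableWithinAt_extChartAt_symm (I := 𝓘(ℝ, E)) hu
  rwa [modelWithCornersSelf_coe, range_id, mdifferentiableWithinAt_univ] at h

theorem dChart_comp_dChartSymm {x₀ : M} {u : E} (hu : u ∈ (extChartAt 𝓘(ℝ, E) x₀).target) :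
    dChart E x₀ ((extChartAt 𝓘(ℝ, E) x₀).symm u) ∘L dChartSymm x₀ u =
      ContinuousLinearMap.id ℝ E := by
  have := isManifold_one (E := E) (M := M)
  have h := mfderiv_extChartAt_comp_mfderivWithin_extChartAt_symm (I := 𝓘(ℝ, E)) hu
  rw [modelWithCornersSelf_coe, range_id, mfderivWithin_univ] at h
  exact h

theorem dChartSymm_comp_dChart {x₀ : M} {u : E} (hu : u ∈ (extChartAt 𝓘(ℝ, E) x₀).target) :
    dChartSymm x₀ u ∘L dChart E x₀ ((extChartAt 𝓘(ℝ, E) x₀).symm u) =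
      ContinuousLinearMap.id ℝ E := by
  have := isManifold_one (E := E) (M := M)
  have h := mfderivWithin_extChartAt_symm_comp_mfderiv_extChartAt (I := 𝓘(ℝ, E)) hu
  rw [modelWithCornersSelf_coe, range_id, mfderivWithin_univ] at h
  exact h

theorem dChartSymm_comp_dChart' {x₀ x : M} (hx : x ∈ (extChartAt 𝓘(ℝ, E) x₀).source) :
    dChartSymm x₀ (extChartAt 𝓘(ℝ, E) x₀ x) ∘L dChart E x₀ x = ContinuousLinearMap.id ℝ E := by
  have h := dChartSymm_comp_dChart ((extChartAt 𝓘(ℝ, E) x₀).map_source hx)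
  rwa [(extChartAt 𝓘(ℝ, E) x₀).left_inv hx] at h

theorem dChart_comp_dChartSymm' {x₀ x : M} (hx : x ∈ (extChartAt 𝓘(ℝ, E) x₀).source) :
    dChart E x₀ x ∘L dChartSymm x₀ (extChartAt 𝓘(ℝ, E) x₀ x) = ContinuousLinearMap.id ℝ E := by
  have h := dChart_comp_dChartSymm ((extChartAt 𝓘(ℝ, E) x₀).map_source hx)
  rwa [(extChartAt 𝓘(ℝ, E) x₀).left_inv hx] at h

/-- A form is recovered from its coordinate expression. -/
theorem eq_pullForm_formInChart {k : ℕ} (β : FormField E M k) {x₀ x : M}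
    (hx : x ∈ (extChartAt 𝓘(ℝ, E) x₀).source) :
    β x = pullForm (dChart E x₀ x) (formInChart x₀ β (extChartAt 𝓘(ℝ, E) x₀ x)) := by
  rw [formInChart, pullForm_comp, dChartSymm_comp_dChart' hx, (extChartAt 𝓘(ℝ, E) x₀).left_inv hx,
    pullForm_id]

/-- A bivector field is recovered from its coordinate expression. -/
theorem eq_pushBivector_bivectorInChart (π : BivectorField E M) {x₀ x : M}
    (hx : x ∈ (extChartAt 𝓘(ℝ, E) x₀).source) :
    π x = pushBivector (dChartSymm x₀ (extChartAt 𝓘(ℝ, E) x₀ x))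
      (bivectorInChart x₀ π (extChartAt 𝓘(ℝ, E) x₀ x)) := by
  rw [bivectorInChart, (extChartAt 𝓘(ℝ, E) x₀).left_inv hx, pushBivector_comp,
    dChartSymm_comp_dChart' hx, pushBivector_id]

omit [IsManifold 𝓘(ℝ, E) ∞ M] in
theorem bivectorInChart_chart (π : BivectorField E M) {x₀ x : M}
    (hx : x ∈ (extChartAt 𝓘(ℝ, E) x₀).source) :
    bivectorInChart x₀ π (extChartAt 𝓘(ℝ, E) x₀ x) = pushBivector (dChart E x₀ x) (π x) := by
  rw [bivectorInChart, (extChartAt 𝓘(ℝ, E) x₀).left_inv hx]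

/-- The derivative of a coordinate expression of a map `f : M → M` is its differential, written
in charts. -/
theorem hasFDerivAt_inCharts {f : M → M} {x₁ x₂ : M} {u : E}
    (hu : u ∈ (extChartAt 𝓘(ℝ, E) x₁).target)
    (hf : MDifferentiableAt 𝓘(ℝ, E) 𝓘(ℝ, E) f ((extChartAt 𝓘(ℝ, E) x₁).symm u))
    (hfu : f ((extChartAt 𝓘(ℝ, E) x₁).symm u) ∈ (extChartAt 𝓘(ℝ, E) x₂).source) :
    HasFDerivAt (fun v ↦ extChartAt 𝓘(ℝ, E) x₂ (f ((extChartAt 𝓘(ℝ, E) x₁).symm v)))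
      (dChart E x₂ (f ((extChartAt 𝓘(ℝ, E) x₁).symm u)) ∘L
        tangentMapAt E f ((extChartAt 𝓘(ℝ, E) x₁).symm u) ∘L dChartSymm x₁ u) u := by
  have h := ((mdifferentiableAt_chart hfu).hasMFDerivAt.comp _ hf.hasMFDerivAt).comp u
    (mdifferentiableAt_chart_symm hu).hasMFDerivAt
  exact hasMFDerivAt_iff_hasFDerivAt.1 h

omit [IsManifold 𝓘(ℝ, E) ∞ M] in
theorem tangentMapAt_id (x : M) : tangentMapAt E (id : M → M) x = ContinuousLinearMap.id ℝ E :=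
  mfderiv_id

/-- The coordinate expression of the pull-back of a form. -/
theorem pullForm_inCharts {k : ℕ} {f : M → M} (β : FormField E M k) {x₁ x₂ : M} {u : E}
    (hu : u ∈ (extChartAt 𝓘(ℝ, E) x₁).target)
    (hf : MDifferentiableAt 𝓘(ℝ, E) 𝓘(ℝ, E) f ((extChartAt 𝓘(ℝ, E) x₁).symm u))
    (hfu : f ((extChartAt 𝓘(ℝ, E) x₁).symm u) ∈ (extChartAt 𝓘(ℝ, E) x₂).source) :
    formInChart x₁ (fun x ↦ pullForm (tangentMapAt E f x) (β (f x))) u =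
      pullForm (fderiv ℝ (fun v ↦ extChartAt 𝓘(ℝ, E) x₂ (f ((extChartAt 𝓘(ℝ, E) x₁).symm v))) u)
        (formInChart x₂ β (extChartAt 𝓘(ℝ, E) x₂ (f ((extChartAt 𝓘(ℝ, E) x₁).symm u)))) := by
  rw [(hasFDerivAt_inCharts hu hf hfu).fderiv, formInChart, eq_pullForm_formInChart β hfu,
    pullForm_comp, pullForm_comp]

theorem contMDiffAt_chart {n : ℕ∞ω} (hn : n ≤ ∞) {x₀ x : M}
    (hx : x ∈ (extChartAt 𝓘(ℝ, E) x₀).source) :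
    ContMDiffAt 𝓘(ℝ, E) 𝓘(ℝ, E) n (extChartAt 𝓘(ℝ, E) x₀) x :=
  (contMDiffAt_extChartAt' (n := ∞) (by rwa [extChartAt_source] at hx)).of_le hn

theorem contMDiffAt_chart_symm {n : ℕ∞ω} (hn : n ≤ ∞) {x₀ : M} {u : E}
    (hu : u ∈ (extChartAt 𝓘(ℝ, E) x₀).target) :
    ContMDiffAt 𝓘(ℝ, E) 𝓘(ℝ, E) n (extChartAt 𝓘(ℝ, E) x₀).symm u :=
  ((contMDiffOn_extChartAt_symm (n := ∞) x₀).contMDiffAt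
    ((isOpen_chart_target x₀).mem_nhds hu)).of_le hn

/-- The exterior derivative computed in any chart. -/
theorem formInChart_deRham {k : ℕ} {β : FormField E M k} (hβ : IsSmoothForm β) {x₀ : M} {u : E}
    (hu : u ∈ (extChartAt 𝓘(ℝ, E) x₀).target) :
    formInChart x₀ (deRham β) u = extDeriv (formInChart x₀ β) u := by
  set x := (extChartAt 𝓘(ℝ, E) x₀).symm u with hx
  let f : E → E := fun v ↦ extChartAt 𝓘(ℝ, E) x ((extChartAt 𝓘(ℝ, E) x₀).symm v)
  have hfx : x ∈ (extChartAt 𝓘(ℝ, E) x).source := mem_extChartAt_source x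
  have hf : ContDiffAt ℝ ∞ f u :=
    (ContMDiffAt.comp u (contMDiffAt_chart le_rfl (hx ▸ hfx))
      (contMDiffAt_chart_symm le_rfl hu)).contDiffAt
  have hω : DifferentiableAt ℝ (formInChart x β) (f u) :=
    ((hβ x).contDiffAt ((isOpen_chart_target x).mem_nhds
      ((extChartAt 𝓘(ℝ, E) x).map_source (hx ▸ hfx)))).differentiableAt (by simp)
  have hsrc : ∀ᶠ v in 𝓝 u, (extChartAt 𝓘(ℝ, E) x₀).symm v ∈ (extChartAt 𝓘(ℝ, E) x).source :=
    (mdifferentiableAt_chart_symm hu).continuousAt.eventually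
      ((isOpen_extChartAt_source x).mem_nhds (hx ▸ hfx))
  have hev : formInChart x₀ β =ᶠ[𝓝 u] fun v ↦
      (formInChart x β (f v)).compContinuousLinearMap (fderiv ℝ f v) := by
    filter_upwards [hsrc, (isOpen_chart_target x₀).mem_nhds hu] with v hv hvt
    have h := pullForm_inCharts (f := id) (x₂ := x) β hvt mdifferentiableAt_id hv
    simp only [tangentMapAt_id, pullForm_id] at h
    exact h
  rw [hev.extDeriv_eq, extDeriv_pullback hω hf (r := ∞) (by
    rw [minSmoothness_of_isRCLikeNormedField]
    exact WithTop.coe_le_coe.2 (le_top : (2 : ℕ∞) ≤ ⊤))]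
  have h := (hasFDerivAt_inCharts (f := id) (x₂ := x) hu mdifferentiableAt_id (hx ▸ hfx)).fderiv
  have h' : fderiv ℝ f u = dChart E x x ∘L dChartSymm x₀ u := by
    refine Eq.trans h ?_
    rw [tangentMapAt_id, ContinuousLinearMap.id_comp]
    rfl
  rw [h', formInChart, deRham, pullForm_comp]
  rfl

theorem isSmoothForm_deRham {k : ℕ} {β : FormField E M k} (hβ : IsSmoothForm β) :
    IsSmoothForm (deRham β) := by
  intro x₀
  have h1 : ContDiffOn ℝ ∞ (fderiv ℝ (formInChart x₀ β)) (extChartAt 𝓘(ℝ, E) x₀).target :=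
    (hβ x₀).fderiv_of_isOpen (isOpen_chart_target x₀) (by simp)
  have h3 : ContDiff ℝ ∞ (ContinuousAlternatingMap.alternatizeUncurryFinCLM ℝ E ℝ (n := k)) := by
    fun_prop
  have h2 : ContDiffOn ℝ ∞ (extDeriv (formInChart x₀ β)) (extChartAt 𝓘(ℝ, E) x₀).target :=
    h3.comp_contDiffOn h1
  exact h2.congr fun u hu ↦ formInChart_deRham hβ hu

/-- Smoothness of a section of the tangent bundle, in terms of the differential of the charts: the
trivialisation of the bundle at `x₀` is the differential of the chart at `x₀`. -/
theorem contDiffOn_vectorInChart {X : VectorFieldOn E M} (hX : IsSmoothVectorField X) (x₀ : M) :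
    ContDiffOn ℝ ∞ (vectorInChart x₀ X) (extChartAt 𝓘(ℝ, E) x₀).target := by
  intro u hu
  refine ContDiffAt.contDiffWithinAt ?_
  have := isManifold_one (E := E) (M := M)
  set x := (extChartAt 𝓘(ℝ, E) x₀).symm u with hx
  have hsrc : x ∈ (extChartAt 𝓘(ℝ, E) x₀).source := (extChartAt 𝓘(ℝ, E) x₀).map_target hu
  let e := trivializationAt E (TangentSpace 𝓘(ℝ, E) : M → Type _) x₀
  have hbase : x ∈ e.baseSet := by
    rw [TangentBundle.trivializationAt_baseSet]
    rwa [extChartAt_source] at hsrc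
  have h1 := (e.contMDiffAt_section_iff (n := ∞) (IB := 𝓘(ℝ, E)) hbase).1 (hX x)
  have h2 : ContDiffAt ℝ ∞ (fun v ↦ (e ⟨(extChartAt 𝓘(ℝ, E) x₀).symm v,
      X ((extChartAt 𝓘(ℝ, E) x₀).symm v)⟩).2) u :=
    (ContMDiffAt.comp u h1 (contMDiffAt_chart_symm le_rfl hu)).contDiffAt
  refine h2.congr_of_eventuallyEq ?_
  filter_upwards [(isOpen_chart_target x₀).mem_nhds hu] with v hv
  have hv' := mdifferentiableAt_chart ((extChartAt 𝓘(ℝ, E) x₀).map_target hv)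
  exact DFunLike.congr_fun hv'.mfderiv _

theorem isSmoothForm_contractField [FiniteDimensional ℝ E] {k : ℕ} {X : VectorFieldOn E M}
    (hX : IsSmoothVectorField X) {β : FormField E M (k + 1)} (hβ : IsSmoothForm β) :
    IsSmoothForm (contractField X β) := by
  intro x₀ u hu
  refine ContDiffAt.contDiffWithinAt ?_
  have hmem := (isOpen_chart_target x₀).mem_nhds hu
  refine (contDiffAt_contract ((contDiffOn_vectorInChart hX x₀).contDiffAt hmem)
    ((hβ x₀).contDiffAt hmem)).congr_of_eventuallyEq ?_
  filter_upwards [hmem] with v hv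
  have h : X ((extChartAt 𝓘(ℝ, E) x₀).symm v) = dChartSymm x₀ v (vectorInChart x₀ X v) :=
    (DFunLike.congr_fun (dChartSymm_comp_dChart hv) _).symm
  rw [formInChart, formInChart, contract_pullForm, ← h]
  rfl

omit [IsManifold 𝓘(ℝ, E) ∞ M] in
theorem IsSmoothForm.sub {k : ℕ} {β γ : FormField E M k} (hβ : IsSmoothForm β)
    (hγ : IsSmoothForm γ) : IsSmoothForm (fun x ↦ β x - γ x) := fun x₀ ↦ (hβ x₀).sub (hγ x₀)

end Charts

/-! ### Smoothness and group law of the flow -/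

section Flow

theorem mul_mem_uIcc_zero {r t : ℝ} (hr : r ∈ Icc (0 : ℝ) 1) : r * t ∈ uIcc 0 t := by
  rcases le_total 0 t with h0 | h0
  · rw [uIcc_of_le h0]
    exact ⟨mul_nonneg hr.1 h0, mul_le_of_le_one_left h0 hr.2⟩
  · rw [uIcc_of_ge h0]
    exact ⟨by nlinarith [hr.2], mul_nonpos_of_nonneg_of_nonpos hr.1 h0⟩

variable {E : Type*} [NormedAddCommGroup E] [NormedSpace ℝ E]
  {M : Type*} [TopologicalSpace M] [ChartedSpace E M]

/-- An integral curve on an open interval, in terms of the derivative at each time. -/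
theorem hasMFDerivAt_comp_add {γ : ℝ → M} {s c : ℝ} {v : E}
    (h : HasMFDerivAt 𝓘(ℝ, ℝ) 𝓘(ℝ, E) γ (s + c) ((1 : ℝ →L[ℝ] ℝ).smulRight v)) :
    HasMFDerivAt 𝓘(ℝ, ℝ) 𝓘(ℝ, E) (fun r ↦ γ (r + c)) s ((1 : ℝ →L[ℝ] ℝ).smulRight v) := by
  have h1 : HasMFDerivAt 𝓘(ℝ, ℝ) 𝓘(ℝ, ℝ) (fun r : ℝ ↦ r + c) s (ContinuousLinearMap.id ℝ ℝ) :=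
    ((hasFDerivAt_id s).add_const c).hasMFDerivAt
  exact h.comp s h1

theorem isMIntegralCurveOn_Ioo_iff {γ : ℝ → M} {X : VectorFieldOn E M} {a b : ℝ} :
    IsMIntegralCurveOn (I := 𝓘(ℝ, E)) γ X (Ioo a b) ↔ ∀ t ∈ Ioo a b,
      HasMFDerivAt 𝓘(ℝ, ℝ) 𝓘(ℝ, E) γ t ((1 : ℝ →L[ℝ] ℝ).smulRight (X (γ t))) :=
  ⟨fun h t ht ↦ (h t ht).hasMFDerivAt (Ioo_mem_nhds ht.1 ht.2),
    fun h t ht ↦ (h t ht).hasMFDerivWithinAt⟩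

theorem flowDomain_of_mem {X : VectorFieldOn E M} {t : ℝ} {x : M} (h : (t, x) ∈ flowDomain X)
    {r : ℝ} (hr : r ∈ uIcc 0 t) : (r, x) ∈ flowDomain X := by
  obtain ⟨γ, a, b, h0, ht, hx, hγ⟩ := h
  exact ⟨γ, a, b, h0, ordConnected_Ioo.uIcc_subset h0 ht hr, hx, hγ⟩

theorem flowDomain_scaled {X : VectorFieldOn E M} {t : ℝ} {x : M} (h : (t, x) ∈ flowDomain X)
    {r : ℝ} (hr : r ∈ Icc (0 : ℝ) 1) : (r * t, x) ∈ flowDomain X :=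
  flowDomain_of_mem h (mul_mem_uIcc_zero hr)

variable [IsManifold 𝓘(ℝ, E) ∞ M] [T2Space M] [FiniteDimensional ℝ E] {X : VectorFieldOn E M}

omit [T2Space M] in
theorem zero_mem_flowDomain (hX : IsSmoothVectorField X) (x : M) : ((0 : ℝ), x) ∈ flowDomain X := by
  have := FiniteDimensional.complete ℝ E
  have := isManifold_one (E := E) (M := M)
  obtain ⟨γ, h0, hγ⟩ := exists_isMIntegralCurveAt_of_contMDiffAt_boundaryless (I := 𝓘(ℝ, E)) 0
    ((hX x).of_le (by norm_cast))
  obtain ⟨ε, hε, hγ⟩ := isMIntegralCurveAt_iff'.1 hγ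
  rw [Real.ball_eq_Ioo, zero_sub, zero_add] at hγ
  exact ⟨γ, -ε, ε, ⟨by simpa using hε, hε⟩, ⟨by simpa using hε, hε⟩, h0, hγ⟩

theorem flow_zero (hX : IsSmoothVectorField X) (x : M) : flow X 0 x = x := by
  obtain ⟨γ, a, b, h0, ht, hx, hγ⟩ := zero_mem_flowDomain hX x
  dsimp only at hx
  rw [← hx, flow_eq hX h0 h0 hγ]

/-- The orbit `s ↦ φ_s(x)` is an integral curve on an interval around each time in its domain. -/
theorem exists_flow_isMIntegralCurveOn (hX : IsSmoothVectorField X) {t : ℝ} {x : M}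
    (h : (t, x) ∈ flowDomain X) : ∃ a b : ℝ, (0 : ℝ) ∈ Ioo a b ∧ t ∈ Ioo a b ∧
      (∀ s ∈ Ioo a b, (s, x) ∈ flowDomain X) ∧
      IsMIntegralCurveOn (I := 𝓘(ℝ, E)) (fun s ↦ flow X s x) X (Ioo a b) := by
  obtain ⟨γ, a, b, h0, ht, hx, hγ⟩ := h
  dsimp only at ht hx
  subst hx
  refine ⟨a, b, h0, ht, fun s hs ↦ ⟨γ, a, b, h0, hs, rfl, hγ⟩, ?_⟩
  rw [isMIntegralCurveOn_Ioo_iff] at hγ ⊢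
  intro s hs
  have h1 : (fun s ↦ flow X s (γ 0)) =ᶠ[𝓝 s] γ := by
    filter_upwards [Ioo_mem_nhds hs.1 hs.2] with r hr
    exact flow_eq hX h0 hr (isMIntegralCurveOn_Ioo_iff.2 hγ)
  have e : flow X s (γ 0) = γ s := h1.self_of_nhds
  have h2 := (hγ s hs).congr_of_eventuallyEq h1
  rwa [← e] at h2

theorem hasMFDerivAt_flow (hX : IsSmoothVectorField X) {t : ℝ} {x : M}
    (h : (t, x) ∈ flowDomain X) : HasMFDerivAt 𝓘(ℝ, ℝ) 𝓘(ℝ, E) (fun s ↦ flow X s x) t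
      ((1 : ℝ →L[ℝ] ℝ).smulRight (X (flow X t x))) := by
  obtain ⟨a, b, -, ht, -, hγ⟩ := exists_flow_isMIntegralCurveOn hX h
  exact isMIntegralCurveOn_Ioo_iff.1 hγ t ht

/-- The flow is defined at `(-t, φ_t(x))` if it is defined at `(t, x)`. -/
theorem flow_neg_flow (hX : IsSmoothVectorField X) {t : ℝ} {x : M} (h : (t, x) ∈ flowDomain X) :
    (-t, flow X t x) ∈ flowDomain X ∧ flow X (-t) (flow X t x) = x := by
  obtain ⟨a, b, h0, ht, hab, hγ⟩ := exists_flow_isMIntegralCurveOn hX h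
  have h1 : IsMIntegralCurveOn (I := 𝓘(ℝ, E)) (fun r ↦ flow X (r + t) x) X
      (Ioo (a - t) (b - t)) := by
    rw [isMIntegralCurveOn_Ioo_iff] at hγ ⊢
    exact fun s hs ↦ hasMFDerivAt_comp_add (hγ (s + t) ⟨by linarith [hs.1], by linarith [hs.2]⟩)
  have h00 : (0 : ℝ) ∈ Ioo (a - t) (b - t) := ⟨by linarith [ht.1], by linarith [ht.2]⟩
  have hnt : -t ∈ Ioo (a - t) (b - t) := ⟨by linarith [h0.1], by linarith [h0.2]⟩
  refine ⟨⟨_, _, _, h00, hnt, by simp, h1⟩, ?_⟩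
  have h2 := flow_eq hX h00 hnt h1
  simpa [flow_zero hX] using h2

/-- The group law `φ_{s + t} = φ_s ∘ φ_t`, wherever the right-hand side is defined. -/
theorem flow_add (hX : IsSmoothVectorField X) {s t : ℝ} {x : M} (ht : (t, x) ∈ flowDomain X)
    (hs : (s, flow X t x) ∈ flowDomain X) :
    (s + t, x) ∈ flowDomain X ∧ flow X (s + t) x = flow X s (flow X t x) := by
  have := FiniteDimensional.complete ℝ E
  have := isManifold_one (E := E) (M := M)
  obtain ⟨a, b, h0, htab, -, hγ₁⟩ := exists_flow_isMIntegralCurveOn hX ht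
  obtain ⟨a', b', h0', hsab, -, hγ₂'⟩ := exists_flow_isMIntegralCurveOn hX hs
  let γ₁ : ℝ → M := fun r ↦ flow X r x
  let γ₂ : ℝ → M := fun r ↦ flow X (r + -t) (flow X t x)
  have hγ₂ : IsMIntegralCurveOn (I := 𝓘(ℝ, E)) γ₂ X (Ioo (a' + t) (b' + t)) := by
    rw [isMIntegralCurveOn_Ioo_iff] at hγ₂' ⊢
    exact fun s hs ↦ hasMFDerivAt_comp_add (hγ₂' (s + -t) ⟨by linarith [hs.1], by linarith [hs.2]⟩)
  have heq : EqOn γ₁ γ₂ (Ioo (max a (a' + t)) (min b (b' + t))) := by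
    refine isMIntegralCurveOn_Ioo_eqOn_of_contMDiff_boundaryless (I := 𝓘(ℝ, E)) (t₀ := t)
      ⟨max_lt htab.1 (by linarith [h0'.1]), lt_min htab.2 (by linarith [h0'.2])⟩
      (ContMDiff.of_le hX (by norm_cast))
      (hγ₁.mono (Ioo_subset_Ioo (le_max_left _ _) (min_le_left _ _)))
      (hγ₂.mono (Ioo_subset_Ioo (le_max_right _ _) (min_le_right _ _))) ?_
    simp [γ₁, γ₂, flow_zero hX]
  -- the two orbits agree where both are defined, so they can be glued
  classical
  let γ : ℝ → M := fun r ↦ if r ∈ Ioo a b then γ₁ r else γ₂ r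
  have hg₁ : EqOn γ γ₁ (Ioo a b) := fun r hr ↦ if_pos hr
  have hg₂ : EqOn γ γ₂ (Ioo (a' + t) (b' + t)) := by
    intro r hr
    by_cases h : r ∈ Ioo a b
    · exact (hg₁ h).trans (heq ⟨max_lt h.1 hr.1, lt_min h.2 hr.2⟩)
    · exact if_neg h
  have hγ : IsMIntegralCurveOn (I := 𝓘(ℝ, E)) γ X (Ioo (min a (a' + t)) (max b (b' + t))) := by
    rw [isMIntegralCurveOn_Ioo_iff] at hγ₁ hγ₂ ⊢
    have key : ∀ {γ' : ℝ → M} {c d : ℝ}, EqOn γ γ' (Ioo c d) →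
        (∀ r ∈ Ioo c d, HasMFDerivAt 𝓘(ℝ, ℝ) 𝓘(ℝ, E) γ' r
          ((1 : ℝ →L[ℝ] ℝ).smulRight (X (γ' r)))) →
        ∀ r ∈ Ioo c d, HasMFDerivAt 𝓘(ℝ, ℝ) 𝓘(ℝ, E) γ r
          ((1 : ℝ →L[ℝ] ℝ).smulRight (X (γ r))) := by
      intro γ' c d he hd r hr
      rw [he hr]
      exact (hd r hr).congr_of_eventuallyEq (he.eventuallyEq_of_mem (Ioo_mem_nhds hr.1 hr.2))
    intro r hr
    by_cases h : r ∈ Ioo a b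
    · exact key hg₁ hγ₁ r h
    · refine key hg₂ hγ₂ r ?_
      rw [mem_Ioo, not_and_or, not_lt, not_lt] at h
      rcases h with h | h
      · refine ⟨?_, by linarith [htab.1, h0'.2]⟩
        rcases min_lt_iff.1 hr.1 with h' | h'
        · linarith
        · exact h'
      · refine ⟨by linarith [htab.2, h0'.1], ?_⟩
        rcases lt_max_iff.1 hr.2 with h' | h'
        · linarith
        · exact h'
  have h00 : (0 : ℝ) ∈ Ioo (min a (a' + t)) (max b (b' + t)) :=
    ⟨(min_le_left _ _).trans_lt h0.1, h0.2.trans_le (le_max_left _ _)⟩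
  have hst' : s + t ∈ Ioo (a' + t) (b' + t) := ⟨by linarith [hsab.1], by linarith [hsab.2]⟩
  have hst : s + t ∈ Ioo (min a (a' + t)) (max b (b' + t)) :=
    ⟨(min_le_right _ _).trans_lt hst'.1, hst'.2.trans_le (le_max_right _ _)⟩
  have hx : γ 0 = x := (hg₁ h0).trans (flow_zero hX x)
  refine ⟨⟨γ, _, _, h00, hst, hx, hγ⟩, ?_⟩
  have h1 := flow_eq hX h00 hst hγ
  rw [hx, hg₂ hst'] at h1
  simpa [γ₂] using h1

/-- Near `{0} × M` the flow is defined, and it is smooth at the points of `{0} × M`. -/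
theorem flow_near_zero (hX : IsSmoothVectorField X) (x₀ : M) {n : ℕ} (hn : n ≠ 0) :
    (∀ᶠ p in 𝓝 ((0 : ℝ), x₀), p ∈ flowDomain X) ∧
      ContMDiffAt (𝓘(ℝ, ℝ).prod 𝓘(ℝ, E)) 𝓘(ℝ, E) n (fun p : ℝ × M ↦ flow X p.1 p.2) (0, x₀) := by
  have hn' : ((n : ℕ) : ℕ∞ω) ≤ ∞ := by exact_mod_cast le_top
  set u₀ := extChartAt 𝓘(ℝ, E) x₀ x₀ with hu₀
  have hu₀t : u₀ ∈ (extChartAt 𝓘(ℝ, E) x₀).target := mem_extChartAt_target x₀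
  obtain ⟨R, hR, hRt⟩ := Metric.nhds_basis_closedBall.mem_iff.1
    ((isOpen_chart_target x₀).mem_nhds hu₀t)
  -- in the chart, `X` is cut off to a compactly supported field `Y` which equals `X` near `u₀`
  let f : ContDiffBump u₀ := ⟨R / 2, R, by positivity, by linarith⟩
  let Y : E → E := fun u ↦ f u • vectorInChart x₀ X u
  have hY : ContDiff ℝ n Y := by
    refine contDiff_iff_contDiffAt.2 fun u ↦ ?_
    by_cases hu : u ∈ Metric.closedBall u₀ R
    · exact f.contDiff.contDiffAt.smul (((contDiffOn_vectorInChart hX x₀).contDiffAt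
        ((isOpen_chart_target x₀).mem_nhds (hRt hu))).of_le hn')
    · refine (contDiffAt_const (c := (0 : E))).congr_of_eventuallyEq ?_
      filter_upwards [Metric.isClosed_closedBall.isOpen_compl.mem_nhds hu] with v hv
      have h0 : f v = 0 := f.zero_of_le_dist (not_le.1 fun h ↦ hv (Metric.mem_closedBall.2 h)).le
      simp [Y, h0]
  have hYc : HasCompactSupport Y := f.hasCompactSupport.smul_right
  obtain ⟨Φ, hΦ, ε, hε, hev⟩ := exists_localFlow hn hY hYc u₀
  have hΦ0 : Φ (0, u₀) = u₀ := hev.self_of_nhds.1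
  have hball : ∀ᶠ p in 𝓝 ((0 : ℝ), u₀), Φ p ∈ Metric.ball u₀ (R / 2) :=
    hΦ.continuousAt.eventually (by rw [hΦ0]; exact Metric.ball_mem_nhds _ (by positivity))
  rw [nhds_prod_eq] at hball
  obtain ⟨pa, ha, pb, hb, hab⟩ := Filter.eventually_prod_iff.1 hball
  obtain ⟨ε', hε', ha'⟩ := Metric.eventually_nhds_iff.1 ha
  let δ := min ε ε'
  have hδ : 0 < δ := lt_min hε hε'
  have hmain : ∀ᶠ x in 𝓝 x₀, ∀ t ∈ Ioo (-δ) δ, (t, x) ∈ flowDomain X ∧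
      flow X t x = (extChartAt 𝓘(ℝ, E) x₀).symm (Φ (t, extChartAt 𝓘(ℝ, E) x₀ x)) := by
    filter_upwards [(continuousAt_extChartAt x₀).eventually (hev.and hb),
      extChartAt_source_mem_nhds (I := 𝓘(ℝ, E)) x₀] with x ⟨⟨hx0, hxd⟩, hxb⟩ hxs
    set u := extChartAt 𝓘(ℝ, E) x₀ x
    let γ : ℝ → M := fun s ↦ (extChartAt 𝓘(ℝ, E) x₀).symm (Φ (s, u))
    have h00 : (0 : ℝ) ∈ Ioo (-δ) δ := ⟨by linarith, hδ⟩
    have hγ : IsMIntegralCurveOn (I := 𝓘(ℝ, E)) γ X (Ioo (-δ) δ) := by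
      rw [isMIntegralCurveOn_Ioo_iff]
      intro t ht
      have hΦb : Φ (t, u) ∈ Metric.ball u₀ (R / 2) := by
        refine hab (ha' ?_) hxb
        rw [Real.dist_eq, sub_zero]
        exact (abs_lt.2 ht).trans_le (min_le_right _ _)
      have hΦt : Φ (t, u) ∈ (extChartAt 𝓘(ℝ, E) x₀).target :=
        hRt (Metric.ball_subset_closedBall (Metric.ball_subset_ball (by linarith) hΦb))
      have hd := hxd t ⟨by linarith [ht.1, min_le_left ε ε'], ht.2.trans_le (min_le_left _ _)⟩
      have hYX : Y (Φ (t, u)) = vectorInChart x₀ X (Φ (t, u)) := by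
        have h1 : f (Φ (t, u)) = 1 := f.one_of_mem_closedBall (Metric.ball_subset_closedBall hΦb)
        simp only [Y, h1, one_smul]
      rw [hYX] at hd
      have h1 := (mdifferentiableAt_chart_symm hΦt).hasMFDerivAt.comp t hd.hasFDerivAt.hasMFDerivAt
      refine h1.congr_mfderiv ?_
      have h2 : dChartSymm x₀ (Φ (t, u)) (vectorInChart x₀ X (Φ (t, u))) = X (γ t) :=
        DFunLike.congr_fun (dChartSymm_comp_dChart hΦt) _
      refine ContinuousLinearMap.ext_ring ?_
      refine Eq.trans ?_ (h2.trans (one_smul ℝ (X (γ t) : E)).symm)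
      exact congrArg (dChartSymm x₀ (Φ (t, u))) (one_smul ℝ (vectorInChart x₀ X (Φ (t, u))))
    have hγ0 : γ 0 = x := by
      simp only [γ, hx0]
      exact (extChartAt 𝓘(ℝ, E) x₀).left_inv hxs
    intro t ht
    refine ⟨⟨γ, _, _, h00, ht, hγ0, hγ⟩, ?_⟩
    have h1 := flow_eq hX h00 ht hγ
    rwa [hγ0] at h1
  have hprod : ∀ᶠ p in 𝓝 ((0 : ℝ), x₀), p.1 ∈ Ioo (-δ) δ ∧ ∀ t ∈ Ioo (-δ) δ,
      (t, p.2) ∈ flowDomain X ∧ flow X t p.2 =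
        (extChartAt 𝓘(ℝ, E) x₀).symm (Φ (t, extChartAt 𝓘(ℝ, E) x₀ p.2)) := by
    rw [nhds_prod_eq]
    have hI : ∀ᶠ t in 𝓝 (0 : ℝ), t ∈ Ioo (-δ) δ := Ioo_mem_nhds (by linarith) hδ
    exact hI.prod_mk hmain
  refine ⟨hprod.mono fun p hp ↦ (hp.2 p.1 hp.1).1, ?_⟩
  have h1 : ContMDiffAt (𝓘(ℝ, ℝ).prod 𝓘(ℝ, E)) 𝓘(ℝ, ℝ × E) n
      (fun p : ℝ × M ↦ (p.1, extChartAt 𝓘(ℝ, E) x₀ p.2)) (0, x₀) :=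
    contMDiffAt_fst.prodMk_space ((contMDiffAt_chart hn' (mem_extChartAt_source x₀)).comp
      (0, x₀) contMDiffAt_snd)
  have h2 : ContMDiffAt (𝓘(ℝ, ℝ).prod 𝓘(ℝ, E)) 𝓘(ℝ, E) n
      (fun p : ℝ × M ↦ Φ (p.1, extChartAt 𝓘(ℝ, E) x₀ p.2)) (0, x₀) :=
    ContMDiffAt.comp (0, x₀) hΦ.contMDiffAt h1
  have h3 : ContMDiffAt (𝓘(ℝ, ℝ).prod 𝓘(ℝ, E)) 𝓘(ℝ, E) n
      (fun p : ℝ × M ↦ (extChartAt 𝓘(ℝ, E) x₀).symm (Φ (p.1, extChartAt 𝓘(ℝ, E) x₀ p.2)))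
      (0, x₀) :=
    ContMDiffAt.comp (0, x₀) (contMDiffAt_chart_symm hn' (by rw [← hu₀, hΦ0]; exact hu₀t)) h2
  exact h3.congr_of_eventuallyEq (hprod.mono fun p hp ↦ (hp.2 p.1 hp.1).2)

/-- The flow is defined in a neighbourhood of `p`, and it is `C^n` at `p`. -/
def FlowRegularAt (X : VectorFieldOn E M) (n : ℕ) (p : ℝ × M) : Prop :=
  flowDomain X ∈ 𝓝 p ∧
    ContMDiffAt (𝓘(ℝ, ℝ).prod 𝓘(ℝ, E)) 𝓘(ℝ, E) n (fun p : ℝ × M ↦ flow X p.1 p.2) p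

/-- Regularity of the flow propagates along the group law. -/
theorem FlowRegularAt.add (hX : IsSmoothVectorField X) {n : ℕ} {s t : ℝ} {x : M}
    (ht : FlowRegularAt X n (t, x)) (hs : FlowRegularAt X n (s, flow X t x)) :
    FlowRegularAt X n (s + t, x) := by
  have hc : ContMDiffAt (𝓘(ℝ, ℝ).prod 𝓘(ℝ, E)) (𝓘(ℝ, ℝ).prod 𝓘(ℝ, E)) n
      (fun p : ℝ × M ↦ (t, p.2)) (s + t, x) := contMDiffAt_const.prodMk contMDiffAt_snd
  have hc1 : ContMDiffAt (𝓘(ℝ, ℝ).prod 𝓘(ℝ, E)) 𝓘(ℝ, E) n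
      (fun p : ℝ × M ↦ flow X t p.2) (s + t, x) := ContMDiffAt.comp (s + t, x) ht.2 hc
  have hsub : ContMDiffAt (𝓘(ℝ, ℝ).prod 𝓘(ℝ, E)) 𝓘(ℝ, ℝ) n
      (fun p : ℝ × M ↦ p.1 - t) (s + t, x) :=
    ContMDiffAt.comp (s + t, x) (I' := 𝓘(ℝ, ℝ)) (g := fun r : ℝ ↦ r - t)
      (contDiff_id.sub contDiff_const).contMDiff.contMDiffAt contMDiffAt_fst
  have hc2 := hsub.prodMk hc1
  have e1 : (s + t - t, flow X t x) = (s, flow X t x) := by rw [add_sub_cancel_right]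
  have hev : ∀ᶠ p in 𝓝 (s + t, x), (t, p.2) ∈ flowDomain X ∧
      (p.1 - t, flow X t p.2) ∈ flowDomain X :=
    (hc.continuousAt.eventually ht.1).and
      (hc2.continuousAt.eventually (e1 ▸ hs.1 : flowDomain X ∈ 𝓝 (s + t - t, flow X t x)))
  have hadd : ∀ᶠ p in 𝓝 (s + t, x), p ∈ flowDomain X ∧
      flow X p.1 p.2 = flow X (p.1 - t) (flow X t p.2) := by
    filter_upwards [hev] with p hp
    have h := flow_add hX hp.1 hp.2
    rwa [sub_add_cancel] at h
  refine ⟨hadd.mono fun p hp ↦ hp.1, ?_⟩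
  have h3 := ContMDiffAt.comp (s + t, x) (g := fun p : ℝ × M ↦ flow X p.1 p.2)
    (e1 ▸ hs.2 : ContMDiffAt (𝓘(ℝ, ℝ).prod 𝓘(ℝ, E)) 𝓘(ℝ, E) n _ (s + t - t, flow X t x)) hc2
  exact h3.congr_of_eventuallyEq (hadd.mono fun p hp ↦ hp.2)

/-- The flow is regular on all of its domain: it is so on a time interval `(-ε, ε)` which is uniform
in the starting point along the compact segment of the orbit of `x` up to the time `t`, and the
segment is covered by `N` steps of length `t / N`. -/
theorem flowRegularAt (hX : IsSmoothVectorField X) {n : ℕ} (hn : n ≠ 0) {t : ℝ} {x : M}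
    (h : (t, x) ∈ flowDomain X) : FlowRegularAt X n (t, x) := by
  have hn' : ((n : ℕ) : ℕ∞ω) ≤ ∞ := by exact_mod_cast le_top
  have hMn : IsManifold 𝓘(ℝ, E) n M := IsManifold.of_le hn'
  have hnear : ∀ z : M, ∀ᶠ p in 𝓝 ((0 : ℝ), z), FlowRegularAt X n p := by
    intro z
    obtain ⟨h1, h2⟩ := flow_near_zero hX z hn
    have h3 := contMDiffAt_iff_contMDiffAt_nhds (by simp) |>.1 h2
    exact (eventually_eventually_nhds.2 h1).and h3
  let K : Set M := (fun r ↦ flow X (r * t) x) '' Icc (0 : ℝ) 1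
  have hK : IsCompact K := by
    refine isCompact_Icc.image_of_continuousOn fun r hr ↦ ContinuousAt.continuousWithinAt ?_
    exact ContinuousAt.comp (f := fun r ↦ r * t) (g := fun s ↦ flow X s x)
      (hasMFDerivAt_flow hX (flowDomain_scaled h hr)).continuousAt (by fun_prop)
  have htube : ∀ᶠ s in 𝓝 (0 : ℝ), ∀ z ∈ K, FlowRegularAt X n (s, z) :=
    hK.eventually_forall_of_forall_eventually fun z _ ↦ hnear z
  obtain ⟨ε, hε, hεs⟩ := Metric.eventually_nhds_iff.1 htube
  obtain ⟨N, hN⟩ := exists_nat_gt (|t| / ε)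
  have hN0 : (0 : ℝ) < N := (div_nonneg (abs_nonneg t) hε.le).trans_lt hN
  have hstep : ∀ z ∈ K, FlowRegularAt X n (t / N, z) := by
    refine hεs ?_
    rw [Real.dist_eq, sub_zero, abs_div, abs_of_pos hN0, div_lt_iff₀ hN0, mul_comm]
    exact (div_lt_iff₀ hε).1 hN
  have hind : ∀ k : ℕ, k ≤ N → FlowRegularAt X n (k / N * t, x) := by
    intro k
    induction k with
    | zero =>
      intro _
      have h0 := (hnear x).self_of_nhds
      simpa using h0
    | succ k ih =>
      intro hk
      have hk' : (k : ℝ) / N ∈ Icc (0 : ℝ) 1 :=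
        ⟨by positivity, (div_le_one hN0).2 (by exact_mod_cast (Nat.le_succ k).trans hk)⟩
      have h1 := (ih ((Nat.le_succ k).trans hk)).add hX (hstep _ ⟨_, hk', rfl⟩)
      have h2 : t / N + k / N * t = ((k + 1 : ℕ) : ℝ) / N * t := by
        push_cast
        field_simp
        ring
      rwa [h2] at h1
  have h1 := hind N le_rfl
  rwa [div_self hN0.ne', one_mul] at h1

theorem isOpen_flowDomain (hX : IsSmoothVectorField X) : IsOpen (flowDomain X) :=
  isOpen_iff_mem_nhds.2 fun _ h ↦ (flowRegularAt hX one_ne_zero h).1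

theorem contMDiffAt_flow (hX : IsSmoothVectorField X) {t : ℝ} {x : M}
    (h : (t, x) ∈ flowDomain X) :
    ContMDiffAt (𝓘(ℝ, ℝ).prod 𝓘(ℝ, E)) 𝓘(ℝ, E) ∞ (fun p : ℝ × M ↦ flow X p.1 p.2) (t, x) :=
  contMDiffAt_infty.2 fun n ↦
    (flowRegularAt hX n.succ_ne_zero h).2.of_le (by exact_mod_cast n.le_succ)

end Flow

/-! ### The flow in charts and the variational equation -/

section Variational

variable {E : Type*} [NormedAddCommGroup E] [NormedSpace ℝ E]

/-- The variational equation: the spatial derivative of a flow solves the linearised equation. -/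
theorem hasDerivAt_fderiv_of_flow {Ψ : ℝ × E → E} {Y : E → E} {t : ℝ} {u : E}
    (hΨ : ContDiffAt ℝ ∞ Ψ (t, u)) (hY : DifferentiableAt ℝ Y (Ψ (t, u)))
    (h : ∀ᶠ q in 𝓝 (t, u), HasDerivAt (fun s ↦ Ψ (s, q.2)) (Y (Ψ q)) q.1) :
    HasDerivAt (fun s ↦ fderiv ℝ (fun v ↦ Ψ (s, v)) u)
      (fderiv ℝ Y (Ψ (t, u)) ∘L fderiv ℝ (fun v ↦ Ψ (t, v)) u) t := by
  have hdiff : ∀ᶠ q in 𝓝 (t, u), DifferentiableAt ℝ Ψ q := by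
    filter_upwards [(hΨ.of_le (m := 1) (by norm_cast)).eventually (by simp)] with q hq
    exact hq.differentiableAt (by simp)
  have hx : ∀ {s : ℝ} {v : E}, DifferentiableAt ℝ Ψ (s, v) →
      fderiv ℝ (fun v ↦ Ψ (s, v)) v = fderiv ℝ Ψ (s, v) ∘L ContinuousLinearMap.inr ℝ ℝ E :=
    fun hd ↦ (hd.hasFDerivAt.comp _ (hasFDerivAt_prodMk_right _ _)).fderiv
  have hs : ∀ᶠ q in 𝓝 (t, u), fderiv ℝ Ψ q (1, 0) = Y (Ψ q) := by
    filter_upwards [hdiff, h] with q hq hq'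
    have h1 := (hq.hasFDerivAt.comp_hasDerivAt q.1
      ((hasDerivAt_id q.1).prodMk (hasDerivAt_const q.1 q.2)))
    exact h1.unique hq'
  have h2 : HasFDerivAt (fderiv ℝ Ψ) (fderiv ℝ (fderiv ℝ Ψ) (t, u)) (t, u) :=
    ((hΨ.fderiv_right (m := 1) (by norm_cast)).differentiableAt (by simp)).hasFDerivAt
  set D2 := fderiv ℝ (fderiv ℝ Ψ) (t, u) with hD2
  -- the two sides of the variational equation are `D2 (1, 0) (0, v)` and `D2 (0, v) (1, 0)`
  have hsymm : ∀ v w, D2 v w = D2 w v := hΨ.isSymmSndFDerivAt (by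
    rw [minSmoothness_of_isRCLikeNormedField]
    exact WithTop.coe_le_coe.2 (le_top : (2 : ℕ∞) ≤ ⊤))
  have h3 : ∀ w, D2 w (1, 0) = fderiv ℝ Y (Ψ (t, u)) (fderiv ℝ Ψ (t, u) w) := by
    intro w
    have h4 := (h2.clm_apply (hasFDerivAt_const ((1 : ℝ), (0 : E)) (t, u))).congr_of_eventuallyEq
      (f₁ := fun q ↦ Y (Ψ q)) (hs.mono fun q hq ↦ hq.symm)
    have h5 := h4.unique (hY.hasFDerivAt.comp (t, u) hdiff.self_of_nhds.hasFDerivAt)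
    simpa using DFunLike.congr_fun h5 w
  have h6 : HasDerivAt (fun s : ℝ ↦ (s, u)) ((1 : ℝ), (0 : E)) t :=
    (hasDerivAt_id t).prodMk (hasDerivAt_const t u)
  have h7 : HasDerivAt (fun s ↦ fderiv ℝ Ψ (s, u)) (D2 (1, 0)) t := h2.comp_hasDerivAt t h6
  have h8 := hasDerivAt_linear
    ((ContinuousLinearMap.compL ℝ E (ℝ × E) E).flip (ContinuousLinearMap.inr ℝ ℝ E)) h7
  have h9 : D2 (1, 0) ∘L ContinuousLinearMap.inr ℝ ℝ E =
      fderiv ℝ Y (Ψ (t, u)) ∘L fderiv ℝ (fun v ↦ Ψ (t, v)) u := by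
    ext v
    rw [hx hdiff.self_of_nhds]
    exact (hsymm _ _).trans (h3 _)
  rw [← h9]
  refine HasDerivAt.congr_of_eventuallyEq h8 ?_
  filter_upwards [h6.continuousAt.eventually hdiff] with s hs
  exact hx hs

end Variational

section FlowCharts

variable {E : Type*} [NormedAddCommGroup E] [NormedSpace ℝ E]
  {M : Type*} [TopologicalSpace M] [ChartedSpace E M] {X : VectorFieldOn E M}

/-- The flow `(t, u) ↦ φ_t(u)` in charts: around `x₁` for `u`, around `x₂` for `φ_t(u)`. -/
def flowInChart (X : VectorFieldOn E M) (x₁ x₂ : M) (p : ℝ × E) : E :=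
  extChartAt 𝓘(ℝ, E) x₂ (flow X p.1 ((extChartAt 𝓘(ℝ, E) x₁).symm p.2))

/-- The Jacobian matrix of `φ_t`, in charts. -/
def flowJacobian (X : VectorFieldOn E M) (x₁ x₂ : M) (p : ℝ × E) : E →L[ℝ] E :=
  fderiv ℝ (fun v ↦ flowInChart X x₁ x₂ (p.1, v)) p.2

/-- The points at which `flowInChart` is not a junk value. -/
def flowChartDomain (X : VectorFieldOn E M) (x₁ x₂ : M) : Set (ℝ × E) :=
  {p | p.2 ∈ (extChartAt 𝓘(ℝ, E) x₁).target ∧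
    (p.1, (extChartAt 𝓘(ℝ, E) x₁).symm p.2) ∈ flowDomain X ∧
    flow X p.1 ((extChartAt 𝓘(ℝ, E) x₁).symm p.2) ∈ (extChartAt 𝓘(ℝ, E) x₂).source}

theorem mem_flowChartDomain {t : ℝ} {x x₁ x₂ : M} (h₁ : x ∈ (extChartAt 𝓘(ℝ, E) x₁).source)
    (h : (t, x) ∈ flowDomain X) (h₂ : flow X t x ∈ (extChartAt 𝓘(ℝ, E) x₂).source) :
    (t, extChartAt 𝓘(ℝ, E) x₁ x) ∈ flowChartDomain X x₁ x₂ := by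
  refine ⟨(extChartAt 𝓘(ℝ, E) x₁).map_source h₁, ?_⟩
  dsimp only
  rw [(extChartAt 𝓘(ℝ, E) x₁).left_inv h₁]
  exact ⟨h, h₂⟩

theorem flowInChart_mem_target {x₁ x₂ : M} {p : ℝ × E} (hp : p ∈ flowChartDomain X x₁ x₂) :
    flowInChart X x₁ x₂ p ∈ (extChartAt 𝓘(ℝ, E) x₂).target :=
  (extChartAt 𝓘(ℝ, E) x₂).map_source hp.2.2

variable [IsManifold 𝓘(ℝ, E) ∞ M]

theorem contMDiffAt_prod_chart_symm {x₁ : M} {p : ℝ × E}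
    (h : p.2 ∈ (extChartAt 𝓘(ℝ, E) x₁).target) :
    ContMDiffAt 𝓘(ℝ, ℝ × E) (𝓘(ℝ, ℝ).prod 𝓘(ℝ, E)) ∞
      (fun p : ℝ × E ↦ (p.1, (extChartAt 𝓘(ℝ, E) x₁).symm p.2)) p :=
  ContMDiffAt.prodMk contDiff_fst.contMDiff.contMDiffAt (ContMDiffAt.comp p
    (contMDiffAt_chart_symm le_rfl h) contDiff_snd.contMDiff.contMDiffAt)

theorem isOpen_inChart (x₁ : M) {W : Set (ℝ × M)} (hW : IsOpen W) :
    IsOpen (inChart (E := E) x₁ W) := by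
  refine isOpen_iff_mem_nhds.2 fun p hp ↦ ?_
  exact ((continuousAt_snd.eventually ((isOpen_chart_target x₁).mem_nhds hp.1))).and
    ((contMDiffAt_prod_chart_symm hp.1).continuousAt.eventually (hW.mem_nhds hp.2))

variable [T2Space M] [FiniteDimensional ℝ E]

theorem isOpen_flowChartDomain (hX : IsSmoothVectorField X) (x₁ x₂ : M) :
    IsOpen (flowChartDomain X x₁ x₂) := by
  refine isOpen_iff_mem_nhds.2 fun p hp ↦ ?_
  have h1 := (contMDiffAt_prod_chart_symm hp.1).continuousAt
  have h2 := ContinuousAt.comp (f := fun p : ℝ × E ↦ (p.1, (extChartAt 𝓘(ℝ, E) x₁).symm p.2))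
    (g := fun p : ℝ × M ↦ flow X p.1 p.2) (contMDiffAt_flow hX hp.2.1).continuousAt h1
  exact ((continuousAt_snd.eventually ((isOpen_chart_target x₁).mem_nhds hp.1))).and
    ((h1.eventually ((isOpen_flowDomain hX).mem_nhds hp.2.1)).and
    (h2.eventually ((isOpen_extChartAt_source x₂).mem_nhds hp.2.2)))

theorem contDiffAt_flowInChart (hX : IsSmoothVectorField X) {x₁ x₂ : M} {p : ℝ × E}
    (hp : p ∈ flowChartDomain X x₁ x₂) : ContDiffAt ℝ ∞ (flowInChart X x₁ x₂) p :=
  (ContMDiffAt.comp p (contMDiffAt_chart le_rfl hp.2.2) (ContMDiffAt.comp p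
    (g := fun p : ℝ × M ↦ flow X p.1 p.2) (contMDiffAt_flow hX hp.2.1)
    (contMDiffAt_prod_chart_symm hp.1))).contDiffAt

theorem mdifferentiableAt_flow (hX : IsSmoothVectorField X) {t : ℝ} {x : M}
    (h : (t, x) ∈ flowDomain X) : MDifferentiableAt 𝓘(ℝ, E) 𝓘(ℝ, E) (flow X t) x := by
  have hc : ContMDiffAt 𝓘(ℝ, E) (𝓘(ℝ, ℝ).prod 𝓘(ℝ, E)) ∞ (fun z : M ↦ (t, z)) x :=
    contMDiffAt_const.prodMk contMDiffAt_id
  exact (ContMDiffAt.comp x (g := fun p : ℝ × M ↦ flow X p.1 p.2)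
    (contMDiffAt_flow hX h) hc).mdifferentiableAt (by simp)

theorem flowJacobian_eq (hX : IsSmoothVectorField X) {x₁ x₂ : M} {p : ℝ × E}
    (hp : p ∈ flowChartDomain X x₁ x₂) : flowJacobian X x₁ x₂ p =
      dChart E x₂ (flow X p.1 ((extChartAt 𝓘(ℝ, E) x₁).symm p.2)) ∘L
        tangentMapAt E (flow X p.1) ((extChartAt 𝓘(ℝ, E) x₁).symm p.2) ∘L dChartSymm x₁ p.2 :=
  (hasFDerivAt_inCharts hp.1 (mdifferentiableAt_flow hX hp.2.1) hp.2.2).fderiv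

theorem contDiffAt_flowJacobian (hX : IsSmoothVectorField X) {x₁ x₂ : M} {p : ℝ × E}
    (hp : p ∈ flowChartDomain X x₁ x₂) : ContDiffAt ℝ ∞ (flowJacobian X x₁ x₂) p := by
  have h1 := (contDiffAt_flowInChart hX hp).fderiv_right (m := ∞) (by simp)
  have h2 : ContDiff ℝ ∞
      ((ContinuousLinearMap.compL ℝ E (ℝ × E) E).flip (ContinuousLinearMap.inr ℝ ℝ E)) := by
    fun_prop
  refine (ContDiffAt.comp p h2.contDiffAt h1).congr_of_eventuallyEq ?_
  filter_upwards [(isOpen_flowChartDomain hX x₁ x₂).mem_nhds hp] with q hq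
  have h3 := (contDiffAt_flowInChart hX hq).differentiableAt (by simp)
  exact (HasFDerivAt.comp (f := fun v : E ↦ (q.1, v)) q.2 h3.hasFDerivAt
    (hasFDerivAt_prodMk_right q.1 q.2)).fderiv

theorem hasDerivAt_flowInChart (hX : IsSmoothVectorField X) {x₁ x₂ : M} {p : ℝ × E}
    (hp : p ∈ flowChartDomain X x₁ x₂) : HasDerivAt (fun s ↦ flowInChart X x₁ x₂ (s, p.2))
      (vectorInChart x₂ X (flowInChart X x₁ x₂ p)) p.1 := by
  have h1 := (mdifferentiableAt_chart hp.2.2).hasMFDerivAt.comp p.1 (hasMFDerivAt_flow hX hp.2.1)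
  have h2 : HasDerivAt (fun s ↦ flowInChart X x₁ x₂ (s, p.2)) _ p.1 :=
    HasFDerivAt.hasDerivAt (hasMFDerivAt_iff_hasFDerivAt.1 h1)
  set z := flow X p.1 ((extChartAt 𝓘(ℝ, E) x₁).symm p.2) with hz
  have h3 : vectorInChart x₂ X (flowInChart X x₁ x₂ p) = dChart E x₂ z (X z) := by
    rw [vectorInChart, flowInChart, (extChartAt 𝓘(ℝ, E) x₂).left_inv hp.2.2]
  rw [h3]
  have h4 : dChart E x₂ z ((1 : ℝ) • (X z : E)) = dChart E x₂ z (X z) := by rw [one_smul]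
  rw [← h4]
  exact h2

/-- The variational equation for the flow of `X`, in charts. -/
theorem hasDerivAt_flowJacobian (hX : IsSmoothVectorField X) {x₁ x₂ : M} {t : ℝ} {u : E}
    (hp : (t, u) ∈ flowChartDomain X x₁ x₂) : HasDerivAt (fun s ↦ flowJacobian X x₁ x₂ (s, u))
      (fderiv ℝ (vectorInChart x₂ X) (flowInChart X x₁ x₂ (t, u)) ∘L
        flowJacobian X x₁ x₂ (t, u)) t := by
  refine hasDerivAt_fderiv_of_flow (contDiffAt_flowInChart hX hp)
    (((contDiffOn_vectorInChart hX x₂).contDiffAt ((isOpen_chart_target x₂).mem_nhds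
      (flowInChart_mem_target hp))).differentiableAt (by simp)) ?_
  filter_upwards [(isOpen_flowChartDomain hX x₁ x₂).mem_nhds hp] with q hq
  exact hasDerivAt_flowInChart hX hq

/-- `dφ_{-t} ∘ dφ_t = 1`. -/
theorem tangentMapAt_flow_neg_comp (hX : IsSmoothVectorField X) {t : ℝ} {x : M}
    (h : (t, x) ∈ flowDomain X) :
    tangentMapAt E (flow X (-t)) (flow X t x) ∘L tangentMapAt E (flow X t) x =
      ContinuousLinearMap.id ℝ E := by
  have h1 := (mdifferentiableAt_flow hX (flow_neg_flow hX h).1).hasMFDerivAt.comp x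
    (mdifferentiableAt_flow hX h).hasMFDerivAt
  have hev : ∀ᶠ z in 𝓝 x, (t, z) ∈ flowDomain X :=
    (Continuous.prodMk_right t).continuousAt.eventually ((isOpen_flowDomain hX).mem_nhds h)
  have h2 := h1.congr_of_eventuallyEq (f₁ := id) (hev.mono fun z hz ↦ (flow_neg_flow hX hz).2.symm)
  exact (hasMFDerivAt_unique h2 (hasMFDerivAt_id x))

/-- `dφ_t ∘ dφ_{-t} = 1`. -/
theorem tangentMapAt_flow_comp_neg (hX : IsSmoothVectorField X) {t : ℝ} {x : M}
    (h : (t, x) ∈ flowDomain X) :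
    tangentMapAt E (flow X t) x ∘L tangentMapAt E (flow X (-t)) (flow X t x) =
      ContinuousLinearMap.id ℝ E := by
  have h1 := tangentMapAt_flow_neg_comp hX (flow_neg_flow hX h).1
  rwa [(flow_neg_flow hX h).2, neg_neg] at h1

/-! ### Pull-back and push-forward along the flow -/

theorem isSmoothFormFamilyOn_flowPullback (hX : IsSmoothVectorField X) {k : ℕ}
    {β : FormField E M k} (hβ : IsSmoothForm β) :
    IsSmoothFormFamilyOn (fun t ↦ flowPullback X t β) (flowDomain X) := by
  rintro x₁ ⟨t, u⟩ ⟨hu, h⟩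
  dsimp only at hu h
  set y := flow X t ((extChartAt 𝓘(ℝ, E) x₁).symm u) with hy
  have hp : (t, u) ∈ flowChartDomain X x₁ y := ⟨hu, h, mem_extChartAt_source y⟩
  refine ContDiffAt.contDiffWithinAt ?_
  have h1 : ContDiffAt ℝ ∞ (fun p ↦ formInChart y β (flowInChart X x₁ y p)) (t, u) :=
    ContDiffAt.comp (t, u) ((hβ y).contDiffAt ((isOpen_chart_target y).mem_nhds
      (flowInChart_mem_target hp))) (contDiffAt_flowInChart hX hp)
  refine (contDiffAt_pullForm (contDiffAt_flowJacobian hX hp) h1).congr_of_eventuallyEq ?_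
  filter_upwards [(isOpen_flowChartDomain hX x₁ y).mem_nhds hp] with q hq
  exact pullForm_inCharts β hq.1 (mdifferentiableAt_flow hX hq.2.1) hq.2.2

/-- The coordinate expression of `(φ_t)_* ρ`. -/
theorem bivectorInChart_flowPushforward (hX : IsSmoothVectorField X) (ρ : BivectorField E M)
    {t : ℝ} {x₀ x₁ : M} {v : E} (hp : (-t, v) ∈ flowChartDomain X x₀ x₁) :
    bivectorInChart x₀ (flowPushforward X t ρ) v =
      pushBivector (flowJacobian X x₁ x₀ (t, flowInChart X x₀ x₁ (-t, v)))
        (bivectorInChart x₁ ρ (flowInChart X x₀ x₁ (-t, v))) := by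
  obtain ⟨hv, hd, hs⟩ := hp
  dsimp only at hv hd hs
  set y := (extChartAt 𝓘(ℝ, E) x₀).symm v with hy
  have hback := flow_neg_flow hX hd
  rw [neg_neg] at hback
  have hys : y ∈ (extChartAt 𝓘(ℝ, E) x₀).source := (extChartAt 𝓘(ℝ, E) x₀).map_target hv
  have hq : (t, flowInChart X x₀ x₁ (-t, v)) ∈ flowChartDomain X x₁ x₀ :=
    mem_flowChartDomain hs hback.1 (by rw [hback.2]; exact hys)
  have hinv : (extChartAt 𝓘(ℝ, E) x₁).symm (flowInChart X x₀ x₁ (-t, v)) = flow X (-t) y :=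
    (extChartAt 𝓘(ℝ, E) x₁).left_inv hs
  rw [flowJacobian_eq hX hq, bivectorInChart, bivectorInChart, flowPushforward, pushBivector_comp,
    pushBivector_comp]
  dsimp only
  rw [hinv, ← hy, hback.2]
  congr 1
  rw [ContinuousLinearMap.comp_assoc, ContinuousLinearMap.comp_assoc, flowInChart]
  dsimp only
  rw [dChartSymm_comp_dChart' hs, ContinuousLinearMap.comp_id]

theorem flowPushforward_flowPushforward_neg (hX : IsSmoothVectorField X) (σ : BivectorField E M)
    {t : ℝ} {y : M} (h : (-t, y) ∈ flowDomain X) :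
    flowPushforward X t (flowPushforward X (-t) σ) y = σ y := by
  have h1 := tangentMapAt_flow_neg_comp hX h
  have h2 := flow_neg_flow hX h
  rw [neg_neg] at h1 h2
  rw [flowPushforward, flowPushforward, neg_neg, h2.2, pushBivector_comp, h1, pushBivector_id]

/-- The push-forward of a smooth family of bivector fields along the flow is smooth. -/
theorem contDiffAt_flowPushforward (hX : IsSmoothVectorField X) {ρ : ℝ → BivectorField E M}
    {t : ℝ} {x₀ x₁ : M} {v : E} (hp : (-t, v) ∈ flowChartDomain X x₀ x₁)
    (hρ : ContDiffAt ℝ ∞ (fun p : ℝ × E ↦ bivectorInChart x₁ (ρ p.1) p.2)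
      (t, flowInChart X x₀ x₁ (-t, v))) :
    ContDiffAt ℝ ∞ (fun p : ℝ × E ↦ bivectorInChart x₀ (flowPushforward X p.1 (ρ p.1)) p.2)
      (t, v) := by
  have hneg : ContDiff ℝ ∞ fun p : ℝ × E ↦ (-p.1, p.2) := by fun_prop
  have h1 : ContDiffAt ℝ ∞ (fun p : ℝ × E ↦ (p.1, flowInChart X x₀ x₁ (-p.1, p.2))) (t, v) :=
    contDiffAt_fst.prodMk (ContDiffAt.comp (t, v) (g := flowInChart X x₀ x₁)
      (contDiffAt_flowInChart hX hp) hneg.contDiffAt)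
  have hq : (t, flowInChart X x₀ x₁ (-t, v)) ∈ flowChartDomain X x₁ x₀ := by
    have hback := flow_neg_flow hX hp.2.1
    rw [neg_neg] at hback
    exact mem_flowChartDomain hp.2.2 hback.1
      (by rw [hback.2]; exact (extChartAt 𝓘(ℝ, E) x₀).map_target hp.1)
  refine (contDiffAt_pushBivector (ContDiffAt.comp (t, v) (contDiffAt_flowJacobian hX hq) h1)
    (ContDiffAt.comp (t, v) hρ h1)).congr_of_eventuallyEq ?_
  filter_upwards [hneg.continuous.continuousAt.eventually
    ((isOpen_flowChartDomain hX x₀ x₁).mem_nhds hp)] with q hq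
  exact bivectorInChart_flowPushforward hX (ρ q.1) hq

/-- Pushing back a family `σ_s` along the flow: the derivative of `s ↦ (φ_{-s})_* σ_s` is
`(φ_{-s})_* (∂_s σ_s + 𝓛_X σ_s)`. -/
theorem hasDerivAt_flowPushforward_neg (hX : IsSmoothVectorField X) {σ : ℝ → BivectorField E M}
    {W : Set (ℝ × M)} (hW : IsOpen W) (hσ : IsSmoothBivectorFamilyOn σ W) {t : ℝ} {x : M}
    (hx : (t, x) ∈ flowDomain X) (hxW : (t, flow X t x) ∈ W) {σ' : Bivector E}
    (hσ' : HasDerivAt (fun s ↦ σ s (flow X t x)) σ' t) :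
    HasDerivAt (fun s ↦ flowPushforward X (-s) (σ s) x)
      (pushBivector (tangentMapAt E (flow X (-t)) (flow X t x))
        (σ' + schouten X (σ t) (flow X t x))) t := by
  set y := flow X t x with hy
  set u := extChartAt 𝓘(ℝ, E) x x with hu
  have hxs : x ∈ (extChartAt 𝓘(ℝ, E) x).source := mem_extChartAt_source x
  have hys : y ∈ (extChartAt 𝓘(ℝ, E) y).source := mem_extChartAt_source y
  have hux : (extChartAt 𝓘(ℝ, E) x).symm u = x := (extChartAt 𝓘(ℝ, E) x).left_inv hxs
  have hp : (t, u) ∈ flowChartDomain X x y := mem_flowChartDomain hxs hx hys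
  have hψy : flowInChart X x y (t, u) = extChartAt 𝓘(ℝ, E) y y := by
    simp only [flowInChart, hux, ← hy]
  -- the family `σ` in the chart around `y`
  have hσ2 : ContDiffAt ℝ ∞ (fun p : ℝ × E ↦ bivectorInChart y (σ p.1) p.2)
      (t, flowInChart X x y (t, u)) := by
    refine (hσ y).contDiffAt ((isOpen_inChart y hW).mem_nhds ⟨flowInChart_mem_target hp, ?_⟩)
    dsimp only
    rw [hψy, (extChartAt 𝓘(ℝ, E) y).left_inv hys]
    exact hxW
  -- the family `s ↦ (φ_{-s})_* σ_s` at `x`, in the chart around `x`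
  let τ : ℝ → Bivector E := fun s ↦ bivectorInChart x (flowPushforward X (-s) (σ s)) u
  obtain ⟨τ', hτ⟩ : ∃ τ', HasDerivAt τ τ' t := by
    have hneg : ContDiff ℝ ∞ fun p : ℝ × E ↦ (-p.1, p.2) := by fun_prop
    have hp' : (- -t, u) ∈ flowChartDomain X x y := by rwa [neg_neg]
    have h1 := contDiffAt_flowPushforward hX (ρ := fun s ↦ σ (-s)) hp' (by
      refine ContDiffAt.comp (g := fun p : ℝ × E ↦ bivectorInChart y (σ p.1) p.2) _ ?_
        hneg.contDiffAt
      simpa using hσ2)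
    have h2 : ContDiffAt ℝ ∞ (fun s : ℝ ↦ (-s, u)) t := by fun_prop
    have h3 := (ContDiffAt.comp t h1 h2).differentiableAt (by simp)
    refine ⟨_, h3.hasDerivAt.congr_of_eventuallyEq (Filter.Eventually.of_forall fun s ↦ ?_)⟩
    simp [τ]
  have hτe : ∀ s, flowPushforward X (-s) (σ s) x = pushBivector (dChartSymm x u) (τ s) :=
    fun s ↦ eq_pushBivector_bivectorInChart _ hxs
  have hev : ∀ᶠ s in 𝓝 t, (s, u) ∈ flowChartDomain X x y :=
    (Continuous.prodMk_left u).continuousAt.eventually ((isOpen_flowChartDomain hX x y).mem_nhds hp)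
  -- in charts, `σ_s` is the image of `τ_s` under the Jacobian matrix of `φ_s`
  have hpush : ∀ s, (s, u) ∈ flowChartDomain X x y →
      pushBivector (flowJacobian X x y (s, u)) (τ s) =
        bivectorInChart y (σ s) (flowInChart X x y (s, u)) := by
    intro s hs
    have hsx := hs.2.1
    have hsy := hs.2.2
    dsimp only at hsx hsy
    rw [hux] at hsx hsy
    have hback := flow_neg_flow hX hsx
    have hs' : (-s, flowInChart X x y (s, u)) ∈ flowChartDomain X y x := by
      have := mem_flowChartDomain (x₂ := x) hsy hback.1 (by rw [hback.2]; exact hxs)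
      simpa only [flowInChart, hux] using this
    have hinv : (extChartAt 𝓘(ℝ, E) y).symm (flowInChart X x y (s, u)) = flow X s x := by
      simp only [flowInChart, hux]
      exact (extChartAt 𝓘(ℝ, E) y).left_inv hsy
    have hu' : flowInChart X y x (-s, flowInChart X x y (s, u)) = u := by
      rw [flowInChart]
      dsimp only
      rw [hinv, hback.2]
    have h1 := bivectorInChart_flowPushforward hX (flowPushforward X (-s) (σ s)) hs'
    rw [hu'] at h1
    rw [← h1, bivectorInChart, bivectorInChart, hinv,
      flowPushforward_flowPushforward_neg hX _ hback.1]
  have hA := hasDerivAt_flowJacobian hX hp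
  have hl := hasDerivAt_pushBivector hA hτ
  -- the chain rule for `s ↦ σ_s (φ_s x)` in the chart around `y`
  have hr : HasDerivAt (fun s ↦ bivectorInChart y (σ s) (flowInChart X x y (s, u)))
      (pushBivector (dChart E y y) σ' + fderiv ℝ (bivectorInChart y (σ t))
        (flowInChart X x y (t, u)) (vectorInChart y X (flowInChart X x y (t, u)))) t := by
    have h0 := (hσ2.differentiableAt (by simp)).hasFDerivAt
    have h1 := h0.comp_hasDerivAt t ((hasDerivAt_id t).prodMk (hasDerivAt_flowInChart hX hp))
    have h2 := h0.comp_hasDerivAt t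
      ((hasDerivAt_id t).prodMk (hasDerivAt_const t (flowInChart X x y (t, u))))
    have h3 := (h0.comp _ (hasFDerivAt_prodMk_right t (flowInChart X x y (t, u)))).fderiv
    have h4 : HasDerivAt (fun s ↦ bivectorInChart y (σ s) (flowInChart X x y (t, u)))
        (pushBivector (dChart E y y) σ') t := by
      simp only [hψy, bivectorInChart_chart _ hys]
      exact hasDerivAt_pushBivector_const _ hσ'
    have h5 := h4.unique h2
    have h6 := DFunLike.congr_fun h3 (vectorInChart y X (flowInChart X x y (t, u)))
    have h7 : ((1 : ℝ), vectorInChart y X (flowInChart X x y (t, u))) =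
      (1, 0) + (0, vectorInChart y X (flowInChart X x y (t, u))) := by simp
    rw [h7, map_add] at h1
    rw [h5]
    refine HasDerivAt.congr_deriv h1 (congrArg _ h6.symm)
  have heq := (hr.congr_of_eventuallyEq (hev.mono hpush)).unique hl
  rw [hpush t hp] at heq
  have hsch : schouten X (σ t) y = pushBivector (dChartSymm y (extChartAt 𝓘(ℝ, E) y y))
      (fderiv ℝ (bivectorInChart y (σ t)) (flowInChart X x y (t, u))
          (vectorInChart y X (flowInChart X x y (t, u))) -
        derivBivector (fderiv ℝ (vectorInChart y X) (flowInChart X x y (t, u)))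
          (bivectorInChart y (σ t) (flowInChart X x y (t, u)))) := by
    rw [hψy]
    rfl
  have hσe : σ' = pushBivector (dChartSymm y (extChartAt 𝓘(ℝ, E) y y))
      (pushBivector (dChart E y y) σ') := by
    rw [pushBivector_comp, dChartSymm_comp_dChart' hys, pushBivector_id]
  have hsum : σ' + schouten X (σ t) y = pushBivector (dChartSymm y (extChartAt 𝓘(ℝ, E) y y))
      (pushBivector (flowJacobian X x y (t, u)) τ') := by
    rw [hsch, hσe, ← pushBivector_add, ← add_sub_assoc, heq, add_sub_cancel_right]
  have hAe : dChartSymm y (extChartAt 𝓘(ℝ, E) y y) ∘L flowJacobian X x y (t, u) =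
      tangentMapAt E (flow X t) x ∘L dChartSymm x u := by
    rw [flowJacobian_eq hX hp]
    dsimp only
    rw [hux, ← hy, ← ContinuousLinearMap.comp_assoc, dChartSymm_comp_dChart' hys,
      ContinuousLinearMap.id_comp]
  rw [hsum, pushBivector_comp, pushBivector_comp, ContinuousLinearMap.comp_assoc, hAe,
    ← ContinuousLinearMap.comp_assoc, tangentMapAt_flow_neg_comp hX hx, ContinuousLinearMap.id_comp]
  simp only [hτe]
  exact hasDerivAt_pushBivector_const _ hτ

end FlowCharts

/-! ### Smooth families of forms and bivector fields -/

section Families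

variable {E : Type*} [NormedAddCommGroup E] [NormedSpace ℝ E] [FiniteDimensional ℝ E]
  {M : Type*} [TopologicalSpace M] [ChartedSpace E M] [IsManifold 𝓘(ℝ, E) ∞ M]

theorem IsSmoothFormFamilyOn.contDiffAt {k : ℕ} {γ : ℝ → FormField E M k} {W : Set (ℝ × M)}
    (hγ : IsSmoothFormFamilyOn γ W) (hW : IsOpen W) {t : ℝ} {x : M} (h : (t, x) ∈ W) :
    ContDiffAt ℝ ∞ (fun s ↦ γ s x) t := by
  have hxs : x ∈ (extChartAt 𝓘(ℝ, E) x).source := mem_extChartAt_source x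
  have h1 : (t, extChartAt 𝓘(ℝ, E) x x) ∈ inChart x W := by
    refine ⟨mem_extChartAt_target x, ?_⟩
    dsimp only
    rwa [(extChartAt 𝓘(ℝ, E) x).left_inv hxs]
  have h2 := (hγ x).contDiffAt ((isOpen_inChart x hW).mem_nhds h1)
  have h3 : ContDiffAt ℝ ∞ (fun s : ℝ ↦ (s, extChartAt 𝓘(ℝ, E) x x)) t := by fun_prop
  have h4 := contDiffAt_pullForm (contDiffAt_const (c := dChart E x x)) (ContDiffAt.comp t h2 h3)
  exact h4.congr_of_eventuallyEq
    (Filter.Eventually.of_forall fun s ↦ eq_pullForm_formInChart (γ s) hxs)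

theorem IsSmoothBivectorFamilyOn.contDiffAt {σ : ℝ → BivectorField E M} {W : Set (ℝ × M)}
    (hσ : IsSmoothBivectorFamilyOn σ W) (hW : IsOpen W) {t : ℝ} {x : M} (h : (t, x) ∈ W) :
    ContDiffAt ℝ ∞ (fun s ↦ σ s x) t := by
  have hxs : x ∈ (extChartAt 𝓘(ℝ, E) x).source := mem_extChartAt_source x
  have h1 : (t, extChartAt 𝓘(ℝ, E) x x) ∈ inChart x W := by
    refine ⟨mem_extChartAt_target x, ?_⟩
    dsimp only
    rwa [(extChartAt 𝓘(ℝ, E) x).left_inv hxs]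
  have h2 := (hσ x).contDiffAt ((isOpen_inChart x hW).mem_nhds h1)
  have h3 : ContDiffAt ℝ ∞ (fun s : ℝ ↦ (s, extChartAt 𝓘(ℝ, E) x x)) t := by fun_prop
  have h4 := contDiffAt_pushBivector
    (contDiffAt_const (c := dChartSymm x (extChartAt 𝓘(ℝ, E) x x))) (ContDiffAt.comp t h2 h3)
  exact h4.congr_of_eventuallyEq
    (Filter.Eventually.of_forall fun s ↦ eq_pushBivector_bivectorInChart (σ s) hxs)

omit [FiniteDimensional ℝ E] [IsManifold 𝓘(ℝ, E) ∞ M] in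
theorem IsSmoothFormFamilyOn.add {k : ℕ} {γ γ' : ℝ → FormField E M k} {W : Set (ℝ × M)}
    (hγ : IsSmoothFormFamilyOn γ W) (hγ' : IsSmoothFormFamilyOn γ' W) :
    IsSmoothFormFamilyOn (fun t x ↦ γ t x + γ' t x) W := fun x₀ ↦ (hγ x₀).add (hγ' x₀)

omit [FiniteDimensional ℝ E] [IsManifold 𝓘(ℝ, E) ∞ M] in
theorem IsSmoothFormFamilyOn.time_smul {k : ℕ} {γ : ℝ → FormField E M k} {W : Set (ℝ × M)}
    (hγ : IsSmoothFormFamilyOn γ W) : IsSmoothFormFamilyOn (fun t x ↦ t • γ t x) W :=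
  fun x₀ ↦ contDiffOn_fst.smul (hγ x₀)

omit [FiniteDimensional ℝ E] [IsManifold 𝓘(ℝ, E) ∞ M] in
theorem IsSmoothFormFamilyOn.congr {k : ℕ} {γ γ' : ℝ → FormField E M k} {W : Set (ℝ × M)}
    (hγ : IsSmoothFormFamilyOn γ W) (h : ∀ t x, (t, x) ∈ W → γ' t x = γ t x) :
    IsSmoothFormFamilyOn γ' W := fun x₀ ↦ (hγ x₀).congr fun p hp ↦ by
  simp only [formInChart]
  rw [h _ _ hp.2]

/-- The set of points of `V` at which `e^{C_t} π` is defined. -/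
def expDomain (C : ℝ → FormField E M 2) (π : BivectorField E M) (V : Set (ℝ × M)) :
    Set (ℝ × M) := {p | p ∈ V ∧ (onePlus (C p.1 p.2) (π p.2)).IsInvertible}

theorem isInvertible_onePlus_inChart {C : FormField E M 2} {π : BivectorField E M} {x₀ : M} {u : E}
    (hu : u ∈ (extChartAt 𝓘(ℝ, E) x₀).target)
    (h : (onePlus (C ((extChartAt 𝓘(ℝ, E) x₀).symm u))
      (π ((extChartAt 𝓘(ℝ, E) x₀).symm u))).IsInvertible) :
    (onePlus (formInChart x₀ C u) (bivectorInChart x₀ π u)).IsInvertible :=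
  isInvertible_onePlus_conj (dChartSymm_comp_dChart hu) (dChart_comp_dChartSymm hu) h

theorem isInvertible_onePlus_of_inChart {C : FormField E M 2} {π : BivectorField E M} {x₀ x : M}
    (hx : x ∈ (extChartAt 𝓘(ℝ, E) x₀).source)
    (h : (onePlus (formInChart x₀ C (extChartAt 𝓘(ℝ, E) x₀ x))
      (bivectorInChart x₀ π (extChartAt 𝓘(ℝ, E) x₀ x))).IsInvertible) :
    (onePlus (C x) (π x)).IsInvertible := by
  rw [eq_pullForm_formInChart C hx, eq_pushBivector_bivectorInChart π hx]
  exact isInvertible_onePlus_conj (dChart_comp_dChartSymm' hx) (dChartSymm_comp_dChart' hx) h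

theorem isOpen_expDomain {C : ℝ → FormField E M 2} {π : BivectorField E M} {V : Set (ℝ × M)}
    (hV : IsOpen V) (hC : IsSmoothFormFamilyOn C V) (hπ : IsSmoothBivectorField π) :
    IsOpen (expDomain C π V) := by
  refine isOpen_iff_mem_nhds.2 fun ⟨t, x⟩ ⟨hp, hinv⟩ ↦ ?_
  dsimp only at hinv
  have hxs : x ∈ (extChartAt 𝓘(ℝ, E) x).source := mem_extChartAt_source x
  have hxt := mem_extChartAt_target (I := 𝓘(ℝ, E)) x
  have hxl := (extChartAt 𝓘(ℝ, E) x).left_inv hxs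
  have h1 : (t, extChartAt 𝓘(ℝ, E) x x) ∈ inChart x V := by
    refine ⟨hxt, ?_⟩
    dsimp only
    rwa [hxl]
  have h2 := (hC x).contDiffAt ((isOpen_inChart x hV).mem_nhds h1)
  have h3 : ContDiffAt ℝ ∞ (fun p : ℝ × E ↦ bivectorInChart x π p.2)
      (t, extChartAt 𝓘(ℝ, E) x x) :=
    ContDiffAt.comp (g := bivectorInChart x π) _ ((hπ x).contDiffAt
      ((isOpen_chart_target x).mem_nhds hxt)) contDiffAt_snd
  have h4 : ContinuousAt (fun p : ℝ × M ↦ (p.1, extChartAt 𝓘(ℝ, E) x p.2)) (t, x) :=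
    continuousAt_fst.prodMk (ContinuousAt.comp (continuousAt_extChartAt x) continuousAt_snd)
  have h5 := ContinuousAt.comp (f := fun p : ℝ × M ↦ (p.1, extChartAt 𝓘(ℝ, E) x p.2)) (x := (t, x))
    (contDiffAt_onePlus h2 h3).continuousAt h4
  have h6 := eventually_isInvertible h5 (isInvertible_onePlus_inChart hxt (by rwa [hxl]))
  filter_upwards [hV.mem_nhds hp, h6, continuousAt_snd.eventually
    ((isOpen_extChartAt_source (I := 𝓘(ℝ, E)) x).mem_nhds hxs)] with q hq hq' hqs
  exact ⟨hq, isInvertible_onePlus_of_inChart hqs hq'⟩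

theorem isSmoothBivectorFamilyOn_expBivector {C : ℝ → FormField E M 2} {π : BivectorField E M}
    {V : Set (ℝ × M)} (hV : IsOpen V) (hC : IsSmoothFormFamilyOn C V)
    (hπ : IsSmoothBivectorField π) :
    IsSmoothBivectorFamilyOn (fun t x ↦ expBivector (C t x) (π x)) (expDomain C π V) := by
  rintro x₀ ⟨t, u⟩ hp
  refine ContDiffAt.contDiffWithinAt ?_
  have h2 := (hC x₀).contDiffAt ((isOpen_inChart x₀ hV).mem_nhds ⟨hp.1, hp.2.1⟩)
  have h3 : ContDiffAt ℝ ∞ (fun p : ℝ × E ↦ bivectorInChart x₀ π p.2) (t, u) :=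
    ContDiffAt.comp (g := bivectorInChart x₀ π) _ ((hπ x₀).contDiffAt
      ((isOpen_chart_target x₀).mem_nhds hp.1)) contDiffAt_snd
  refine (contDiffAt_expBivector h2 h3
    (isInvertible_onePlus_inChart hp.1 hp.2.2)).congr_of_eventuallyEq ?_
  filter_upwards [(isOpen_inChart x₀ (isOpen_expDomain hV hC hπ)).mem_nhds hp] with q hq
  exact expBivector_conj (dChartSymm_comp_dChart hq.1) (dChart_comp_dChartSymm hq.1) hq.2.2

variable [T2Space M] {X : VectorFieldOn E M}

theorem isOpen_flowDomain_section (hX : IsSmoothVectorField X) (x : M) :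
    IsOpen {s : ℝ | (s, x) ∈ flowDomain X} :=
  (isOpen_flowDomain hX).preimage (Continuous.prodMk_left x)

theorem IsSmoothFormFamilyOn.continuousOn_uIcc (hX : IsSmoothVectorField X) {k : ℕ}
    {γ : ℝ → FormField E M k} (hγ : IsSmoothFormFamilyOn γ (flowDomain X)) {t : ℝ} {x : M}
    (h : (t, x) ∈ flowDomain X) : ContinuousOn (fun s ↦ γ s x) (uIcc 0 t) := fun _ hs ↦
  (hγ.contDiffAt (isOpen_flowDomain hX) (flowDomain_of_mem h hs)).continuousAt.continuousWithinAt

theorem hasDerivAt_primitive (hX : IsSmoothVectorField X) {k : ℕ}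
    {γ : ℝ → FormField E M k} (hγ : IsSmoothFormFamilyOn γ (flowDomain X)) {t : ℝ} {x : M}
    (h : (t, x) ∈ flowDomain X) :
    HasDerivAt (fun r ↦ ∫ s in (0 : ℝ)..r, γ s x) (γ t x) t := by
  have hc : ∀ s ∈ {s : ℝ | (s, x) ∈ flowDomain X}, ContinuousAt (fun s ↦ γ s x) s := fun s hs ↦
    (hγ.contDiffAt (isOpen_flowDomain hX) hs).continuousAt
  have hi : IntervalIntegrable (fun s ↦ γ s x) MeasureTheory.volume 0 t :=
    (hγ.continuousOn_uIcc hX h).intervalIntegrable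
  exact intervalIntegral.integral_hasDerivAt_right hi
    (ContinuousAt.stronglyMeasurableAtFilter (isOpen_flowDomain_section hX x) hc t h) (hc t h)

theorem isSmoothFormFamilyOn_primitive (hX : IsSmoothVectorField X) {k : ℕ}
    {γ : ℝ → FormField E M k} (hγ : IsSmoothFormFamilyOn γ (flowDomain X)) :
    IsSmoothFormFamilyOn (fun t x ↦ ∫ s in (0 : ℝ)..t, γ s x) (flowDomain X) := by
  rintro x₀ ⟨t, u⟩ hp
  refine ContDiffAt.contDiffWithinAt ?_
  have ho := isOpen_inChart (E := E) x₀ (isOpen_flowDomain hX)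
  have h1 := contDiffAt_parametric_primitive ho (hγ x₀) (t₀ := t) (p₀ := u)
    fun r hr ↦ ⟨hp.1, flowDomain_scaled hp.2 hr⟩
  refine h1.congr_of_eventuallyEq ?_
  filter_upwards [ho.mem_nhds hp] with q hq
  exact ((ContinuousAlternatingMap.compContinuousLinearMapCLM
    (dChartSymm x₀ q.2)).intervalIntegral_comp_comm
    ((hγ.continuousOn_uIcc hX hq.2).intervalIntegrable (μ := MeasureTheory.volume))).symm

end Families

/-! ### The family `C_t` -/

section FamilyC

variable {E : Type*} [NormedAddCommGroup E] [NormedSpace ℝ E] [FiniteDimensional ℝ E]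
  {M : Type*} [TopologicalSpace M] [ChartedSpace E M] [IsManifold 𝓘(ℝ, E) ∞ M] [T2Space M]
  {B : FormField E M 2} {X : VectorFieldOn E M} {H : FormField E M 3}

theorem isSmoothFormFamilyOn_velocityD (hB : IsSmoothForm B) (hX : IsSmoothVectorField X) :
    IsSmoothFormFamilyOn (fun t x ↦ t • flowPullback X t (contractField X (deRham B)) x)
      (flowDomain X) :=
  (isSmoothFormFamilyOn_flowPullback hX
    (isSmoothForm_contractField hX (isSmoothForm_deRham hB))).time_smul

theorem exists_isPrimitiveD (hB : IsSmoothForm B) (hX : IsSmoothVectorField X) :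
    ∃ D, IsPrimitiveD B X D :=
  ⟨fun t x ↦ ∫ s in (0 : ℝ)..t, s • flowPullback X s (contractField X (deRham B)) x,
    fun _ ↦ intervalIntegral.integral_same,
    fun _ _ h ↦ hasDerivAt_primitive hX (isSmoothFormFamilyOn_velocityD hB hX) h⟩

theorem IsPrimitiveD.eq_integral (hB : IsSmoothForm B) (hX : IsSmoothVectorField X)
    {D : ℝ → FormField E M 2} (hD : IsPrimitiveD B X D) {t : ℝ} {x : M}
    (h : (t, x) ∈ flowDomain X) :
    D t x = ∫ s in (0 : ℝ)..t, s • flowPullback X s (contractField X (deRham B)) x := by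
  rw [intervalIntegral.integral_eq_sub_of_hasDerivAt
    (fun s hs ↦ hD.2 s x (flowDomain_of_mem h hs))
    ((isSmoothFormFamilyOn_velocityD hB hX).continuousOn_uIcc hX h).intervalIntegrable, hD.1,
    sub_zero]

/-- The time derivative `φ_t^* (B - ι_X H_t)` of `C_t`, where `H_t = H - t dB`. -/
def velocityC (B : FormField E M 2) (X : VectorFieldOn E M) (H : FormField E M 3) (t : ℝ) :
    FormField E M 2 :=
  flowPullback X t fun y ↦ B y - contractField X (fun z ↦ H z - t • deRham B z) y

omit [FiniteDimensional ℝ E] [IsManifold 𝓘(ℝ, E) ∞ M] [T2Space M] in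
theorem velocityC_eq (t : ℝ) (x : M) : velocityC B X H t x =
    t • flowPullback X t (contractField X (deRham B)) x +
      flowPullback X t (fun y ↦ B y - contractField X H y) x := by
  rw [velocityC, flowPullback, flowPullback, flowPullback, ← pullForm_smul, ← pullForm_add]
  congr 1
  have h1 : contractField X (fun z ↦ H z - t • deRham B z) (flow X t x) =
    contractField X H (flow X t x) - t • contractField X (deRham B) (flow X t x) := rfl
  rw [h1]
  abel

theorem isSmoothFormFamilyOn_velocityC (hB : IsSmoothForm B) (hX : IsSmoothVectorField X)
    (hH : IsSmoothForm H) : IsSmoothFormFamilyOn (velocityC B X H) (flowDomain X) :=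
  ((isSmoothFormFamilyOn_velocityD hB hX).add (isSmoothFormFamilyOn_flowPullback hX
    (hB.sub (isSmoothForm_contractField hX hH)))).congr fun t x _ ↦ velocityC_eq t x

variable {D : ℝ → FormField E M 2}

theorem isSmoothFormFamilyOn_formC (hB : IsSmoothForm B) (hX : IsSmoothVectorField X)
    (hH : IsSmoothForm H) (hD : IsPrimitiveD B X D) :
    IsSmoothFormFamilyOn (formC B X H D) (flowDomain X) :=
  IsSmoothFormFamilyOn.add
    ((isSmoothFormFamilyOn_primitive hX (isSmoothFormFamilyOn_velocityD hB hX)).congr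
      fun _ _ h ↦ hD.eq_integral hB hX h)
    (isSmoothFormFamilyOn_primitive hX (isSmoothFormFamilyOn_flowPullback hX
      (hB.sub (isSmoothForm_contractField hX hH))))

theorem hasDerivAt_formC (hB : IsSmoothForm B) (hX : IsSmoothVectorField X)
    (hH : IsSmoothForm H) (hD : IsPrimitiveD B X D) {t : ℝ} {x : M} (h : (t, x) ∈ flowDomain X) :
    HasDerivAt (fun s ↦ formC B X H D s x) (velocityC B X H t x) t := by
  rw [velocityC_eq]
  exact HasDerivAt.add (hD.2 t x h) (hasDerivAt_primitive hX (isSmoothFormFamilyOn_flowPullback hX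
    (hB.sub (isSmoothForm_contractField hX hH))) h)

omit [FiniteDimensional ℝ E] [IsManifold 𝓘(ℝ, E) ∞ M] [T2Space M] in
theorem formC_zero (hD : IsPrimitiveD B X D) (x : M) : formC B X H D 0 x = 0 := by
  rw [formC, hD.1, intervalIntegral.integral_same, add_zero]

end FamilyC

/-! ### The integral curve -/

section Curve

variable {E : Type*} [NormedAddCommGroup E] [NormedSpace ℝ E] [FiniteDimensional ℝ E]

/-- Grönwall's inequality on an interval `[0, t]` or `[t, 0]`. -/
theorem eq_zero_of_norm_deriv_le {V : Type*} [NormedAddCommGroup V] [NormedSpace ℝ V]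
    {Z Z' : ℝ → V} {K t : ℝ} (hZ : ∀ s ∈ uIcc 0 t, HasDerivAt Z (Z' s) s)
    (hK : ∀ s ∈ uIcc 0 t, ‖Z' s‖ ≤ K * ‖Z s‖) (h0 : Z 0 = 0) : Z t = 0 := by
  -- rescaling the time to `[0, 1]` treats both signs of `t` at once
  have hd : ∀ r ∈ Icc (0 : ℝ) 1, HasDerivAt (fun r ↦ Z (r * t)) (t • Z' (r * t)) r := fun r hr ↦
    HasDerivAt.scomp r (hZ _ (mul_mem_uIcc_zero hr)) (hasDerivAt_mul_const t)
  have h1 := eq_zero_of_abs_deriv_le_mul_abs_self_of_eq_zero_right (K := |t| * K)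
    (f := fun r ↦ Z (r * t)) (a := 0) (b := 1)
    (fun r hr ↦ (hd r hr).continuousAt.continuousWithinAt)
    (fun r hr ↦ (hd r ⟨hr.1, hr.2.le⟩).hasDerivWithinAt)
    (by simp [h0])
    (fun r hr ↦ by
      rw [norm_smul, Real.norm_eq_abs, mul_assoc]
      gcongr
      exact hK _ (mul_mem_uIcc_zero ⟨hr.1, hr.2.le⟩))
    1 ⟨zero_le_one, le_rfl⟩
  rwa [one_mul] at h1

/-- A solution of `dτ/ds = ∧²τ̃ (dC/ds)` that starts at `π` equals `e^{C_t} π` as soon as that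
bivector is defined at the time `t` (it need not be defined in between): the difference
`τ^♯ (1 + C^♭ π^♯) - π^♯` solves a homogeneous linear equation. -/
theorem eq_expBivector_of_hasDerivAt {τ : ℝ → Bivector E} {C C' : ℝ → Form E 2} {π : Bivector E}
    {t : ℝ} (hτ : ∀ s ∈ uIcc 0 t, HasDerivAt τ (wedgeTwo (τ s) (C' s)) s)
    (hC : ∀ s ∈ uIcc 0 t, HasDerivAt C (C' s) s) (hC' : ContinuousOn C' (uIcc 0 t))
    (hC0 : C 0 = 0) (hτ0 : τ 0 = π) (hinv : (onePlus (C t) π).IsInvertible) :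
    τ t = expBivector (C t) π := by
  let Z : ℝ → (E →L[ℝ] ℝ) →L[ℝ] E := fun s ↦ sharp (τ s) ∘L onePlus (C s) π - sharp π
  let A : ℝ → E →L[ℝ] E := fun s ↦ sharp (τ s) ∘L flat (C' s)
  have hZ : ∀ s ∈ uIcc 0 t, HasDerivAt Z (-(A s ∘L Z s)) s := by
    intro s hs
    have h1 := (hasDerivAt_sharp (hτ s hs)).clm_comp (hasDerivAt_onePlus (π := π) (hC s hs))
    have h2 := HasDerivAt.sub_const (𝕜 := ℝ) (F := (E →L[ℝ] ℝ) →L[ℝ] E) (sharp π) h1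
    have h3 : sharp (wedgeTwo (τ s) (C' s)) ∘L onePlus (C s) π +
        sharp (τ s) ∘L flat (C' s) ∘L sharp π = -(A s ∘L Z s) := by
      rw [sharp_wedgeTwo]
      ext1 ξ
      simp only [A, Z, add_apply, sub_apply, neg_apply, ContinuousLinearMap.comp_apply, map_sub]
      abel
    rwa [h3] at h2
  have hA : ContinuousOn A (uIcc 0 t) := by
    have h1 : ContinuousOn τ (uIcc 0 t) := fun s hs ↦ (hτ s hs).continuousAt.continuousWithinAt
    have h2 : ContinuousOn (fun s ↦ sharp (τ s)) (uIcc 0 t) :=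
      (sharpL E).continuous.comp_continuousOn h1
    have h3 : ContinuousOn (fun s ↦ flat (C' s)) (uIcc 0 t) :=
      (flatL E).continuous.comp_continuousOn hC'
    exact h2.clm_comp h3
  obtain ⟨K, hK⟩ := isCompact_uIcc.exists_bound_of_continuousOn hA
  have hZ0 : Z 0 = 0 := by
    simp only [Z, hC0, hτ0, onePlus_zero, ContinuousLinearMap.comp_id]
    exact sub_self (sharp π)
  have hzero : Z t = 0 := eq_zero_of_norm_deriv_le (V := (E →L[ℝ] ℝ) →L[ℝ] E) hZ (K := K)
    (fun s hs ↦ le_of_eq_of_le (norm_neg (A s ∘L Z s))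
      ((ContinuousLinearMap.opNorm_comp_le _ _).trans
        (mul_le_mul_of_nonneg_right (hK s hs) (norm_nonneg _)))) hZ0
  exact eq_expBivector hinv (sub_eq_zero.1 hzero)

variable {M : Type*} [TopologicalSpace M] [ChartedSpace E M] [IsManifold 𝓘(ℝ, E) ∞ M] [T2Space M]
  {B : FormField E M 2} {X : VectorFieldOn E M} {H : FormField E M 3} {π : BivectorField E M}
  {D : ℝ → FormField E M 2}

theorem mem_gaugeCurveDomain_iff (hX : IsSmoothVectorField X) {t : ℝ} {y : M} :
    (t, y) ∈ gaugeCurveDomain B X H π D ↔ (-t, y) ∈ flowDomain X ∧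
      (t, flow X (-t) y) ∈ expDomain (formC B X H D) π (flowDomain X) := by
  refine ⟨fun h ↦ ⟨h.1, ?_, h.2⟩, fun h ↦ ⟨h.1, h.2.2⟩⟩
  have h1 := (flow_neg_flow hX h.1).1
  rwa [neg_neg] at h1

theorem isOpen_gaugeCurveDomain (hB : IsSmoothForm B) (hX : IsSmoothVectorField X)
    (hH : IsSmoothForm H) (hπ : IsSmoothBivectorField π) (hD : IsPrimitiveD B X D) :
    IsOpen (gaugeCurveDomain B X H π D) := by
  have ho := isOpen_expDomain (isOpen_flowDomain hX) (isSmoothFormFamilyOn_formC hB hX hH hD) hπ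
  refine isOpen_iff_mem_nhds.2 fun ⟨t, y⟩ hp ↦ ?_
  rw [mem_gaugeCurveDomain_iff hX] at hp
  have hneg : Continuous fun p : ℝ × M ↦ (-p.1, p.2) := by fun_prop
  have h1 : ContinuousAt (fun p : ℝ × M ↦ (p.1, flow X (-p.1) p.2)) (t, y) :=
    continuousAt_fst.prodMk (ContinuousAt.comp (f := fun p : ℝ × M ↦ (-p.1, p.2))
      (g := fun p : ℝ × M ↦ flow X p.1 p.2) (contMDiffAt_flow hX hp.1).continuousAt
      hneg.continuousAt)
  filter_upwards [hneg.continuousAt.eventually ((isOpen_flowDomain hX).mem_nhds hp.1),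
    h1.eventually (ho.mem_nhds hp.2)] with q hq hq'
  exact (mem_gaugeCurveDomain_iff hX).2 ⟨hq, hq'⟩

theorem isSmoothBivectorFamilyOn_gaugeCurve (hB : IsSmoothForm B) (hX : IsSmoothVectorField X)
    (hH : IsSmoothForm H) (hπ : IsSmoothBivectorField π) (hD : IsPrimitiveD B X D) :
    IsSmoothBivectorFamilyOn (fun t ↦ (gaugeCurve B X H π D t).2) (gaugeCurveDomain B X H π D) := by
  rintro x₀ ⟨t, v⟩ ⟨hv, hp⟩
  rw [mem_gaugeCurveDomain_iff hX] at hp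
  dsimp only at hv hp
  have hC := isSmoothFormFamilyOn_formC hB hX hH hD
  have ho := isOpen_expDomain (isOpen_flowDomain hX) hC hπ
  refine ContDiffAt.contDiffWithinAt ?_
  set x := flow X (-t) ((extChartAt 𝓘(ℝ, E) x₀).symm v) with hx
  have hpd : (-t, v) ∈ flowChartDomain X x₀ x := ⟨hv, hp.1, mem_extChartAt_source x⟩
  refine contDiffAt_flowPushforward hX (ρ := fun t x ↦ expBivector (formC B X H D t x) (π x)) hpd
    ((isSmoothBivectorFamilyOn_expBivector (isOpen_flowDomain hX) hC hπ x).contDiffAt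
      ((isOpen_inChart x ho).mem_nhds ⟨flowInChart_mem_target hpd, ?_⟩))
  have h1 : (extChartAt 𝓘(ℝ, E) x).symm (flowInChart X x₀ x (-t, v)) = x :=
    (extChartAt 𝓘(ℝ, E) x).left_inv hpd.2.2
  dsimp only
  rw [h1]
  exact hp.2

/-- The derivative of `σ_t = (φ_t)_* e^{C_t} π`: pulled back along the flow, `σ` is `e^{C_s} π` at
`x = φ_{-t}(y)`. -/
theorem hasDerivAt_gaugeCurve_snd (hB : IsSmoothForm B) (hX : IsSmoothVectorField X)
    (hH : IsSmoothForm H) (hπ : IsSmoothBivectorField π) (hD : IsPrimitiveD B X D) {t : ℝ} {y : M}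
    (hp : (t, y) ∈ gaugeCurveDomain B X H π D) :
    HasDerivAt (fun s ↦ (gaugeCurve B X H π D s).2 y)
      ((gaugeField B X (gaugeCurve B X H π D t)).2 y) t := by
  have hW := isOpen_gaugeCurveDomain hB hX hH hπ hD
  have hσ := isSmoothBivectorFamilyOn_gaugeCurve hB hX hH hπ hD
  obtain ⟨hy, hx, hinv⟩ := (mem_gaugeCurveDomain_iff hX).1 hp
  dsimp only at hinv
  set x := flow X (-t) y with hxdef
  have hxy : flow X t x = y := by
    have h1 := (flow_neg_flow hX hy).2
    rwa [neg_neg] at h1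
  -- smoothness provides some derivative `σ'`, and the pulled-back family determines it
  have hσ' := ((hσ.contDiffAt hW hp).differentiableAt (by simp)).hasDerivAt
  set σ' := deriv (fun s ↦ (gaugeCurve B X H π D s).2 y) t
  have h1 := hasDerivAt_flowPushforward_neg hX hW hσ hx (by rwa [hxy]) (by rw [hxy]; exact hσ')
  have hev : ∀ᶠ s in 𝓝 t, expBivector (formC B X H D s x) (π x) =
      flowPushforward X (-s) (gaugeCurve B X H π D s).2 x := by
    filter_upwards [(isOpen_flowDomain_section hX x).mem_nhds hx] with s hs
    have h2 := flowPushforward_flowPushforward_neg hX (t := -s) (y := x)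
      (fun x ↦ expBivector (formC B X H D s x) (π x)) (by rwa [neg_neg])
    rw [neg_neg] at h2
    exact h2.symm
  have h2 := (h1.congr_of_eventuallyEq hev).unique
    (hasDerivAt_expBivector (hasDerivAt_formC hB hX hH hD hx) hinv)
  have h3 := congrArg (pushBivector (tangentMapAt E (flow X t) x)) h2
  rw [pushBivector_comp, tangentMapAt_flow_comp_neg hX hx, pushBivector_id, velocityC,
    flowPullback, ← wedgeTwo_pushBivector, hxy] at h3
  rw [eq_sub_of_add_eq h3] at hσ'
  rwa [sub_eq_neg_add] at hσ'

theorem isGaugeIntegralCurveOn_gaugeCurve (hB : IsSmoothForm B) (hX : IsSmoothVectorField X)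
    (hH : IsSmoothForm H) (hπ : IsSmoothBivectorField π) (hD : IsPrimitiveD B X D) :
    IsGaugeIntegralCurveOn B X (gaugeCurve B X H π D) (gaugeCurveDomain B X H π D) where
  isOpen := isOpen_gaugeCurveDomain hB hX hH hπ hD
  smooth_form x₀ := by
    have h1 : ∀ {β : FormField E M 3}, IsSmoothForm β → ContDiffOn ℝ ∞
        (fun p : ℝ × E ↦ formInChart x₀ β p.2) (inChart x₀ (gaugeCurveDomain B X H π D)) :=
      fun hβ ↦ (hβ x₀).comp contDiffOn_snd fun _ hp ↦ hp.1
    exact (h1 hH).sub (contDiffOn_fst.smul (h1 (isSmoothForm_deRham hB)))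
  smooth_bivector := isSmoothBivectorFamilyOn_gaugeCurve hB hX hH hπ hD
  deriv_form t y _ := by
    have h1 := ((hasDerivAt_id t).smul_const (deRham B y)).const_sub (H y)
    rwa [one_smul] at h1
  deriv_bivector _ _ hp := hasDerivAt_gaugeCurve_snd hB hX hH hπ hD hp

theorem gaugeCurve_zero (hX : IsSmoothVectorField X) (hD : IsPrimitiveD B X D) :
    gaugeCurve B X H π D 0 = (H, π) := by
  have h1 : flow X 0 = id := funext (flow_zero hX)
  refine Prod.ext (funext fun y ↦ by simp [gaugeCurve]) (funext fun y ↦ ?_)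
  simp only [gaugeCurve, flowPushforward, neg_zero, formC_zero hD, expBivector_zero, h1,
    tangentMapAt_id, pushBivector_id, id]

omit [IsManifold 𝓘(ℝ, E) ∞ M] [T2Space M] in
theorem IsGaugeIntegralCurveOn.fst_eq {J : Set ℝ} (hJ : IsOpen J) (hJc : J.OrdConnected)
    (h0 : (0 : ℝ) ∈ J) {c : ℝ → FormField E M 3 × BivectorField E M}
    (hc : IsGaugeIntegralCurveOn B X c (J ×ˢ (univ : Set M))) (hc0 : (c 0).1 = H) {t : ℝ}
    (ht : t ∈ J) (y : M) : (c t).1 y = H y - t • deRham B y := by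
  have hd : ∀ s ∈ J, HasDerivAt (fun s ↦ (c s).1 y + s • deRham B y) 0 s := by
    intro s hs
    have h1 := (hc.deriv_form s y ⟨hs, mem_univ y⟩).add
      ((hasDerivAt_id s).smul_const (deRham B y))
    have h2 : (gaugeField B X (c s)).1 y + (1 : ℝ) • deRham B y = 0 := by
      simp [gaugeField]
    rwa [h2] at h1
  have h1 := hJ.is_const_of_deriv_eq_zero hJc.isPreconnected
    (fun s hs ↦ (hd s hs).differentiableAt.differentiableWithinAt) (fun s hs ↦ (hd s hs).deriv)
    ht h0
  rw [zero_smul, add_zero, hc0] at h1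
  exact eq_sub_of_add_eq h1

/-- Uniqueness: pulled back along the orbit of `x = φ_{-t}(y)`, the bivector part of an integral
curve solves `dτ/ds = ∧²τ̃ (dC/ds)`. -/
theorem IsGaugeIntegralCurveOn.eq_gaugeCurve (hB : IsSmoothForm B) (hX : IsSmoothVectorField X)
    (hH : IsSmoothForm H) (hD : IsPrimitiveD B X D) {J : Set ℝ}
    (hJ : IsOpen J) (hJc : J.OrdConnected) (h0 : (0 : ℝ) ∈ J)
    (hJW : J ×ˢ (univ : Set M) ⊆ gaugeCurveDomain B X H π D)
    {c : ℝ → FormField E M 3 × BivectorField E M}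
    (hc : IsGaugeIntegralCurveOn B X c (J ×ˢ (univ : Set M))) (hc0 : c 0 = (H, π)) {t : ℝ}
    (ht : t ∈ J) : c t = gaugeCurve B X H π D t := by
  have hfst : ∀ s ∈ J, ∀ y, (c s).1 y = H y - s • deRham B y := fun s hs y ↦
    hc.fst_eq hJ hJc h0 (by rw [hc0]) hs y
  refine Prod.ext (funext (hfst t ht)) (funext fun y ↦ ?_)
  obtain ⟨hy, hx, hinv⟩ := (mem_gaugeCurveDomain_iff hX).1 (hJW ⟨ht, mem_univ y⟩)
  dsimp only at hinv
  set x := flow X (-t) y with hxdef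
  have hJt : ∀ s ∈ uIcc 0 t, s ∈ J := fun s hs ↦ hJc.uIcc_subset h0 ht hs
  have hτ : ∀ s ∈ uIcc 0 t, HasDerivAt (fun s ↦ flowPushforward X (-s) (c s).2 x)
      (wedgeTwo (flowPushforward X (-s) (c s).2 x) (velocityC B X H s x)) s := by
    intro s hs
    have hxs := flowDomain_of_mem hx hs
    have hmem : (s, flow X s x) ∈ J ×ˢ (univ : Set M) := ⟨hJt s hs, mem_univ _⟩
    have h1 := hasDerivAt_flowPushforward_neg hX hc.isOpen hc.smooth_bivector hxs hmem
      (hc.deriv_bivector s _ hmem)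
    have hbeta : B (flow X s x) - contractField X (c s).1 (flow X s x) =
        B (flow X s x) - contractField X (fun z ↦ H z - s • deRham B z) (flow X s x) := by
      rw [contractField, contractField, hfst s (hJt s hs)]
    have hpull : (c s).2 (flow X s x) = pushBivector (tangentMapAt E (flow X s) x)
        (flowPushforward X (-s) (c s).2 x) := by
      rw [flowPushforward, neg_neg, pushBivector_comp, tangentMapAt_flow_comp_neg hX hxs,
        pushBivector_id]
    have h2 : (gaugeField B X (c s)).2 (flow X s x) + schouten X (c s).2 (flow X s x) =
        pushBivector (tangentMapAt E (flow X s) x)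
          (wedgeTwo (flowPushforward X (-s) (c s).2 x) (velocityC B X H s x)) := by
      rw [velocityC, flowPullback, ← wedgeTwo_pushBivector, ← hpull, ← hbeta]
      simp only [gaugeField]
      abel
    rwa [h2, pushBivector_comp, tangentMapAt_flow_neg_comp hX hxs, pushBivector_id] at h1
  have hτ0 : flowPushforward X (-0) (c 0).2 x = π x := by
    have h1 : flow X 0 = id := funext (flow_zero hX)
    rw [flowPushforward, neg_neg, neg_zero, h1, tangentMapAt_id, pushBivector_id, hc0]
    rfl
  have h1 := eq_expBivector_of_hasDerivAt hτ
    (fun s hs ↦ hasDerivAt_formC hB hX hH hD (flowDomain_of_mem hx hs))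
    ((isSmoothFormFamilyOn_velocityC hB hX hH).continuousOn_uIcc hX hx)
    (formC_zero hD x) hτ0 hinv
  have h2 := flowPushforward_flowPushforward_neg hX (c t).2 hy
  rw [← h2, gaugeCurve, flowPushforward, ← hxdef, h1]
  rfl

end Curve

end TwistedPoisson

end

open TwistedPoisson
theorem mainTheorem10 {E : Type*} [NormedAddCommGroup E] [NormedSpace ℝ E] [FiniteDimensional ℝ E]
    {M : Type*} [TopologicalSpace M] [T2Space M] [ChartedSpace E M] [IsManifold 𝓘(ℝ, E) ∞ M]
    (B : FormField E M 2) (hB : IsSmoothForm B)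
    (X : VectorFieldOn E M) (hX : IsSmoothVectorField X)
    (H : FormField E M 3) (hH : IsSmoothForm H)
    (π : BivectorField E M) (hπ : IsSmoothBivectorField π) :
    -- existence and uniqueness of `D_t`
    (∃ D, IsPrimitiveD B X D) ∧
    (∀ D D', IsPrimitiveD B X D → IsPrimitiveD B X D' →
      ∀ t x, (t, x) ∈ flowDomain X → D t x = D' t x) ∧
    ∀ D, IsPrimitiveD B X D →
      -- the curve starts at `(H, π)`
      (∀ y, ((0 : ℝ), y) ∈ gaugeCurveDomain B X H π D) ∧
      gaugeCurve B X H π D 0 = (H, π) ∧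
      -- it is an integral curve as long as it is defined
      IsGaugeIntegralCurveOn B X (gaugeCurve B X H π D) (gaugeCurveDomain B X H π D) ∧
      -- and it is the only one on each time interval on which it is defined on all of `M`
      ∀ J : Set ℝ, IsOpen J → J.OrdConnected → (0 : ℝ) ∈ J →
        J ×ˢ (Set.univ : Set M) ⊆ gaugeCurveDomain B X H π D →
        ∀ c, IsGaugeIntegralCurveOn B X c (J ×ˢ (Set.univ : Set M)) → c 0 = (H, π) →
          ∀ t ∈ J, c t = gaugeCurve B X H π D t := by
  refine ⟨exists_isPrimitiveD hB hX, fun D D' hD hD' t x h ↦ ?_, fun D hD ↦ ⟨fun y ↦ ?_,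
    gaugeCurve_zero hX hD, isGaugeIntegralCurveOn_gaugeCurve hB hX hH hπ hD, ?_⟩⟩
  · rw [hD.eq_integral hB hX h, hD'.eq_integral hB hX h]
  · refine ⟨?_, ?_⟩
    · dsimp only
      rw [neg_zero]
      exact zero_mem_flowDomain hX y
    · dsimp only
      rw [formC_zero hD]
      exact isInvertible_onePlus_zero _
  · intro J hJ hJc h0 hJW c hc hc0 t ht
    exact hc.eq_gaugeCurve hB hX hH hD hJ hJc h0 hJW hc0 ht
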